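/- Let $n\in\mathbb N$, $m>0$, $s\in\mathbb R$, and let $\epsilon(\xi)=\sqrt{m^2+|\xi|^2}$. For $\sigma\in\mathbb R$ let $H^\sigma$ be the space of real tempered distributions $\varphi$ on $\mathbb R^n$ with $\epsilon^\sigma\hat\varphi\in L^2$, normed by $\|\varphi\|_{H^\sigma}=\|\epsilon^\sigma\hat\varphi\|_{L^2}$, and give $H^{s+1}\times H^s$ the norm $(\|\Phi_0\|^2+\|\Phi_1\|^2)^{1/2}$. Let $(\mathcal V_q)_{q\ge 0}$ be continuous symmetric $q$-linear maps from $H^{s+1}\times H^s$ to $H^s$ with norms $\|\mathcal V_q\|$, such that $X(z)=\sum_q\|\mathcal V_q\|z^q$ has radius of convergence $r_0\in(0,\infty]$; put $\mathcal V(\Phi)=\sum_q\mathcal V_q(\Phi^{\otimes q})$ for $\|\Phi\|<r_0$. For $\tau\ge0$ let $e^{\pm\tau X}(z)$ be the value at time $\tau$ of the solution of $\gamma'=\pm X(\gamma)$, $\gamma(0)=z$, in $[0,r_0)$ ($=+\infty$ if there is no such solution up to time $\tau$). Let $\mathcal E_0^{s+1}$ be the space of $\varphi\in C^0(\mathbb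 R,H^{s+1})\cap C^1(\mathbb R,H^s)$ with $\Box\varphi+m^2\varphi=0$ ($\Box=\partial_t^2-\Delta$), with Cauchy data $[\varphi]_t=(\varphi(t),\partial_t\varphi(t))$ and the norm $\|\varphi\|=(\|\varphi(t)\|_{H^{s+1}}^2+\|\partial_t\varphi(t)\|_{H^s}^2)^{1/2}$, which does not depend on $t$. For $\rho>0$ let $\mathbb F_\rho$ be the space of formal series $|f\rangle=\sum_pf_p$ of continuous symmetric $p$-linear forms on $\mathcal E_0^{s+1}$ with $N_\rho(f)=\sum_p\|f_p\|\rho^p<\infty$, and $\langle 0|f\rangle=f_0$. For $\psi\in\mathcal E_0^{s+1}$ let $\frac{\delta f}{\delta\psi}(\varphi)=\sum_{p\ge 1}p\,f_p(\psi\otimes\varphi^{\otimes(p-1)})$. For $v\in H^s$ let $v\sharp_tG\in\mathcal E_0^{s+1}$ be the solution with Cauchy data $(0,-v)$ at time $t$, and set $$\Big(\int_t\mathcal V(\phi^\triangleright,\partial_t\phi^\triangleright)\phi^\triangleleft\,f\Big)(\varphi)=\frac{\delta f}{\delta(\mathcal V([\varphi]_t)\sharp_tG)}(\varphi),\qquad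 \mathbb D(t)=-\int_t\mathcal V(\phi^\triangleright,\partial_t\phi^\triangleright)\phi^\triangleleft .$$ For $u\in C^0(I,H^{s+1})\cap C^1(I,H^s)$ on an open interval $I$ and $t\in I$ write $[u]_t=(u(t),\partial_tu(t))$, $\|[u]_t\|_{s+1}=\|u(t)\|_{H^{s+1}}+\|\partial_tu(t)\|_{H^s}$, and $\int_tu\overleftrightarrow{\partial}\phi^\triangleleft=\frac{\delta}{\delta\psi}$, where $\psi\in\mathcal E_0^{s+1}$ is the solution with $[\psi]_t=[u]_t$. Finally $$T\exp\Big(\int_0^t\mathbb D\Big)|f\rangle=\sum_{k\ge0}\int_0^tds_1\int_0^{s_1}ds_2\cdots\int_0^{s_{k-1}}ds_k\,\mathbb D(s_1)\cdots\mathbb D(s_k)|f\rangle ,$$ the integrals being taken after evaluation on elements of $\mathcal E_0^{s+1}$. **Theorem.** Let $I\subseteq\mathbb R$ be an open interval, $u\in C^0(I,H^{s+1})\cap C^1(I,H^s)$, and let $J\subseteq I$ be an interval (for instance $J=I$, or $J=I\cap[0,\infty)$). Let $r\in(0,r_0)$ be such that $$\sup_{t\in J}e^{|t|X}\big(\|[u]_t\|_{s+1}\big)<r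 .$$ Then for all $|f\rangle\in\mathbb F_r$ and all $t\in J$ the quantity $$\alpha(t)=\langle0|\exp\Big(\int_tu\overleftrightarrow{\partial}\phi^\triangleleft\Big)\,T\exp\Big(-\int_0^tds\int_s\mathcal V(\phi^\triangleright,\partial_t\phi^\triangleright)\phi^\triangleleft\Big)|f\rangle$$ is well defined: with $\rho=e^{-|t|X}(r)$ one has $\rho>\|[u]_t\|_{s+1}$, the time ordered exponential applied to $|f\rangle$ converges absolutely in $\mathbb F_\rho$, and the exponential of $\int_tu\overleftrightarrow{\partial}\phi^\triangleleft$ applied to the result converges absolutely in $\mathbb F_{\rho-\|[u]_t\|_{s+1}}$. If moreover $\Box u+m^2u+\mathcal V(u,\partial_tu)=0$ in the sense of distributions on $\mathring J\times\mathbb R^n$, where $\mathring J$ is the interior of $J$, then $\alpha(t)$ does not depend on $t\in J$. -/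

import Mathlib

open MeasureTheory TemperedDistribution Filter Topology
open scoped SchwartzMap FourierTransform Laplacian ENNReal ContDiff

namespace KleinGordon

/-! ### Sobolev spaces with the Klein-Gordon weight -/

/-- The space `ℝⁿ`. -/
abbrev Space (n : ℕ) : Type := EuclideanSpace ℝ (Fin n)

/-- The weight `ε(ξ) ^ s` with `ε(ξ) = √(m² + |ξ|²)`, written in the frequency variable of
Mathlib's Fourier transform, whose kernel is `exp (-2πi x·ξ)`. With the unitary normalisation
`(2π)^(-n/2) ∫ f(x) exp (-i x·ξ) dx` the weight is `(m² + |ξ|²) ^ (s/2)`, and the two weighted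
`L²` norms agree by the change of variables `ξ ↦ 2πξ`. -/
noncomputable def weight (n : ℕ) (m s : ℝ) : Space n → ℂ :=
  fun ξ => (((m ^ 2 + (2 * Real.pi * ‖ξ‖) ^ 2) ^ (s / 2) : ℝ) : ℂ)

theorem base_pos (n : ℕ) {m : ℝ} (hm : 0 < m) (ξ : Space n) :
    0 < m ^ 2 + (2 * Real.pi * ‖ξ‖) ^ 2 := by positivity

theorem weight_temperate (n : ℕ) {m : ℝ} (hm : 0 < m) (s : ℝ) :
    (weight n m s).HasTemperateGrowth := by
  have h1 : (fun ξ : Space n => (1 + ‖ξ‖ ^ 2) ^ (s / 2)).HasTemperateGrowth :=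
    Function.hasTemperateGrowth_one_add_norm_sq_rpow _ _
  have h2 : (fun ξ : Space n => (2 * Real.pi / m) • ξ).HasTemperateGrowth :=
    ((2 * Real.pi / m) • ContinuousLinearMap.id ℝ (Space n)).hasTemperateGrowth
  have h3 := h1.comp h2
  have h4 : (fun ξ : Space n => ((m ^ 2) ^ (s / 2) : ℝ) *
      (1 + ‖(2 * Real.pi / m) • ξ‖ ^ 2) ^ (s / 2)).HasTemperateGrowth :=
    (Function.HasTemperateGrowth.const _).mul h3
  have h5 : weight n m s = fun ξ => Complex.ofReal (((m ^ 2) ^ (s / 2) : ℝ) *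
      (1 + ‖(2 * Real.pi / m) • ξ‖ ^ 2) ^ (s / 2)) := by
    funext ξ
    have hpi := Real.pi_pos
    rw [weight, ← Real.mul_rpow (by positivity) (by positivity), norm_smul, Real.norm_eq_abs,
      abs_of_pos (by positivity : 0 < 2 * Real.pi / m)]
    congr 2
    field_simp
  rw [h5]
  exact Function.HasTemperateGrowth.comp Function.Complex.hasTemperateGrowth_ofReal h4

theorem weight_mul (n : ℕ) {m : ℝ} (hm : 0 < m) (s s' : ℝ) :
    weight n m s * weight n m s' = weight n m (s + s') := by
  funext ξ
  simp only [weight, Pi.mul_apply]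
  rw [← Complex.ofReal_mul, ← Real.rpow_add (base_pos n hm ξ)]
  congr 2
  ring

theorem weight_zero (n : ℕ) (m : ℝ) : weight n m 0 = fun _ => 1 := by
  funext ξ
  simp [weight]

theorem weight_cancel {n : ℕ} {m : ℝ} (hm : 0 < m) (s : ℝ) (T : 𝓢'(Space n, ℂ)) :
    smulLeftCLM ℂ (weight n m (-s)) (smulLeftCLM ℂ (weight n m s) T) = T := by
  rw [smulLeftCLM_smulLeftCLM_apply (weight_temperate n hm s) (weight_temperate n hm (-s)),
    weight_mul n hm, add_neg_cancel, weight_zero, smulLeftCLM_const, one_smul]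

/-- A tempered distribution is real if it takes real values on real test functions. -/
def IsRealDistribution {n : ℕ} (T : 𝓢'(Space n, ℂ)) : Prop :=
  ∀ ψ : 𝓢(Space n, ℂ), (∀ x, (ψ x).im = 0) → (T ψ).im = 0

/-- `g ∈ L²` represents `ε ^ s • 𝓕 T`. -/
def IsSymbol {n : ℕ} (m s : ℝ) (T : 𝓢'(Space n, ℂ)) (g : Lp ℂ 2 (volume : Measure (Space n))) :
    Prop :=
  smulLeftCLM ℂ (weight n m s) (𝓕 T) = (g : 𝓢'(Space n, ℂ))

theorem toTD_injective {n : ℕ} {g g' : Lp ℂ 2 (volume : Measure (Space n))}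
    (h : (g : 𝓢'(Space n, ℂ)) = (g' : 𝓢'(Space n, ℂ))) : g = g' := by
  have := LinearMap.ker_eq_bot.mp
    (MeasureTheory.Lp.ker_toTemperedDistributionCLM_eq_bot (F := ℂ)
      (μ := (volume : Measure (Space n))) (p := 2))
  exact this (by simpa using h)

theorem IsSymbol.add {n : ℕ} {m s : ℝ} {T T' : 𝓢'(Space n, ℂ)}
    {g g' : Lp ℂ 2 (volume : Measure (Space n))} (h : IsSymbol m s T g) (h' : IsSymbol m s T' g') :
    IsSymbol m s (T + T') (g + g') := by
  unfold IsSymbol at *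
  rw [← Lp.toTemperedDistributionCLM_apply] at *
  rw [FourierTransform.fourier_add, map_add, map_add, h, h']

theorem IsSymbol.smul {n : ℕ} {m s : ℝ} {T : 𝓢'(Space n, ℂ)}
    {g : Lp ℂ 2 (volume : Measure (Space n))} (c : ℝ) (h : IsSymbol m s T g) :
    IsSymbol m s (c • T) (c • g) := by
  unfold IsSymbol at *
  have e1 : c • T = (c : ℂ) • T := rfl
  have e2 : c • g = (c : ℂ) • g := by
    ext1
    filter_upwards [Lp.coeFn_smul c g, Lp.coeFn_smul (c : ℂ) g] with x h1 h2
    rw [h1, h2]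
    simp
  rw [e1, e2, FourierTransform.fourier_smul, map_smul, h]
  rw [← Lp.toTemperedDistributionCLM_apply, ← Lp.toTemperedDistributionCLM_apply, map_smul]

theorem IsSymbol.zero (n : ℕ) (m s : ℝ) : IsSymbol m s (0 : 𝓢'(Space n, ℂ)) 0 := by
  unfold IsSymbol
  rw [← Lp.toTemperedDistributionCLM_apply, map_zero]
  have h : 𝓕 (0 : 𝓢'(Space n, ℂ)) = 0 := by
    ext ψ
    simp
  rw [h, map_zero]

/-- The real Sobolev space `H^s(ℝⁿ)`: real tempered distributions `T` with `ε ^ s • 𝓕 T ∈ L²`. -/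
def sobolevSubmodule (n : ℕ) (m s : ℝ) : Submodule ℝ 𝓢'(Space n, ℂ) where
  carrier := {T | IsRealDistribution T ∧ ∃ g, IsSymbol m s T g}
  zero_mem' := ⟨fun _ _ => rfl, 0, IsSymbol.zero n m s⟩
  add_mem' := by
    rintro T T' ⟨hT, g, hg⟩ ⟨hT', g', hg'⟩
    exact ⟨fun ψ hψ => by simp [hT ψ hψ, hT' ψ hψ], g + g', hg.add hg'⟩
  smul_mem' := by
    rintro c T ⟨hT, g, hg⟩
    exact ⟨fun ψ hψ => by simp [hT ψ hψ], c • g, hg.smul c⟩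

/-- `H^s(ℝⁿ)` as a type of its own, so that it carries its own norm topology and not the one it
would inherit from the space of tempered distributions. -/
def Sobolev (n : ℕ) (m s : ℝ) : Type := sobolevSubmodule n m s

noncomputable instance (n : ℕ) (m s : ℝ) : AddCommGroup (Sobolev n m s) :=
  inferInstanceAs (AddCommGroup (sobolevSubmodule n m s))

noncomputable instance (n : ℕ) (m s : ℝ) : Module ℝ (Sobolev n m s) :=
  inferInstanceAs (Module ℝ (sobolevSubmodule n m s))

/-- The tempered distribution underlying an element of `H^s`. -/
noncomputable def toDist {n : ℕ} {m s : ℝ} : Sobolev n m s →ₗ[ℝ] 𝓢'(Space n, ℂ) :=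
  (sobolevSubmodule n m s).subtype

/-- The linear map `T ↦ ε ^ s • 𝓕 T` from `H^s` to `L²`. -/
noncomputable def symbol {n : ℕ} {m s : ℝ} :
    Sobolev n m s →ₗ[ℝ] Lp ℂ 2 (volume : Measure (Space n)) where
  toFun T := T.2.2.choose
  map_add' T T' := toTD_injective <|
    ((T + T').2.2.choose_spec).symm.trans (T.2.2.choose_spec.add T'.2.2.choose_spec)
  map_smul' c T := toTD_injective <|
    ((c • T).2.2.choose_spec).symm.trans (T.2.2.choose_spec.smul c)

theorem symbol_spec {n : ℕ} {m s : ℝ} (T : Sobolev n m s) : IsSymbol m s (toDist T) (symbol T) :=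
  T.2.2.choose_spec

theorem toDist_eq {n : ℕ} {m s : ℝ} (hm : 0 < m) (T : Sobolev n m s) :
    toDist T = 𝓕⁻ (smulLeftCLM ℂ (weight n m (-s)) (symbol T : 𝓢'(Space n, ℂ))) := by
  have h : smulLeftCLM ℂ (weight n m s) (𝓕 (toDist T)) = (symbol T : 𝓢'(Space n, ℂ)) :=
    symbol_spec T
  rw [← h, weight_cancel hm, FourierTransform.fourierInv_fourier_eq]

theorem symbol_injective (n : ℕ) {m : ℝ} (hm : 0 < m) (s : ℝ) :
    Function.Injective (symbol (n := n) (m := m) (s := s)) := by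
  intro T T' h
  apply Subtype.ext
  change toDist T = toDist T'
  rw [toDist_eq hm, toDist_eq hm, h]

/-- The norm `‖T‖ = ‖ε ^ s • 𝓕 T‖` of `H^s`, the norm on the right being that of `L²`. -/
noncomputable instance (n : ℕ) (m s : ℝ) [hm : Fact (0 < m)] : NormedAddCommGroup (Sobolev n m s) :=
  NormedAddCommGroup.induced _ _ symbol (symbol_injective n hm.out s)

noncomputable instance (n : ℕ) (m s : ℝ) [Fact (0 < m)] : NormedSpace ℝ (Sobolev n m s) :=
  NormedSpace.induced ℝ _ _ symbol

theorem norm_eq_norm_symbol {n : ℕ} {m s : ℝ} [Fact (0 < m)] (T : Sobolev n m s) :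
    ‖T‖ = ‖symbol T‖ := rfl

theorem continuous_toDist_apply {n : ℕ} {m s : ℝ} [hm : Fact (0 < m)] (ψ : 𝓢(Space n, ℂ)) :
    Continuous fun T : Sobolev n m s => toDist T ψ := by
  have h1 : Continuous (symbol (n := n) (m := m) (s := s)) :=
    (AddMonoidHomClass.isometry_of_norm (symbol (n := n) (m := m) (s := s))
      fun T => (norm_eq_norm_symbol T).symm).continuous
  have h2 : (fun T : Sobolev n m s => toDist T ψ) = fun T =>
      (smulLeftCLM ℂ (weight n m (-s)) (Lp.toTemperedDistributionCLM ℂ volume 2 (symbol T)))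
        (𝓕⁻ ψ) := by
    funext T
    rw [toDist_eq hm.out, fourierInv_apply]
    rfl
  rw [h2]
  exact (continuous_eval_const (𝓕⁻ ψ)).comp
    (((smulLeftCLM ℂ (weight n m (-s))).continuous.comp
      (Lp.toTemperedDistributionCLM ℂ volume 2).continuous).comp h1)

theorem sobolev_mono (n : ℕ) (m s : ℝ) [hm : Fact (0 < m)] :
    sobolevSubmodule n m (s + 1) ≤ sobolevSubmodule n m s := by
  rintro T ⟨hT, g, hg⟩
  refine ⟨hT, ?_⟩
  have hb : ∀ ξ, ‖weight n m (-1) ξ‖ ≤ (m ^ 2) ^ ((-1 : ℝ) / 2) := by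
    intro ξ
    rw [weight, Complex.norm_real, Real.norm_eq_abs,
      abs_of_nonneg (Real.rpow_nonneg (base_pos n hm.out ξ).le _)]
    have := hm.out
    exact Real.rpow_le_rpow_of_nonpos (by positivity) (by nlinarith [sq_nonneg (2 * Real.pi * ‖ξ‖)])
      (by norm_num)
  have ht := weight_temperate n hm.out (-1)
  have hl : MemLp (weight n m (-1)) ∞ (volume : Measure (Space n)) :=
    memLp_top_of_bound ht.1.continuous.aestronglyMeasurable _ (Eventually.of_forall hb)
  refine ⟨(hl.toLp _ • g : Lp ℂ 2 volume), ?_⟩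
  have hg' : smulLeftCLM ℂ (weight n m (s + 1)) (𝓕 T) = (g : 𝓢'(Space n, ℂ)) := hg
  unfold IsSymbol
  rw [MeasureTheory.Lp.toTemperedDistribution_smul_eq ht, ← hg',
    smulLeftCLM_smulLeftCLM_apply (weight_temperate n hm.out (s + 1)) ht, weight_mul n hm.out]
  congr 3
  ring

/-- The inclusion `H^(s+1) ⊆ H^s`. -/
noncomputable def incl {n : ℕ} {m s : ℝ} [Fact (0 < m)] :
    Sobolev n m (s + 1) →ₗ[ℝ] Sobolev n m s :=
  Submodule.inclusion (sobolev_mono n m s)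

/-- The space of Cauchy data `H^(s+1) × H^s`, with the norm `(‖Φ₀‖² + ‖Φ₁‖²) ^ (1/2)`. -/
abbrev Data (n : ℕ) (m s : ℝ) [Fact (0 < m)] : Type :=
  WithLp 2 (Sobolev n m (s + 1) × Sobolev n m s)

/-! ### Curves of distributions, the Klein-Gordon equation, and the space of free solutions -/

/-- `u ∈ C⁰(I, H^(s+1)) ∩ C¹(I, H^s)`, for an open set `I` of times. -/
def TimeRegular {n : ℕ} {m s : ℝ} [Fact (0 < m)] (I : Set ℝ) (u : ℝ → Sobolev n m (s + 1)) :
    Prop :=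
  ContinuousOn u I ∧ ContDiffOn ℝ 1 (fun t => (incl (u t) : Sobolev n m s)) I

/-- The time derivative `∂u/∂t`, in `H^s`. -/
noncomputable def timeDeriv {n : ℕ} {m s : ℝ} [Fact (0 < m)] (u : ℝ → Sobolev n m (s + 1)) (t : ℝ) :
    Sobolev n m s :=
  deriv (fun τ => (incl (u τ) : Sobolev n m s)) t

/-- The Cauchy data `[u]_t = (u(t), ∂u/∂t(t))`. -/
noncomputable def cauchyData {n : ℕ} {m s : ℝ} [Fact (0 < m)] (u : ℝ → Sobolev n m (s + 1))
    (t : ℝ) : Data n m s :=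
  WithLp.toLp 2 (u t, timeDeriv u t)

/-- The size `‖[u]_t‖_{s+1} = ‖u(t)‖_{H^(s+1)} + ‖∂u/∂t(t)‖_{H^s}`. -/
noncomputable def cauchySize {n : ℕ} {m s : ℝ} [Fact (0 < m)] (u : ℝ → Sobolev n m (s + 1))
    (t : ℝ) : ℝ :=
  ‖u t‖ + ‖timeDeriv u t‖

/-- `□u + m²u + J = 0` in the sense of distributions on `I × ℝⁿ`, where `□ = ∂²/∂t² - Δ`. It is
enough to test against the products `χ(t) ψ(x)` of test functions, since their linear span is dense
in the space of test functions on `I × ℝⁿ`. -/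
def IsWeakSolution {n : ℕ} {m s : ℝ} (I : Set ℝ) (u : ℝ → Sobolev n m (s + 1))
    (J : ℝ → Sobolev n m s) : Prop :=
  ∀ (χ : ℝ → ℝ) (ψ : 𝓢(Space n, ℂ)), ContDiff ℝ ∞ χ → HasCompactSupport χ → tsupport χ ⊆ I →
    HasCompactSupport ψ →
    ∫ t : ℝ, (((deriv (deriv χ) t : ℝ) : ℂ) * toDist (u t) ψ +
      (χ t : ℂ) * ((m : ℂ) ^ 2 * toDist (u t) ψ - toDist (u t) (Δ ψ) + toDist (J t) ψ)) = 0

theorem integrable_pairing {n : ℕ} {m s : ℝ} [Fact (0 < m)] {u : ℝ → Sobolev n m (s + 1)}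
    (hu : Continuous u) {χ : ℝ → ℝ} (ψ : 𝓢(Space n, ℂ)) (hχ : ContDiff ℝ ∞ χ)
    (hc : HasCompactSupport χ) :
    Integrable fun t : ℝ => ((deriv (deriv χ) t : ℝ) : ℂ) * toDist (u t) ψ +
      (χ t : ℂ) * ((m : ℂ) ^ 2 * toDist (u t) ψ - toDist (u t) (Δ ψ)) := by
  have hd : Continuous (deriv (deriv χ)) :=
    (contDiff_infty_iff_deriv.mp (contDiff_infty_iff_deriv.mp hχ).2).2.continuous
  have e1 := (continuous_toDist_apply ψ).comp hu
  have e2 := (continuous_toDist_apply (Δ ψ)).comp hu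
  apply Continuous.integrable_of_hasCompactSupport
  · exact ((Complex.continuous_ofReal.comp hd).mul e1).add
      ((Complex.continuous_ofReal.comp hχ.continuous).mul ((continuous_const.mul e1).sub e2))
  · have h1 : HasCompactSupport fun t => ((deriv (deriv χ) t : ℝ) : ℂ) :=
      hc.deriv.deriv.comp_left (g := Complex.ofReal) rfl
    have h2 : HasCompactSupport fun t => ((χ t : ℝ) : ℂ) :=
      hc.comp_left (g := Complex.ofReal) rfl
    exact h1.mul_right.add h2.mul_right

/-- The space `𝓔₀^(s+1)` of the solutions `φ ∈ C⁰(ℝ, H^(s+1)) ∩ C¹(ℝ, H^s)` of the linear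
Klein-Gordon equation. -/
def freeSubmodule (n : ℕ) (m s : ℝ) [Fact (0 < m)] : Submodule ℝ (ℝ → Sobolev n m (s + 1)) where
  carrier := {φ | TimeRegular (s := s) Set.univ φ ∧ IsWeakSolution (s := s) Set.univ φ 0}
  zero_mem' := by
    refine ⟨⟨continuousOn_const, ?_⟩, ?_⟩
    · simpa using contDiffOn_const
    · intro χ ψ _ _ _ _
      simp
  add_mem' := by
    rintro φ φ' ⟨⟨h0, h1⟩, h2⟩ ⟨⟨h0', h1'⟩, h2'⟩
    refine ⟨⟨h0.add h0', ?_⟩, ?_⟩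
    · simpa using h1.add h1'
    · intro χ ψ hχ hc hI hψ
      have i := integrable_pairing (continuousOn_univ.mp h0) ψ hχ hc
      have i' := integrable_pairing (continuousOn_univ.mp h0') ψ hχ hc
      have e := h2 χ ψ hχ hc hI hψ
      have e' := h2' χ ψ hχ hc hI hψ
      have key := integral_add i i'
      simp only [Pi.zero_apply, map_zero, zero_apply, add_zero] at e e' ⊢
      rw [e, e', add_zero] at key
      rw [← key]
      congr 1
      funext t
      simp only [Pi.add_apply, map_add, add_apply]
      ring
  smul_mem' := by
    rintro c φ ⟨⟨h0, h1⟩, h2⟩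
    refine ⟨⟨h0.const_smul c, ?_⟩, ?_⟩
    · simpa using h1.const_smul c
    · intro χ ψ hχ hc hI hψ
      have e := h2 χ ψ hχ hc hI hψ
      have key := integral_const_mul (μ := (volume : Measure ℝ)) (c : ℂ) fun t : ℝ =>
        ((deriv (deriv χ) t : ℝ) : ℂ) * toDist (φ t) ψ +
          (χ t : ℂ) * ((m : ℂ) ^ 2 * toDist (φ t) ψ - toDist (φ t) (Δ ψ))
      simp only [Pi.zero_apply, map_zero, zero_apply, add_zero] at e ⊢
      rw [e, mul_zero] at key
      rw [← key]
      congr 1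
      funext t
      simp only [Pi.smul_apply, map_smul, smul_apply, Complex.real_smul]
      ring

/-- `𝓔₀^(s+1)` as a type of its own, so that it carries the norm below. -/
def Free (n : ℕ) (m s : ℝ) [Fact (0 < m)] : Type := freeSubmodule n m s

noncomputable instance (n : ℕ) (m s : ℝ) [Fact (0 < m)] : AddCommGroup (Free n m s) :=
  inferInstanceAs (AddCommGroup (freeSubmodule n m s))

noncomputable instance (n : ℕ) (m s : ℝ) [Fact (0 < m)] : Module ℝ (Free n m s) :=
  inferInstanceAs (Module ℝ (freeSubmodule n m s))

/-- The map `φ ↦ [φ]_t` on `𝓔₀^(s+1)`. -/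
noncomputable def freeData {n : ℕ} {m s : ℝ} [Fact (0 < m)] (t : ℝ) :
    Free n m s →ₗ[ℝ] Data n m s where
  toFun φ := cauchyData φ.1 t
  map_add' φ φ' := by
    have h := ((φ.2.1.2.contDiffAt Filter.univ_mem).differentiableAt (x := t) one_ne_zero)
    have h' := ((φ'.2.1.2.contDiffAt Filter.univ_mem).differentiableAt (x := t) one_ne_zero)
    have key : timeDeriv (s := s) (φ.1 + φ'.1) t = timeDeriv φ.1 t + timeDeriv φ'.1 t := by
      unfold timeDeriv
      rw [← deriv_fun_add h h']
      simp
    change WithLp.toLp 2 ((φ.1 + φ'.1) t, timeDeriv (φ.1 + φ'.1) t) = _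
    rw [key]
    rfl
  map_smul' c φ := by
    have h := ((φ.2.1.2.contDiffAt Filter.univ_mem).differentiableAt (x := t) one_ne_zero)
    have key : timeDeriv (s := s) (c • φ.1) t = c • timeDeriv φ.1 t := by
      unfold timeDeriv
      rw [← deriv_fun_const_smul c h]
      simp
    change WithLp.toLp 2 ((c • φ.1) t, timeDeriv (c • φ.1) t) = _
    rw [key]
    rfl

/-- The norm `‖φ‖ = (‖φ(t)‖²_{H^(s+1)} + ‖∂φ/∂t(t)‖²_{H^s}) ^ (1/2)` of `𝓔₀^(s+1)`; it does not
depend on `t`, and is taken here at `t = 0`. -/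
noncomputable instance (n : ℕ) (m s : ℝ) [Fact (0 < m)] : SeminormedAddCommGroup (Free n m s) :=
  SeminormedAddCommGroup.induced _ _ (freeData 0)

noncomputable instance (n : ℕ) (m s : ℝ) [Fact (0 < m)] : NormedSpace ℝ (Free n m s) :=
  NormedSpace.induced ℝ _ _ (freeData 0)

/-- The solution in `𝓔₀^(s+1)` of the linear Klein-Gordon equation with Cauchy data `Φ` at time
`t`. -/
noncomputable def freeSolution {n : ℕ} {m s : ℝ} [Fact (0 < m)] (t : ℝ) (Φ : Data n m s) :
    Free n m s :=
  Function.invFun (freeData t) Φ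

/-- `v ♯_t G`, the function `x ↦ ∫ v(y) G(t - x⁰, y - x) dy`, where `G` is the solution of the
linear Klein-Gordon equation with `G = 0` and `∂G/∂t = δ₀` at time `0`: it is the free solution with
Cauchy data `(0, -v)` at time `t`. -/
noncomputable def sharp {n : ℕ} {m s : ℝ} [Fact (0 < m)] (t : ℝ) (v : Sobolev n m s) :
    Free n m s :=
  freeSolution t (WithLp.toLp 2 (0, -v))

/-! ### The Fock spaces -/

/-- All the terms of a series of multilinear maps are symmetric. -/
def IsSymmetric {E F : Type*} [NormedAddCommGroup F] [NormedSpace ℝ F] [SeminormedAddCommGroup E]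
    [NormedSpace ℝ E] (f : FormalMultilinearSeries ℝ E F) : Prop :=
  ∀ (p : ℕ) (σ : Equiv.Perm (Fin p)) (φ : Fin p → E), f p (φ ∘ σ) = f p φ

/-- Formal series `∑ f_p` of continuous `p`-linear forms `f_p` on `𝓔₀^(s+1)`. The norm `‖f p‖` is
the optimal `C` in `|f_p(φ₁, …, φ_p)| ≤ C ‖φ₁‖ ⋯ ‖φ_p‖`. -/
abbrev Series (n : ℕ) (m s : ℝ) [Fact (0 < m)] : Type :=
  FormalMultilinearSeries ℝ (Free n m s) ℝ

/-- `N_r(f) = ∑ ‖f_p‖ r ^ p`, with value `⊤` if the series diverges (`r ≥ 0`). -/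
noncomputable def fockNorm {n : ℕ} {m s : ℝ} [Fact (0 < m)] (r : ℝ) (f : Series n m s) : ℝ≥0∞ :=
  ∑' p, ENNReal.ofReal (‖f p‖ * r ^ p)

/-- The Fock space `𝔽_r`. -/
def Fock (n : ℕ) (m s : ℝ) [Fact (0 < m)] (r : ℝ) : Set (Series n m s) :=
  {f | IsSymmetric f ∧ fockNorm r f < ⊤}

/-- `⟨0|f⟩ = f(0)`. -/
noncomputable def vacuum {n : ℕ} {m s : ℝ} [Fact (0 < m)] (f : Series n m s) : ℝ :=
  f 0 (fun _ => 0)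

/-- The operator `δ/δψ`: the series `f` goes to `φ ↦ ∑ p f_p(ψ ⊗ φ^(p-1))`. -/
noncomputable def delta {n : ℕ} {m s : ℝ} [Fact (0 < m)] (ψ : Free n m s) (f : Series n m s) :
    Series n m s :=
  fun k => ((k : ℝ) + 1) • ((f (k + 1)).toMultilinearMap.curryLeft ψ).mkContinuous
    (‖f (k + 1)‖ * ‖ψ‖) fun φ => by
      have h := (f (k + 1)).le_opNorm (Fin.cons ψ φ)
      rw [Fin.prod_univ_succ] at h
      simpa [mul_assoc] using h

/-- The operator `𝕌(t) = ∫_t u ∂⃡ φ^◁ = δ/δψ`, where `ψ` is the element of `𝓔₀^(s+1)` that has the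
same Cauchy data at time `t` as `u`. -/
noncomputable def opU {n : ℕ} {m s : ℝ} [Fact (0 < m)] (u : ℝ → Sobolev n m (s + 1)) (t : ℝ) :
    Series n m s → Series n m s :=
  delta (freeSolution t (cauchyData u t))

/-- The operator `𝔻(t) = -∫_t 𝒱(φ^▷, ∂φ^▷/∂t) φ^◁`. It sends `f` to the functional
`φ ↦ -∑_p p f_p((𝒱([φ]_t) ♯_t G) ⊗ φ^(p-1))`; the term of degree `k` of the result is the symmetric
`k`-linear form `-g` for which `g(φ, …, φ)` collects the contributions
`p f_p((𝒱_q([φ]_t^q) ♯_t G) ⊗ φ^(p-1))` with `q + (p - 1) = k`. -/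
noncomputable def opD {n : ℕ} {m s : ℝ} [Fact (0 < m)]
    (V : FormalMultilinearSeries ℝ (Data n m s) (Sobolev n m s)) (t : ℝ) (f : Series n m s) :
    Series n m s :=
  fun k => -Classical.epsilon fun g : Free n m s [×k]→L[ℝ] ℝ =>
    (∀ (σ : Equiv.Perm (Fin k)) (φ : Fin k → Free n m s), g (φ ∘ σ) = g φ) ∧
    ∀ φ : Free n m s, g (fun _ => φ) = ∑ qj ∈ Finset.HasAntidiagonal.antidiagonal k, ((qj.2 : ℝ) + 1) *
      f (qj.2 + 1) (Fin.cons (sharp t (V qj.1 fun _ => freeData t φ)) fun _ => φ)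

/-! ### Exponentials and time ordered exponentials -/

/-- `g = exp(T) f = ∑ T^k f / k!`, the series being absolutely convergent in `𝔽_ρ`. -/
def HasExp {n : ℕ} {m s : ℝ} [Fact (0 < m)] (T : Series n m s → Series n m s) (ρ : ℝ)
    (f g : Series n m s) : Prop :=
  ∑' k : ℕ, fockNorm ρ (((k.factorial : ℝ)⁻¹) • T^[k] f) < ⊤ ∧
  ∀ p, HasSum (fun k : ℕ => (((k.factorial : ℝ)⁻¹) • T^[k] f) p) (g p)

/-- `G k t = ∫_0^t ds₁ ∫_0^(s₁) ds₂ ⋯ ∫_0^(s_(k-1)) ds_k D(s₁) D(s₂) ⋯ D(s_k) f` for all `k` and `t`.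
The integrals are taken after evaluation of the functionals on arguments in `𝓔₀^(s+1)`. -/
structure IsOrderedIntegral {n : ℕ} {m s : ℝ} [Fact (0 < m)]
    (D : ℝ → Series n m s → Series n m s) (f : Series n m s) (G : ℕ → ℝ → Series n m s) : Prop where
  zero : ∀ t, G 0 t = f
  integrable : ∀ (k : ℕ) (t : ℝ) (p : ℕ) (φ : Fin p → Free n m s),
    IntervalIntegrable (fun τ => D τ (G k τ) p φ) volume 0 t
  succ : ∀ (k : ℕ) (t : ℝ) (p : ℕ) (φ : Fin p → Free n m s),
    G (k + 1) t p φ = ∫ τ in (0 : ℝ)..t, D τ (G k τ) p φ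

/-- `g = T exp(∫_0^t D(τ) dτ) f = ∑_k ∫_0^t ds₁ ⋯ ∫_0^(s_(k-1)) ds_k D(s₁) ⋯ D(s_k) f`, the series
over `k` being absolutely convergent in `𝔽_ρ`. -/
def HasTimeOrderedExp {n : ℕ} {m s : ℝ} [Fact (0 < m)] (D : ℝ → Series n m s → Series n m s)
    (t ρ : ℝ) (f g : Series n m s) : Prop :=
  ∃ G : ℕ → ℝ → Series n m s, IsOrderedIntegral D f G ∧
    ∑' k, fockNorm ρ (G k t) < ⊤ ∧ ∀ p, HasSum (fun k => G k t p) (g p)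

/-- `a = ⟨0| exp(𝕌(t)) T exp(∫_0^t 𝔻(τ) dτ) |f⟩`, where the time ordered exponential converges in
`𝔽_ρ`, and the exponential of `𝕌(t)` applied to the result converges in `𝔽_ρ'` for
`ρ' = ρ - ‖[u]_t‖_{s+1}`. -/
def IsAlpha {n : ℕ} {m s : ℝ} [Fact (0 < m)]
    (V : FormalMultilinearSeries ℝ (Data n m s) (Sobolev n m s)) (u : ℝ → Sobolev n m (s + 1))
    (ρ t : ℝ) (f : Series n m s) (a : ℝ) : Prop :=
  ∃ g ∈ Fock n m s ρ, HasTimeOrderedExp (opD V) t ρ f g ∧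
    ∃ h ∈ Fock n m s (ρ - cauchySize u t), HasExp (opU u t) (ρ - cauchySize u t) g h ∧
      a = vacuum h

/-! ### The majorant of the nonlinearity and its flow -/

/-- `X(z) = ∑ ‖V_q‖ z ^ q`. -/
noncomputable def majorant {n : ℕ} {m s : ℝ} [Fact (0 < m)]
    (V : FormalMultilinearSeries ℝ (Data n m s) (Sobolev n m s)) (z : ℝ) : ℝ :=
  ∑' q, ‖V q‖ * z ^ q

/-- `γ` solves `γ' = Y(γ)` on `[0, t]` with `γ(0) = z`, with values in `[0, r₀)`. -/
def IsTrajectory (Y : ℝ → ℝ) (r₀ : ℝ≥0∞) (t z : ℝ) (γ : ℝ → ℝ) : Prop :=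
  γ 0 = z ∧ ∀ τ ∈ Set.Icc 0 t, 0 ≤ γ τ ∧ ENNReal.ofReal (γ τ) < r₀ ∧
    HasDerivWithinAt γ (Y (γ τ)) (Set.Icc 0 t) τ

/-- The flow `exp(tY)(z)` (`t ≥ 0`) in `[0, r₀)`: the value at time `t` of the solution of
`γ' = Y(γ)`, `γ(0) = z`, and `⊤` if there is no solution in `[0, r₀)` up to time `t`. -/
noncomputable def flow (Y : ℝ → ℝ) (r₀ : ℝ≥0∞) (t z : ℝ) : ℝ≥0∞ :=
  ⨅ (γ : ℝ → ℝ) (_ : IsTrajectory Y r₀ t z γ), ENNReal.ofReal (γ t)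

/-- The radius `exp(-|t|X)(r)`, for the majorant `X` of `V`. -/
noncomputable def radiusAt {n : ℕ} {m s : ℝ} [Fact (0 < m)]
    (V : FormalMultilinearSeries ℝ (Data n m s) (Sobolev n m s)) (r t : ℝ) : ℝ :=
  (flow (fun z => -majorant V z) V.radius |t| r).toReal

end KleinGordon

/-! Let ψ(t) be the free solution tangent to u at time t, and let g_t be the time ordered
exponential applied to f. The exponential of δ/δψ is Taylor's translation by ψ, and its vacuum
component is Σ g_p(ψ,…,ψ) (`HasExp.vacuum_eq`). Hence α(t) = g_t(ψ(t)), which is `orderedExpAt`. By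
`opD_eq`, 𝔻(t) is the derivation along the field W_t(φ) = -𝒱([φ]_t)♯_tG on free solutions, so
formally g_t satisfies the transport equation ∂_t g = W_t·∂g. Duhamel's formula turns the nonlinear
equation for u into ψ' = -W_t(ψ) (`IsWeakSolution.hasDerivAt_tangentSolution`): ψ runs along a
characteristic, and the two contributions to dα/dt cancel. In terms of series, the explicit time
derivative of the (k+1)-st iterated integral cancels the derivative of the k-th one along ψ; this is
`hasDerivAt_orderedExpAt`.

Convergence is a majorant argument. Coefficientwise, the norms of a derivation along W_t are bounded
by X(z)∂_z applied to b(z) = Σ‖f_p‖z^p, so the k-th iterated integral is bounded by |t|^k/k!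
(X∂_z)^k b. The sum over k is the Taylor series of b along the flow of X, and at z = e^{-|t|X}(r) it
is at most b(r) = N_r(f) (`summable_iterate_fieldDeriv`). The assumption on u says that the
trajectory of X from ‖[u]_t‖ stays below r up to time |t|. Uniqueness for the ODE then keeps the
trajectory of -X from r above ‖[u]_t‖, even slightly beyond time |t| (`exists_backward_trajectory`).
This gives ρ > ‖[u]_t‖ and also bounds that are uniform near t, which allow termwise
differentiation.

Two weak points in regularity have to be dealt with. The field W_t depends on t only strongly, so
integrals are taken after evaluation; each integration restores norm continuity
(`continuous_pointwiseIntegral`), which is what the product rule along ψ needs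
(`hasDerivAt_apply_curve`). Moreover, u satisfies its equation only weakly. In frequency space the
free evolution is a rotation by the angle tε(ξ); it becomes norm differentiable after multiplication
by ε^(-2). Identities are therefore proved after multiplication by powers of 1/ε, and the injective
factor is removed by integrating in time (`hasDerivAt_of_mulOp`). -/

namespace KleinGordon

open scoped BoundedContinuousFunction

/-! ### Power series with nonnegative coefficients -/

/-- The coefficients `b` are nonnegative, and `∑ b_p z ^ p` converges for `0 ≤ z < R`. -/
def PowSummable (R : ℝ≥0∞) (b : ℕ → ℝ) : Prop :=
  (∀ p, 0 ≤ b p) ∧ ∀ z : ℝ, 0 ≤ z → ENNReal.ofReal z < R → Summable fun p => b p * z ^ p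

/-- The sum `∑ b_p z ^ p`. -/
noncomputable def powSum (b : ℕ → ℝ) (z : ℝ) : ℝ := ∑' p, b p * z ^ p

/-- The coefficients of `X(z) ∂/∂z ∑ b_p z ^ p`, where `X(z) = ∑ w_q z ^ q`. -/
noncomputable def fieldDeriv (w b : ℕ → ℝ) (k : ℕ) : ℝ :=
  ∑ qj ∈ Finset.HasAntidiagonal.antidiagonal k, w qj.1 * (((qj.2 : ℝ) + 1) * b (qj.2 + 1))

theorem fieldDeriv_nonneg {w b : ℕ → ℝ} (hw : ∀ q, 0 ≤ w q) (hb : ∀ p, 0 ≤ b p) (k : ℕ) :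
    0 ≤ fieldDeriv w b k :=
  Finset.sum_nonneg fun _ _ => mul_nonneg (hw _) (mul_nonneg (by positivity) (hb _))

theorem fieldDeriv_mono {w b b' : ℕ → ℝ} (hw : ∀ q, 0 ≤ w q) (h : ∀ p, b p ≤ b' p) (k : ℕ) :
    fieldDeriv w b k ≤ fieldDeriv w b' k :=
  Finset.sum_le_sum fun _ _ => mul_le_mul_of_nonneg_left
    (mul_le_mul_of_nonneg_left (h _) (by positivity)) (hw _)

theorem fieldDeriv_const_mul (w b : ℕ → ℝ) (c : ℝ) :
    fieldDeriv w (fun p => c * b p) = fun k => c * fieldDeriv w b k := by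
  funext k
  simp only [fieldDeriv, Finset.mul_sum]
  exact Finset.sum_congr rfl fun _ _ => by ring

theorem iterate_fieldDeriv_nonneg {w b : ℕ → ℝ} (hw : ∀ q, 0 ≤ w q) (hb : ∀ p, 0 ≤ b p)
    (k p : ℕ) : 0 ≤ (fieldDeriv w)^[k] b p := by
  induction k generalizing p with
  | zero => exact hb p
  | succ k ih =>
    rw [Function.iterate_succ_apply']
    exact fieldDeriv_nonneg hw ih p

/-- One application of X∂ at degree p reads coefficients of degree at most p + 1, so k applications
reach at most p + k. This permits truncating b to a polynomial. -/
theorem iterate_fieldDeriv_congr {w b b' : ℕ → ℝ} (k : ℕ) :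
    ∀ p, (∀ i ≤ p + k, b i = b' i) → (fieldDeriv w)^[k] b p = (fieldDeriv w)^[k] b' p := by
  induction k with
  | zero => exact fun p h => h p (by simp)
  | succ k ih =>
    intro p h
    rw [Function.iterate_succ_apply', Function.iterate_succ_apply']
    refine Finset.sum_congr rfl fun qj hqj => ?_
    have := Finset.HasAntidiagonal.mem_antidiagonal.mp hqj
    rw [ih (qj.2 + 1) fun i hi => h i (by omega)]

theorem exists_between_radius {R : ℝ≥0∞} {z : ℝ} (hz : 0 ≤ z) (hzR : ENNReal.ofReal z < R) :
    ∃ z' : ℝ, z < z' ∧ ENNReal.ofReal z' < R := by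
  obtain ⟨c, h1, h2⟩ := ENNReal.lt_iff_exists_nnreal_btwn.mp hzR
  refine ⟨c, ?_, by simpa using h2⟩
  rw [← ENNReal.ofReal_coe_nnreal] at h1
  exact ((ENNReal.ofReal_lt_ofReal_iff_of_nonneg hz).mp h1)

/-- In the factorisation of z'^(p+1) - z^(p+1), the geometric sum has p + 1 terms, each at least
z^p. This plays the role of Cauchy's estimate: a derivative costs only a smaller radius and a factor
1/(z' - z). -/
theorem succ_mul_pow_mul_sub_le {z z' : ℝ} (hz : 0 ≤ z) (hzz' : z ≤ z') (p : ℕ) :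
    ((p : ℝ) + 1) * z ^ p * (z' - z) ≤ z' ^ (p + 1) := by
  have hz' : 0 ≤ z' := hz.trans hzz'
  have e : z' ^ (p + 1) - z ^ (p + 1) = (z' - z) * ∑ i ∈ Finset.range (p + 1),
      z' ^ i * z ^ (p - i) := by
    rw [← (Commute.all z' z).mul_geom_sum₂ (p + 1)]; simp
  have h2 : ((p : ℝ) + 1) * z ^ p ≤ ∑ i ∈ Finset.range (p + 1), z' ^ i * z ^ (p - i) := by
    have : ∀ i ∈ Finset.range (p + 1), z ^ p ≤ z' ^ i * z ^ (p - i) := by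
      intro i hi
      have hi' : i ≤ p := by simpa [Nat.lt_succ_iff] using hi
      calc z ^ p = z ^ i * z ^ (p - i) := by rw [← pow_add]; congr 1; omega
        _ ≤ _ := by gcongr
    have := Finset.card_nsmul_le_sum _ _ _ this
    simpa using this
  nlinarith [pow_nonneg hz (p + 1)]

/-- The derivative of a power series with nonnegative coefficients is bounded by a difference
quotient. -/
theorem summable_deriv_of_summable {b : ℕ → ℝ} (hb : ∀ p, 0 ≤ b p) {z z' : ℝ} (hz : 0 ≤ z)
    (hzz' : z < z') (h : Summable fun p => b p * z' ^ p) :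
    (Summable fun p : ℕ => ((p : ℝ) + 1) * b (p + 1) * z ^ p) ∧
      ∑' p : ℕ, ((p : ℝ) + 1) * b (p + 1) * z ^ p ≤ powSum b z' / (z' - z) := by
  have hd : 0 < z' - z := sub_pos.mpr hzz'
  have hz' : 0 ≤ z' := hz.trans hzz'.le
  have key : ∀ p : ℕ, ((p : ℝ) + 1) * b (p + 1) * z ^ p ≤ b (p + 1) * z' ^ (p + 1) / (z' - z) := by
    intro p
    rw [le_div_iff₀ hd]
    have h1 := succ_mul_pow_mul_sub_le hz hzz'.le p
    calc _ = b (p + 1) * (((p : ℝ) + 1) * z ^ p * (z' - z)) := by ring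
      _ ≤ _ := mul_le_mul_of_nonneg_left h1 (hb _)
  have hs : Summable fun p : ℕ => b (p + 1) * z' ^ (p + 1) / (z' - z) :=
    ((summable_nat_add_iff 1).mpr h).div_const _
  have hs' : Summable fun p : ℕ => ((p : ℝ) + 1) * b (p + 1) * z ^ p :=
    hs.of_nonneg_of_le (fun p => by have := hb (p + 1); positivity) key
  refine ⟨hs', (hs'.tsum_le_tsum key hs).trans ?_⟩
  rw [tsum_div_const]
  gcongr
  rw [powSum, h.tsum_eq_zero_add]
  have := hb 0
  simpa using this

/-- Termwise differentiation on the ball of a radius z₁ > z, dominated by the derivative series at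
z₁. That series converges by comparison with the original one at a second radius z₂ > z₁. -/
theorem hasDerivAt_powSum {R : ℝ≥0∞} {b : ℕ → ℝ} (hb : PowSummable R b) {z : ℝ} (hz : 0 ≤ z)
    (hzR : ENNReal.ofReal z < R) :
    HasDerivAt (powSum b) (∑' p : ℕ, ((p : ℝ) + 1) * b (p + 1) * z ^ p) z := by
  obtain ⟨z₁, h1, h1R⟩ := exists_between_radius hz hzR
  have hz₁ : 0 ≤ z₁ := hz.trans h1.le
  obtain ⟨z₂, h2, h2R⟩ := exists_between_radius hz₁ h1R
  have hsum := (summable_deriv_of_summable hb.1 hz₁ h2 (hb.2 z₂ (hz₁.trans h2.le) h2R)).1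
  have hu : Summable fun p : ℕ => (p : ℝ) * b p * z₁ ^ (p - 1) := by
    rw [← summable_nat_add_iff 1]
    simpa using hsum
  have hmem : z ∈ Metric.ball (0 : ℝ) z₁ := by simpa [abs_of_nonneg hz] using h1
  have := hasDerivAt_tsum_of_isPreconnected (g := fun p y => b p * y ^ p)
    (g' := fun p y => b p * ((p : ℝ) * y ^ (p - 1))) hu Metric.isOpen_ball
    (convex_ball (0 : ℝ) z₁).isPreconnected
    (fun p y _ => (hasDerivAt_pow p y).const_mul (b p)) ?_ hmem (hb.2 z hz hzR) hmem
  · refine this.congr_deriv ?_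
    have hs' : Summable fun p : ℕ => b p * ((p : ℝ) * z ^ (p - 1)) := by
      refine hu.of_nonneg_of_le (fun p => ?_) fun p => ?_
      · have := hb.1 p; positivity
      · have := hb.1 p
        rw [← mul_assoc, mul_comm (b p)]
        gcongr
    rw [hs'.tsum_eq_zero_add]
    simp only [Nat.cast_zero, zero_mul, mul_zero, zero_add, Nat.cast_add, Nat.cast_one,
      Nat.add_sub_cancel]
    exact tsum_congr fun p => by ring
  · intro p y hy
    have hy' : |y| ≤ z₁ := by simpa using (mem_ball_zero_iff.mp hy).le
    have := hb.1 p
    rw [norm_mul, norm_mul, norm_pow, Real.norm_eq_abs, Real.norm_eq_abs, Real.norm_eq_abs,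
      abs_of_nonneg this, abs_of_nonneg (Nat.cast_nonneg p), ← mul_assoc, mul_comm (b p)]
    gcongr

/-- `fieldDeriv` is the Cauchy product of X with the derivative series, so absolute convergence of
the two factors suffices. -/
theorem summable_fieldDeriv {w b : ℕ → ℝ} {z : ℝ}
    (h1 : Summable fun q => w q * z ^ q)
    (h2 : Summable fun p : ℕ => ((p : ℝ) + 1) * b (p + 1) * z ^ p) :
    (Summable fun k => fieldDeriv w b k * z ^ k) ∧
      powSum (fieldDeriv w b) z = powSum w z * ∑' p : ℕ, ((p : ℝ) + 1) * b (p + 1) * z ^ p := by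
  have e : ∀ k, ∑ kl ∈ Finset.HasAntidiagonal.antidiagonal k,
      w kl.1 * z ^ kl.1 * (((kl.2 : ℝ) + 1) * b (kl.2 + 1) * z ^ kl.2) =
      fieldDeriv w b k * z ^ k := by
    intro k
    rw [fieldDeriv, Finset.sum_mul]
    refine Finset.sum_congr rfl fun qj hqj => ?_
    rw [← Finset.HasAntidiagonal.mem_antidiagonal.mp hqj, pow_add]
    ring
  have n1 : Summable fun q => ‖w q * z ^ q‖ := h1.norm
  have n2 : Summable fun p : ℕ => ‖((p : ℝ) + 1) * b (p + 1) * z ^ p‖ := h2.norm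
  constructor
  · have := (summable_norm_sum_mul_antidiagonal_of_summable_norm n1 n2).of_norm
    simpa only [e] using this
  · have := tsum_mul_tsum_eq_tsum_sum_antidiagonal_of_summable_norm n1 n2
    rw [powSum, powSum, this]
    exact tsum_congr fun k => (e k).symm

theorem PowSummable.summable_deriv {R : ℝ≥0∞} {b : ℕ → ℝ} (hb : PowSummable R b) {z : ℝ}
    (hz : 0 ≤ z) (hzR : ENNReal.ofReal z < R) :
    Summable fun p : ℕ => ((p : ℝ) + 1) * b (p + 1) * z ^ p := by
  obtain ⟨z₁, h1, h1R⟩ := exists_between_radius hz hzR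
  exact (summable_deriv_of_summable hb.1 hz h1 (hb.2 z₁ (hz.trans h1.le) h1R)).1

theorem PowSummable.fieldDeriv {R : ℝ≥0∞} {w b : ℕ → ℝ} (hw : PowSummable R w)
    (hb : PowSummable R b) : PowSummable R (fieldDeriv w b) :=
  ⟨fieldDeriv_nonneg hw.1 hb.1, fun z hz hzR =>
    (summable_fieldDeriv (hw.2 z hz hzR) (hb.summable_deriv hz hzR)).1⟩

theorem hasDerivAt_powSum_fieldDeriv {R : ℝ≥0∞} {w b : ℕ → ℝ} (hw : PowSummable R w)
    (hb : PowSummable R b) {z : ℝ} (hz : 0 ≤ z) (hzR : ENNReal.ofReal z < R) :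
    ∃ d, HasDerivAt (powSum b) d z ∧ powSum (KleinGordon.fieldDeriv w b) z = powSum w z * d :=
  ⟨_, hasDerivAt_powSum hb hz hzR,
    (summable_fieldDeriv (hw.2 z hz hzR) (hb.summable_deriv hz hzR)).2⟩

/-- Taylor's formula along the flow of `X`, with the (nonnegative) remainder dropped. -/
theorem sum_iterate_fieldDeriv_le {R : ℝ≥0∞} {w : ℕ → ℝ} (hw : PowSummable R w) {T : ℝ}
    {γ : ℝ → ℝ} (hγ : ∀ τ ∈ Set.Icc 0 T, 0 ≤ γ τ ∧ ENNReal.ofReal (γ τ) < R ∧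
      HasDerivWithinAt γ (powSum w (γ τ)) (Set.Icc 0 T) τ) (K : ℕ) :
    ∀ b, PowSummable R b → ∀ t ∈ Set.Icc 0 T,
      ∑ k ∈ Finset.range K, t ^ k / k.factorial * powSum ((fieldDeriv w)^[k] b) (γ 0) ≤
        powSum b (γ t) := by
  induction K with
  | zero =>
    intro b hb t ht
    simp only [Finset.range_zero, Finset.sum_empty]
    exact tsum_nonneg fun p => mul_nonneg (hb.1 p) (pow_nonneg (hγ t ht).1 p)
  | succ K ih =>
    intro b hb t ht
    set c : ℕ → ℝ := fun k => powSum ((fieldDeriv w)^[k] b) (γ 0) with hc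
    set h : ℝ → ℝ := fun τ => powSum b (γ τ) -
      ∑ k ∈ Finset.range (K + 1), τ ^ k / k.factorial * c k with hh
    -- The derivative of h is the same difference for X∂b in place of b, with one Taylor term fewer;
    -- the induction hypothesis says that it is nonnegative.
    have hder : ∀ τ ∈ Set.Icc 0 T, HasDerivWithinAt h (powSum (fieldDeriv w b) (γ τ) -
        ∑ k ∈ Finset.range K, τ ^ k / k.factorial * c (k + 1)) (Set.Icc 0 T) τ := by
      intro τ hτ
      obtain ⟨h0, hR, hd⟩ := hγ τ hτ
      obtain ⟨d, hd1, hd2⟩ := hasDerivAt_powSum_fieldDeriv hw hb h0 hR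
      have e1 := hd1.comp_hasDerivWithinAt τ hd
      rw [mul_comm, ← hd2] at e1
      refine e1.sub ?_
      have e2 : ∀ k ∈ Finset.range (K + 1), HasDerivAt (fun τ : ℝ => τ ^ k / k.factorial * c k)
          ((k : ℝ) * τ ^ (k - 1) / k.factorial * c k) τ := fun k _ =>
        ((hasDerivAt_pow k τ).div_const _).mul_const _
      have e3 := HasDerivAt.fun_sum e2
      refine (e3.congr_deriv ?_).hasDerivWithinAt
      rw [Finset.sum_range_succ']
      simp only [Nat.cast_zero, zero_mul, zero_div, add_zero, Nat.add_sub_cancel]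
      refine Finset.sum_congr rfl fun k _ => ?_
      rw [Nat.factorial_succ]
      push_cast
      have : (k.factorial : ℝ) ≠ 0 := by positivity
      field_simp
    have hmono : MonotoneOn h (Set.Icc 0 T) := by
      apply monotoneOn_of_deriv_nonneg (convex_Icc 0 T)
      · exact fun τ hτ => (hder τ hτ).continuousWithinAt
      · intro τ hτ
        exact ((hder τ (interior_subset hτ)).differentiableWithinAt.mono interior_subset)
      · intro τ hτ
        have hτ' := interior_subset hτ
        rw [((hder τ hτ').hasDerivAt (mem_interior_iff_mem_nhds.mp hτ)).deriv, sub_nonneg]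
        have := ih (fieldDeriv w b) (hw.fieldDeriv hb) τ hτ'
        simpa only [hc, Function.iterate_succ_apply] using this
    have h0 : (0 : ℝ) ∈ Set.Icc 0 T := ⟨le_rfl, ht.1.trans ht.2⟩
    have := hmono h0 ht ht.1
    have hz : h 0 = 0 := by
      simp only [hh]
      rw [Finset.sum_range_succ']
      simp [hc]
    rw [hz] at this
    exact sub_nonneg.mp this

/-- All terms are nonnegative, so it is enough to bound finite partial sums. Convergence of b is
assumed only at the point γ(T) and possibly nowhere beyond it, so Taylor's formula cannot be applied
to b itself; it is applied to polynomial truncations, which converge everywhere. -/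
theorem summable_iterate_fieldDeriv {R : ℝ≥0∞} {w : ℕ → ℝ} (hw : PowSummable R w) {T : ℝ}
    (hT : 0 ≤ T) {γ : ℝ → ℝ} (hγ : ∀ τ ∈ Set.Icc 0 T, 0 ≤ γ τ ∧ ENNReal.ofReal (γ τ) < R ∧
      HasDerivWithinAt γ (powSum w (γ τ)) (Set.Icc 0 T) τ) {b : ℕ → ℝ} (hb : ∀ p, 0 ≤ b p)
    (hbs : Summable fun p => b p * γ T ^ p) :
    Summable fun kp : ℕ × ℕ =>
      T ^ kp.1 / kp.1.factorial * (fieldDeriv w)^[kp.1] b kp.2 * γ 0 ^ kp.2 := by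
  have h0 : (0 : ℝ) ∈ Set.Icc 0 T := ⟨le_rfl, hT⟩
  have hT' : T ∈ Set.Icc 0 T := ⟨hT, le_rfl⟩
  refine summable_of_sum_le (c := powSum b (γ T)) ?_ ?_
  · intro kp
    have := iterate_fieldDeriv_nonneg hw.1 hb kp.1 kp.2
    have := (hγ 0 h0).1
    dsimp only
    positivity
  · intro s
    obtain ⟨N, hN⟩ : ∃ N, s ⊆ Finset.range N ×ˢ Finset.range N := by
      obtain ⟨N, hN⟩ := Finset.exists_nat_subset_range (s.image Prod.fst ∪ s.image Prod.snd)
      refine ⟨N, fun kp hkp => Finset.mem_product.mpr ⟨hN ?_, hN ?_⟩⟩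
      · exact Finset.mem_union_left _ (Finset.mem_image_of_mem _ hkp)
      · exact Finset.mem_union_right _ (Finset.mem_image_of_mem _ hkp)
    -- For k, p < N, the term of index (k, p) involves only coefficients of degree at most p + k <
    -- 2N.
    set b' : ℕ → ℝ := fun p => if p < 2 * N then b p else 0 with hb'
    have hb'0 : ∀ p, 0 ≤ b' p := fun p => by
      simp only [hb']; split_ifs; exacts [hb p, le_rfl]
    have hb's : ∀ z, Summable fun p => b' p * z ^ p := fun z =>
      summable_of_ne_finset_zero (s := Finset.range (2 * N)) fun p hp => by
        simp only [Finset.mem_range] at hp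
        simp [hb', hp]
    have hbP : PowSummable R b' := ⟨hb'0, fun z _ _ => hb's z⟩
    have hit : ∀ k, PowSummable R ((fieldDeriv w)^[k] b') := by
      intro k
      induction k with
      | zero => exact hbP
      | succ k ih =>
        rw [Function.iterate_succ_apply']
        exact hw.fieldDeriv ih
    calc _ ≤ ∑ kp ∈ Finset.range N ×ˢ Finset.range N,
          T ^ kp.1 / kp.1.factorial * (fieldDeriv w)^[kp.1] b kp.2 * γ 0 ^ kp.2 := by
          refine Finset.sum_le_sum_of_subset_of_nonneg hN fun kp _ _ => ?_
          have := iterate_fieldDeriv_nonneg hw.1 hb kp.1 kp.2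
          have := (hγ 0 h0).1
          positivity
      _ = ∑ k ∈ Finset.range N, T ^ k / k.factorial *
          ∑ p ∈ Finset.range N, (fieldDeriv w)^[k] b' p * γ 0 ^ p := by
          rw [Finset.sum_product]
          refine Finset.sum_congr rfl fun k hk => ?_
          rw [Finset.mul_sum]
          refine Finset.sum_congr rfl fun p hp => ?_
          rw [iterate_fieldDeriv_congr (b' := b') k p, mul_assoc]
          intro i hi
          simp only [Finset.mem_range] at hk hp
          simp only [hb']
          rw [if_pos (by omega)]
      _ ≤ ∑ k ∈ Finset.range N, T ^ k / k.factorial * powSum ((fieldDeriv w)^[k] b') (γ 0) := by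
          gcongr with k hk
          exact ((hit k).2 _ (hγ 0 h0).1 (hγ 0 h0).2.1).sum_le_tsum _ fun p _ =>
            mul_nonneg ((hit k).1 p) (pow_nonneg (hγ 0 h0).1 p)
      _ ≤ powSum b' (γ T) := sum_iterate_fieldDeriv_le hw hγ N b' hbP T hT'
      _ ≤ powSum b (γ T) := by
          refine (hb's _).tsum_le_tsum (fun p => ?_) hbs
          have := pow_nonneg (hγ T hT').1 p
          refine mul_le_mul_of_nonneg_right ?_ this
          simp only [hb']; split_ifs; exacts [le_rfl, hb p]

/-! ### The flow of the majorant -/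

theorem powSum_nonneg {b : ℕ → ℝ} (hb : ∀ p, 0 ≤ b p) {z : ℝ} (hz : 0 ≤ z) : 0 ≤ powSum b z :=
  tsum_nonneg fun p => mul_nonneg (hb p) (pow_nonneg hz p)

theorem powSum_mono {R : ℝ≥0∞} {b : ℕ → ℝ} (hb : PowSummable R b) {z z' : ℝ} (hz : 0 ≤ z)
    (hzz' : z ≤ z') (hR : ENNReal.ofReal z' < R) : powSum b z ≤ powSum b z' := by
  refine (hb.2 z hz ((ENNReal.ofReal_le_ofReal hzz').trans_lt hR)).tsum_le_tsum (fun p => ?_)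
    (hb.2 z' (hz.trans hzz') hR)
  have := hb.1 p
  gcongr

theorem exists_lipschitzOnWith_powSum {R : ℝ≥0∞} {b : ℕ → ℝ} (hb : PowSummable R b) {r : ℝ}
    (hr : ENNReal.ofReal r < R) : ∃ K, LipschitzOnWith K (powSum b) (Set.Icc 0 r) := by
  refine ⟨(∑' p : ℕ, ((p : ℝ) + 1) * b (p + 1) * r ^ p).toNNReal,
    (convex_Icc 0 r).lipschitzOnWith_of_nnnorm_hasDerivWithin_le
      (f' := fun z => ∑' p : ℕ, ((p : ℝ) + 1) * b (p + 1) * z ^ p) (fun z hz =>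
      (hasDerivAt_powSum hb hz.1
        ((ENNReal.ofReal_le_ofReal hz.2).trans_lt hr)).hasDerivWithinAt) fun z hz => ?_⟩
  have hzR := (ENNReal.ofReal_le_ofReal hz.2).trans_lt hr
  have h0 : ∀ p : ℕ, 0 ≤ ((p : ℝ) + 1) * b (p + 1) * z ^ p := fun p => by
    have := hb.1 (p + 1); have := hz.1; positivity
  rw [← NNReal.coe_le_coe, coe_nnnorm, Real.norm_of_nonneg (tsum_nonneg h0)]
  refine le_trans ?_ (Real.le_coe_toNNReal _)
  refine (hb.summable_deriv hz.1 hzR).tsum_le_tsum (fun p => ?_)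
    (hb.summable_deriv (hz.1.trans hz.2) hr)
  have := hb.1 (p + 1)
  have := hz.1
  have := hz.2
  gcongr

/-- The field `-X`, extended from `[0, r]` to the real line by constants. -/
noncomputable def clampedField (w : ℕ → ℝ) {r : ℝ} (hr : 0 ≤ r) (y : ℝ) : ℝ :=
  -powSum w (Set.projIcc 0 r hr y)

theorem clampedField_of_mem (w : ℕ → ℝ) {r : ℝ} (hr : 0 ≤ r) {y : ℝ} (hy : y ∈ Set.Icc 0 r) :
    clampedField w hr y = -powSum w y := by
  rw [clampedField, Set.projIcc_of_mem hr hy]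

theorem exists_lipschitzWith_clampedField {R : ℝ≥0∞} {w : ℕ → ℝ} (hw : PowSummable R w) {r : ℝ}
    (hr : 0 ≤ r) (hrR : ENNReal.ofReal r < R) : ∃ K, LipschitzWith K (clampedField w hr) := by
  obtain ⟨K, hK⟩ := exists_lipschitzOnWith_powSum hw hrR
  refine ⟨K * 1, ?_⟩
  have h1 : LipschitzWith K ((Set.Icc 0 r).domRestrict (powSum w)) :=
    lipschitzOnWith_iff_restrict.mp hK
  exact (h1.comp (LipschitzWith.projIcc hr)).neg

/-- After clamping, the field is globally Lipschitz and bounded by X(r), so the Picard-Lindelöf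
theorem applies on an interval of any length T, on the ball of radius X(r)·T about r. -/
theorem exists_clampedField_solution {R : ℝ≥0∞} {w : ℕ → ℝ} (hw : PowSummable R w) {r : ℝ}
    (hr : 0 ≤ r) (hrR : ENNReal.ofReal r < R) {T : ℝ} (hT : 0 ≤ T) :
    ∃ Γ : ℝ → ℝ, Γ 0 = r ∧ ∀ τ ∈ Set.Icc 0 T,
      HasDerivWithinAt Γ (clampedField w hr (Γ τ)) (Set.Icc 0 T) τ := by
  obtain ⟨K, hK⟩ := exists_lipschitzWith_clampedField hw hr hrR
  have hX : 0 ≤ powSum w r := powSum_nonneg hw.1 hr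
  have hpl : IsPicardLindelof (fun _ => clampedField w hr) (⟨0, le_rfl, hT⟩ : Set.Icc 0 T) r
      (powSum w r * T).toNNReal 0 (powSum w r).toNNReal K := by
    refine ⟨fun t _ => hK.lipschitzOnWith, fun x _ => continuousOn_const, fun t _ x _ => ?_, ?_⟩
    · have hm := (Set.projIcc 0 r hr x).2
      rw [clampedField, norm_neg, Real.norm_of_nonneg (powSum_nonneg hw.1 hm.1),
        Real.coe_toNNReal _ hX]
      exact powSum_mono hw hm.1 hm.2 hrR
    · rw [Real.coe_toNNReal _ hX, Real.coe_toNNReal _ (by positivity)]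
      simp [hT]
  exact hpl.exists_eq_forall_mem_Icc_hasDerivWithinAt₀

theorem antitoneOn_of_clampedField_solution {w : ℕ → ℝ} (hw : ∀ q, 0 ≤ w q) {r : ℝ} (hr : 0 ≤ r)
    {T : ℝ} {Γ : ℝ → ℝ} (hΓ : ∀ τ ∈ Set.Icc 0 T,
      HasDerivWithinAt Γ (clampedField w hr (Γ τ)) (Set.Icc 0 T) τ) :
    AntitoneOn Γ (Set.Icc 0 T) := by
  apply antitoneOn_of_deriv_nonpos (convex_Icc 0 T)
  · exact fun τ hτ => (hΓ τ hτ).continuousWithinAt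
  · intro τ hτ
    exact (hΓ τ (interior_subset hτ)).differentiableWithinAt.mono interior_subset
  · intro τ hτ
    rw [((hΓ τ (interior_subset hτ)).hasDerivAt (mem_interior_iff_mem_nhds.mp hτ)).deriv]
    exact neg_nonpos.mpr (powSum_nonneg hw (Set.projIcc 0 r hr _).2.1)

/-- A trajectory of `X` is increasing. -/
theorem IsTrajectory.monotoneOn {R : ℝ≥0∞} {w : ℕ → ℝ} (hw : ∀ q, 0 ≤ w q) {t z : ℝ} {γ : ℝ → ℝ}
    (hγ : IsTrajectory (powSum w) R t z γ) : MonotoneOn γ (Set.Icc 0 t) := by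
  apply monotoneOn_of_deriv_nonneg (convex_Icc 0 t)
  · exact fun τ hτ => (hγ.2 τ hτ).2.2.continuousWithinAt
  · intro τ hτ
    exact (hγ.2 τ (interior_subset hτ)).2.2.differentiableWithinAt.mono interior_subset
  · intro τ hτ
    have h := hγ.2 τ (interior_subset hτ)
    rw [(h.2.2.hasDerivAt (mem_interior_iff_mem_nhds.mp hτ)).deriv]
    exact powSum_nonneg hw h.1

theorem hasDerivWithinAt_reverse {γ : ℝ → ℝ} {d t τ : ℝ}
    (h : HasDerivWithinAt γ d (Set.Icc 0 t) (t - τ)) :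
    HasDerivWithinAt (fun σ => γ (t - σ)) (-d) (Set.Icc 0 t) τ := by
  have h1 : HasDerivWithinAt (fun σ : ℝ => t - σ) (-1) (Set.Icc 0 t) τ := by
    simpa using ((hasDerivAt_id τ).const_sub t).hasDerivWithinAt
  have h2 : Set.MapsTo (fun σ : ℝ => t - σ) (Set.Icc 0 t) (Set.Icc 0 t) := fun σ hσ =>
    ⟨by linarith [hσ.2], by linarith [hσ.1]⟩
  have := h.comp τ h1 h2
  rw [mul_neg_one] at this
  exact this

/-- The meeting time τ₀ may be inside the interval, so the Lipschitz uniqueness theorem is used to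
its left and to its right. -/
theorem clampedField_solution_unique {R : ℝ≥0∞} {w : ℕ → ℝ} (hw : PowSummable R w) {r : ℝ}
    (hr : 0 ≤ r) (hrR : ENNReal.ofReal r < R) {T : ℝ} {Γ η : ℝ → ℝ}
    (hΓ : ∀ τ ∈ Set.Icc 0 T, HasDerivWithinAt Γ (clampedField w hr (Γ τ)) (Set.Icc 0 T) τ)
    (hη : ∀ τ ∈ Set.Icc 0 T, HasDerivWithinAt η (clampedField w hr (η τ)) (Set.Icc 0 T) τ)
    {τ₀ : ℝ} (hτ₀ : τ₀ ∈ Set.Icc 0 T) (h : Γ τ₀ = η τ₀) : Set.EqOn Γ η (Set.Icc 0 T) := by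
  obtain ⟨K, hK⟩ := exists_lipschitzWith_clampedField hw hr hrR
  have cΓ : ContinuousOn Γ (Set.Icc 0 T) := fun τ hτ => (hΓ τ hτ).continuousWithinAt
  have cη : ContinuousOn η (Set.Icc 0 T) := fun τ hτ => (hη τ hτ).continuousWithinAt
  have s1 : Set.Icc 0 τ₀ ⊆ Set.Icc 0 T := Set.Icc_subset_Icc_right hτ₀.2
  have s2 : Set.Icc τ₀ T ⊆ Set.Icc 0 T := Set.Icc_subset_Icc_left hτ₀.1
  rw [← Set.Icc_union_Icc_eq_Icc hτ₀.1 hτ₀.2]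
  have left : ∀ {f : ℝ → ℝ}, (∀ τ ∈ Set.Icc 0 T,
      HasDerivWithinAt f (clampedField w hr (f τ)) (Set.Icc 0 T) τ) →
      ∀ τ ∈ Set.Ioc 0 τ₀, HasDerivWithinAt f (clampedField w hr (f τ)) (Set.Iic τ) τ := by
    intro f hf τ hτ
    refine (hf τ (s1 ⟨hτ.1.le, hτ.2⟩)).mono_of_mem_nhdsWithin ?_
    refine mem_of_superset (Icc_mem_nhdsLE hτ.1) (Set.Icc_subset_Icc_right (hτ.2.trans hτ₀.2))
  have right : ∀ {f : ℝ → ℝ}, (∀ τ ∈ Set.Icc 0 T,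
      HasDerivWithinAt f (clampedField w hr (f τ)) (Set.Icc 0 T) τ) →
      ∀ τ ∈ Set.Ico τ₀ T, HasDerivWithinAt f (clampedField w hr (f τ)) (Set.Ici τ) τ := by
    intro f hf τ hτ
    refine (hf τ (s2 ⟨hτ.1, hτ.2.le⟩)).mono_of_mem_nhdsWithin ?_
    exact mem_of_superset (Icc_mem_nhdsGE hτ.2) (Set.Icc_subset_Icc_left (hτ₀.1.trans hτ.1))
  refine Set.EqOn.union ?_ ?_
  · exact ODE_solution_unique_of_mem_Icc_left (v := fun _ => clampedField w hr)
      (s := fun _ => Set.univ) (fun _ _ => hK.lipschitzOnWith) (cΓ.mono s1) (left hΓ)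
      (fun _ _ => trivial) (cη.mono s1) (left hη) (fun _ _ => trivial) h
  · exact ODE_solution_unique_of_mem_Icc_right (v := fun _ => clampedField w hr)
      (s := fun _ => Set.univ) (fun _ _ => hK.lipschitzOnWith) (cΓ.mono s2) (right hΓ)
      (fun _ _ => trivial) (cη.mono s2) (right hη) (fun _ _ => trivial) h

/-- If the trajectory of `X` through `z` stays below `r` up to time `t`, then the trajectory of `-X`
through `r` exists a little longer than up to time `t`, and stays above `z`. -/
theorem exists_backward_trajectory {R : ℝ≥0∞} {w : ℕ → ℝ} (hw : PowSummable R w) {r : ℝ}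
    (hrR : ENNReal.ofReal r < R) {t z : ℝ} (ht : 0 ≤ t) {γ : ℝ → ℝ}
    (hγ : IsTrajectory (powSum w) R t z γ) (hγr : γ t < r) :
    ∃ T > t, ∃ Γ : ℝ → ℝ, IsTrajectory (fun y => -powSum w y) R T r Γ ∧ z < Γ T := by
  have hz : 0 ≤ z := hγ.1 ▸ (hγ.2 0 ⟨le_rfl, ht⟩).1
  have hγt := (hγ.2 t ⟨ht, le_rfl⟩).1
  have hr : 0 ≤ r := hγt.trans hγr.le
  -- The extra unit of time leaves room to continue past t.
  obtain ⟨Γ, hΓ0, hΓ⟩ := exists_clampedField_solution hw hr hrR (T := t + 1) (by linarith)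
  have hanti := antitoneOn_of_clampedField_solution hw.1 hr hΓ
  have hsub : Set.Icc 0 t ⊆ Set.Icc 0 (t + 1) := Set.Icc_subset_Icc_right (by linarith)
  have hΓt : ∀ τ ∈ Set.Icc 0 t,
      HasDerivWithinAt Γ (clampedField w hr (Γ τ)) (Set.Icc 0 t) τ := fun τ hτ =>
    (hΓ τ (hsub hτ)).mono hsub
  set η : ℝ → ℝ := fun τ => γ (t - τ) with hη
  have hmono := hγ.monotoneOn hw.1
  have hrev : ∀ τ ∈ Set.Icc 0 t, t - τ ∈ Set.Icc 0 t := fun τ hτ =>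
    ⟨by linarith [hτ.2], by linarith [hτ.1]⟩
  have hηd : ∀ τ ∈ Set.Icc 0 t,
      HasDerivWithinAt η (clampedField w hr (η τ)) (Set.Icc 0 t) τ := by
    intro τ hτ
    have h := hγ.2 (t - τ) (hrev τ hτ)
    have hle : γ (t - τ) ≤ γ t := hmono (hrev τ hτ) ⟨ht, le_rfl⟩ (hrev τ hτ).2
    rw [clampedField_of_mem w hr ⟨h.1, hle.trans hγr.le⟩]
    exact hasDerivWithinAt_reverse h.2.2
  -- If Γ(t) ≤ z = η(t), then Γ meets the reversed trajectory η, because Γ(0) = r > γ(t) = η(0). By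
  -- uniqueness they coincide, which contradicts their values at 0.
  have hlt : z < Γ t := by
    by_contra! hcon
    have hηt : η t = z := by simp [hη, hγ.1]
    have hη0 : η 0 = γ t := by simp [hη]
    have hcont : ContinuousOn (fun τ => Γ τ - η τ) (Set.Icc 0 t) := fun τ hτ =>
      (hΓt τ hτ).continuousWithinAt.sub (hηd τ hτ).continuousWithinAt
    obtain ⟨τ₀, hτ₀, h0⟩ := intermediate_value_Icc' ht hcont
      (show (0 : ℝ) ∈ _ from ⟨by simp only [hηt]; linarith, by simp only [hη0, hΓ0]; linarith⟩)
    have := clampedField_solution_unique hw hr hrR hΓt hηd hτ₀ (sub_eq_zero.mp h0) ⟨le_rfl, ht⟩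
    rw [hΓ0, hη0] at this
    linarith
  have hc : ContinuousWithinAt Γ (Set.Ici t) t := by
    refine (hΓ t ⟨ht, by linarith⟩).continuousWithinAt.mono_of_mem_nhdsWithin ?_
    exact mem_of_superset (Icc_mem_nhdsGE (show t < t + 1 by linarith))
      (Set.Icc_subset_Icc_left ht)
  have hev : ∀ᶠ T in 𝓝[>] t, z < Γ T ∧ T ∈ Set.Ioo t (t + 1) :=
    ((hc.mono Set.Ioi_subset_Ici_self).eventually (lt_mem_nhds hlt)).and
      (Ioo_mem_nhdsGT (by linarith))
  obtain ⟨T, hzT, hT1, hT2⟩ := hev.exists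
  refine ⟨T, hT1, Γ, ⟨hΓ0, fun τ hτ => ?_⟩, hzT⟩
  have hsubT : Set.Icc 0 T ⊆ Set.Icc 0 (t + 1) := Set.Icc_subset_Icc_right hT2.le
  have h1 : z < Γ τ := hzT.trans_le
    (hanti (hsubT hτ) (hsubT ⟨ht.trans hT1.le, le_rfl⟩) hτ.2)
  have h2 : Γ τ ≤ r := hΓ0 ▸ hanti ⟨le_rfl, by linarith⟩ (hsubT hτ) hτ.1
  -- Staying above z ≥ 0 and below r means that the clamping is inactive, so Γ is a genuine
  -- trajectory of -X.
  have h0 : 0 ≤ Γ τ := hz.trans h1.le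
  refine ⟨h0, (ENNReal.ofReal_le_ofReal h2).trans_lt hrR, ?_⟩
  have := (hΓ τ (hsubT hτ)).mono hsubT
  rwa [clampedField_of_mem w hr ⟨h0, h2⟩] at this

theorem IsTrajectory.antitoneOn {R : ℝ≥0∞} {w : ℕ → ℝ} (hw : ∀ q, 0 ≤ w q) {t z : ℝ} {γ : ℝ → ℝ}
    (hγ : IsTrajectory (fun y => -powSum w y) R t z γ) : AntitoneOn γ (Set.Icc 0 t) := by
  apply antitoneOn_of_deriv_nonpos (convex_Icc 0 t)
  · exact fun τ hτ => (hγ.2 τ hτ).2.2.continuousWithinAt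
  · intro τ hτ
    exact (hγ.2 τ (interior_subset hτ)).2.2.differentiableWithinAt.mono interior_subset
  · intro τ hτ
    have h := hγ.2 τ (interior_subset hτ)
    rw [(h.2.2.hasDerivAt (mem_interior_iff_mem_nhds.mp hτ)).deriv]
    exact neg_nonpos.mpr (powSum_nonneg hw h.1)

theorem IsTrajectory.mono {Y : ℝ → ℝ} {R : ℝ≥0∞} {t T z : ℝ} {γ : ℝ → ℝ}
    (hγ : IsTrajectory Y R T z γ) (ht : t ≤ T) : IsTrajectory Y R t z γ :=
  ⟨hγ.1, fun τ hτ =>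
    have h := hγ.2 τ ⟨hτ.1, hτ.2.trans ht⟩
    ⟨h.1, h.2.1, h.2.2.mono (Set.Icc_subset_Icc_right ht)⟩⟩

/-- The time reversal of a trajectory of `-X` is a trajectory of `X`. -/
theorem IsTrajectory.reverse {R : ℝ≥0∞} {w : ℕ → ℝ} {t z : ℝ} {γ : ℝ → ℝ}
    (hγ : IsTrajectory (fun y => -powSum w y) R t z γ) :
    IsTrajectory (powSum w) R t (γ t) (fun τ => γ (t - τ)) := by
  refine ⟨by simp, fun τ hτ => ?_⟩
  have h := hγ.2 (t - τ) ⟨by linarith [hτ.2], by linarith [hτ.1]⟩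
  refine ⟨h.1, h.2.1, ?_⟩
  simpa using hasDerivWithinAt_reverse h.2.2

/-- The flow of `-X` is given by any trajectory. -/
theorem flow_eq_of_isTrajectory {R : ℝ≥0∞} {w : ℕ → ℝ} (hw : PowSummable R w) {r : ℝ}
    (hrR : ENNReal.ofReal r < R) {t : ℝ} (ht : 0 ≤ t) {γ : ℝ → ℝ}
    (hγ : IsTrajectory (fun y => -powSum w y) R t r γ) :
    flow (fun y => -powSum w y) R t r = ENNReal.ofReal (γ t) := by
  have hr : 0 ≤ r := hγ.1 ▸ (hγ.2 0 ⟨le_rfl, ht⟩).1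
  -- Trajectories of -X decrease and so remain in [0, r], where the clamped field agrees with -X.
  -- All of them have the same value at time t, and the infimum is over a single number.
  have key : ∀ γ', IsTrajectory (fun y => -powSum w y) R t r γ' → ∀ τ ∈ Set.Icc 0 t,
      HasDerivWithinAt γ' (clampedField w hr (γ' τ)) (Set.Icc 0 t) τ := by
    intro γ' hγ' τ hτ
    have h := hγ'.2 τ hτ
    have hle : γ' τ ≤ r := hγ'.1 ▸ hγ'.antitoneOn hw.1 ⟨le_rfl, ht⟩ hτ hτ.1
    rw [clampedField_of_mem w hr ⟨h.1, hle⟩]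
    exact h.2.2
  refine le_antisymm (iInf₂_le γ hγ) (le_iInf₂ fun γ' hγ' => ?_)
  rw [clampedField_solution_unique hw hr hrR (key γ hγ) (key γ' hγ') ⟨le_rfl, ht⟩
    (hγ.1.trans hγ'.1.symm) ⟨ht, le_rfl⟩]

/-- The infimum over an empty family is `⊤`, so an upper bound for the flow contains the existence
of a trajectory. -/
theorem exists_isTrajectory_of_flow_lt {Y : ℝ → ℝ} {R : ℝ≥0∞} {t z r : ℝ} (ht : 0 ≤ t)
    (h : flow Y R t z < ENNReal.ofReal r) : ∃ γ, IsTrajectory Y R t z γ ∧ γ t < r := by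
  obtain ⟨γ, hγ⟩ := iInf_lt_iff.mp h
  obtain ⟨hγ', hlt⟩ := iInf_lt_iff.mp hγ
  exact ⟨γ, hγ', (ENNReal.ofReal_lt_ofReal_iff_of_nonneg (hγ'.2 t ⟨ht, le_rfl⟩).1).mp hlt⟩

theorem powSummable_norm {E F : Type*} [NormedAddCommGroup E] [NormedSpace ℝ E]
    [NormedAddCommGroup F] [NormedSpace ℝ F] (V : FormalMultilinearSeries ℝ E F) :
    PowSummable V.radius fun q => ‖V q‖ := by
  refine ⟨fun q => norm_nonneg _, fun z hz hzR => ?_⟩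
  have := V.summable_norm_mul_pow (r := z.toNNReal) hzR
  simpa [Real.coe_toNNReal z hz] using this

/-! ### Symmetric multilinear maps and derivations along a vector field -/

section Multilinear

variable {E F : Type*} [NormedAddCommGroup E] [NormedSpace ℝ E] [NormedAddCommGroup F]
  [NormedSpace ℝ F]

/-- A symmetric multilinear map is determined by its values on the diagonal. -/
theorem eq_of_symmetric_of_diagonal_eq {k : ℕ} {g g' : E [×k]→L[ℝ] F}
    (hg : ∀ (σ : Equiv.Perm (Fin k)) (φ : Fin k → E), g (φ ∘ σ) = g φ)
    (hg' : ∀ (σ : Equiv.Perm (Fin k)) (φ : Fin k → E), g' (φ ∘ σ) = g' φ)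
    (h : ∀ φ : E, g (fun _ => φ) = g' fun _ => φ) : g = g' := by
  ext v
  -- Polarisation: the k-th derivative of φ ↦ g(φ,…,φ) in the directions v is the sum of g over all
  -- permutations of v, which is k! g(v) for symmetric g.
  have e1 := g.iteratedFDeriv_comp_diagonal 0 v
  have e2 := g'.iteratedFDeriv_comp_diagonal 0 v
  rw [show (fun x => g fun _ => x) = fun x => g' fun _ => x from funext h, e2] at e1
  have s1 : ∀ σ : Equiv.Perm (Fin k), g (fun i => v (σ i)) = g v := fun σ => hg σ v
  have s2 : ∀ σ : Equiv.Perm (Fin k), g' (fun i => v (σ i)) = g' v := fun σ => hg' σ v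
  simp only [s1, s2, Finset.sum_const, Finset.card_univ, Fintype.card_perm, Fintype.card_fin] at e1
  rw [← Nat.cast_smul_eq_nsmul ℝ, ← Nat.cast_smul_eq_nsmul ℝ] at e1
  exact (smul_right_injective F (Nat.cast_ne_zero.mpr k.factorial_ne_zero) e1).symm

/-- The symmetric part of a multilinear map. -/
noncomputable def symmetrize {k : ℕ} (g : E [×k]→L[ℝ] F) : E [×k]→L[ℝ] F :=
  (k.factorial : ℝ)⁻¹ • ∑ σ : Equiv.Perm (Fin k), g.domDomCongr σ

theorem symmetrize_apply {k : ℕ} (g : E [×k]→L[ℝ] F) (φ : Fin k → E) :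
    symmetrize g φ = (k.factorial : ℝ)⁻¹ • ∑ σ : Equiv.Perm (Fin k), g fun i => φ (σ i) := by
  simp [symmetrize]

theorem symmetrize_comp_perm {k : ℕ} (g : E [×k]→L[ℝ] F) (σ : Equiv.Perm (Fin k))
    (φ : Fin k → E) : symmetrize g (φ ∘ σ) = symmetrize g φ := by
  rw [symmetrize_apply, symmetrize_apply]
  congr 1
  exact Fintype.sum_equiv (Equiv.mulLeft σ) _ _ fun τ => rfl

theorem symmetrize_diagonal {k : ℕ} (g : E [×k]→L[ℝ] F) (φ : E) :
    symmetrize g (fun _ => φ) = g fun _ => φ := by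
  rw [symmetrize_apply, Finset.sum_const, Finset.card_univ, Fintype.card_perm, Fintype.card_fin,
    ← Nat.cast_smul_eq_nsmul ℝ, smul_smul,
    inv_mul_cancel₀ (Nat.cast_ne_zero.mpr k.factorial_ne_zero), one_smul]

theorem norm_symmetrize_le {k : ℕ} (g : E [×k]→L[ℝ] F) : ‖symmetrize g‖ ≤ ‖g‖ := by
  have hk : (0 : ℝ) < k.factorial := by positivity
  rw [symmetrize, norm_smul, norm_inv, Real.norm_of_nonneg hk.le, inv_mul_le_iff₀ hk]
  refine (norm_sum_le _ _).trans ?_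
  simp [ContinuousMultilinearMap.norm_domDomCongr, Fintype.card_perm]

/-- The multilinear map `φ ↦ f (v (φ₁, …, φ_q), φ_(q+1), …, φ_k)`. -/
noncomputable def insertFirst {q j k : ℕ} (h : q + j = k) (f : E [×(j + 1)]→L[ℝ] F)
    (v : E [×q]→L[ℝ] E) : E [×k]→L[ℝ] F :=
  (ContinuousMultilinearMap.uncurrySum
    (f.curryLeft.compContinuousMultilinearMap v)).domDomCongr (finSumFinEquiv.trans (finCongr h))

theorem insertFirst_apply {q j k : ℕ} (h : q + j = k) (f : E [×(j + 1)]→L[ℝ] F)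
    (v : E [×q]→L[ℝ] E) (φ : Fin k → E) :
    insertFirst h f v φ = f (Fin.cons (v fun i => φ (finCongr h (Fin.castAdd j i)))
      fun i => φ (finCongr h (Fin.natAdd q i))) := by
  rfl

theorem norm_insertFirst_le {q j k : ℕ} (h : q + j = k) (f : E [×(j + 1)]→L[ℝ] F)
    (v : E [×q]→L[ℝ] E) : ‖insertFirst h f v‖ ≤ ‖v‖ * ‖f‖ := by
  rw [insertFirst, ContinuousMultilinearMap.norm_domDomCongr]
  have h1 : ‖ContinuousMultilinearMap.uncurrySum (f.curryLeft.compContinuousMultilinearMap v)‖ =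
      ‖f.curryLeft.compContinuousMultilinearMap v‖ :=
    (ContinuousMultilinearMap.currySumEquiv ℝ (Fin q) (Fin j) E F).symm.norm_map _
  rw [h1, mul_comm, ← f.curryLeft_norm]
  exact ContinuousLinearMap.norm_compContinuousMultilinearMap_le _ _

/-- The derivative of the series `f` along the vector field `∑ W_q`. -/
noncomputable def alongField (W : FormalMultilinearSeries ℝ E E) (f : FormalMultilinearSeries ℝ E F) :
    FormalMultilinearSeries ℝ E F := fun k =>
  symmetrize (∑ qj ∈ (Finset.HasAntidiagonal.antidiagonal k).attach, ((qj.1.2 : ℝ) + 1) •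
    insertFirst (Finset.HasAntidiagonal.mem_antidiagonal.mp qj.2) (f (qj.1.2 + 1)) (W qj.1.1))

theorem alongField_comp_perm (W : FormalMultilinearSeries ℝ E E)
    (f : FormalMultilinearSeries ℝ E F) : IsSymmetric (alongField W f) :=
  fun _ σ φ => symmetrize_comp_perm _ σ φ

theorem alongField_diagonal (W : FormalMultilinearSeries ℝ E E)
    (f : FormalMultilinearSeries ℝ E F) (k : ℕ) (φ : E) :
    alongField W f k (fun _ => φ) = ∑ qj ∈ Finset.HasAntidiagonal.antidiagonal k,
      ((qj.2 : ℝ) + 1) • f (qj.2 + 1) (Fin.cons (W qj.1 fun _ => φ) fun _ => φ) := by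
  rw [alongField, symmetrize_diagonal, sum_apply,
    ← Finset.sum_attach (Finset.HasAntidiagonal.antidiagonal k)]
  rfl

theorem norm_alongField_le {W : FormalMultilinearSeries ℝ E E} {w : ℕ → ℝ}
    (hW : ∀ q, ‖W q‖ ≤ w q) (f : FormalMultilinearSeries ℝ E F) (k : ℕ) :
    ‖alongField W f k‖ ≤ fieldDeriv w (fun p => ‖f p‖) k := by
  refine (norm_symmetrize_le _).trans ((norm_sum_le _ _).trans ?_)
  rw [fieldDeriv, ← Finset.sum_attach (Finset.HasAntidiagonal.antidiagonal k)]
  refine Finset.sum_le_sum fun qj _ => ?_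
  rw [norm_smul, Real.norm_of_nonneg (by positivity)]
  calc _ ≤ ((qj.1.2 : ℝ) + 1) * (‖W qj.1.1‖ * ‖f (qj.1.2 + 1)‖) := by
        gcongr; exact norm_insertFirst_le _ _ _
    _ ≤ ((qj.1.2 : ℝ) + 1) * (w qj.1.1 * ‖f (qj.1.2 + 1)‖) := by gcongr; exact hW _
    _ = _ := by ring

/-- Strong continuity of the field is enough, because the coefficients it is inserted into are
continuous in norm and evaluation is jointly continuous. -/
theorem continuous_alongField {W : ℝ → FormalMultilinearSeries ℝ E E}
    (hW : ∀ q φ, Continuous fun τ => W τ q φ) {f : ℝ → FormalMultilinearSeries ℝ E F}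
    (hf : ∀ p, Continuous fun τ => f τ p) (k : ℕ) (φ : Fin k → E) :
    Continuous fun τ => alongField (W τ) (f τ) k φ := by
  simp only [alongField, symmetrize_apply, sum_apply,
    smul_apply, insertFirst_apply]
  refine continuous_const.smul (continuous_finsetSum _ fun σ _ => continuous_finsetSum _
    fun qj _ => continuous_const.smul ?_)
  exact (hf _).eval (Continuous.finCons (hW _ _) continuous_const)

end Multilinear

/-! ### Iterated time integrals -/

section TimeOrdered

variable {E : Type*} [NormedAddCommGroup E] [NormedSpace ℝ E]

open Classical in
/-- The integral of a curve of multilinear forms, taken after evaluation. -/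
noncomputable def pointwiseIntegral {p : ℕ} (A : ℝ → E [×p]→L[ℝ] ℝ) (t : ℝ) : E [×p]→L[ℝ] ℝ :=
  -- The integrand need not be continuous in operator norm, so no Bochner integral of forms is used.
  -- The default 0 does not occur under the hypotheses of `pointwiseIntegral_apply`.
  if h : ∃ B : E [×p]→L[ℝ] ℝ, ∀ φ, B φ = ∫ τ in (0 : ℝ)..t, A τ φ then h.choose else 0

theorem abs_integral_le_of_pow_bound {g : ℝ → ℝ} {C : ℝ} {k : ℕ}
    (hg : ∀ τ, |g τ| ≤ C * |τ| ^ k) (t : ℝ) :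
    |∫ τ in (0 : ℝ)..t, g τ| ≤ C * (|t| ^ (k + 1) / (k + 1)) := by
  have hi : IntervalIntegrable (fun τ : ℝ => C * |τ| ^ k) volume 0 t :=
    Continuous.intervalIntegrable (by fun_prop) _ _
  rw [← Real.norm_eq_abs, intervalIntegral.norm_integral_eq_norm_integral_uIoc]
  refine (norm_integral_le_of_norm_le (g := fun τ => C * |τ| ^ k) hi.def'
    (ae_of_all _ fun τ => hg τ)).trans ?_
  have := integral_pow_abs_sub_uIoc (a := 0) (b := t) (n := k)
  simp only [sub_zero] at this
  rw [integral_const_mul, this]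

theorem pointwiseIntegral_apply {p : ℕ} {A : ℝ → E [×p]→L[ℝ] ℝ} {C : ℝ} {k : ℕ}
    (hA : ∀ φ, Continuous fun τ => A τ φ) (hb : ∀ τ, ‖A τ‖ ≤ C * |τ| ^ k) (t : ℝ)
    (φ : Fin p → E) : pointwiseIntegral A t φ = ∫ τ in (0 : ℝ)..t, A τ φ := by
  have h : ∃ B : E [×p]→L[ℝ] ℝ, ∀ φ, B φ = ∫ τ in (0 : ℝ)..t, A τ φ := by
    refine ⟨MultilinearMap.mkContinuous
      { toFun := fun φ => ∫ τ in (0 : ℝ)..t, A τ φ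
        map_update_add' := ?_
        map_update_smul' := ?_ } (C * (|t| ^ (k + 1) / (k + 1))) ?_, fun φ => rfl⟩
    · intro _ m i x y
      simp only [ContinuousMultilinearMap.map_update_add]
      exact intervalIntegral.integral_add ((hA _).intervalIntegrable _ _)
        ((hA _).intervalIntegrable _ _)
    · intro _ m i c x
      simp only [ContinuousMultilinearMap.map_update_smul]
      exact intervalIntegral.integral_smul _ _
    · intro φ
      have := abs_integral_le_of_pow_bound (g := fun τ => A τ φ) (C := C * ∏ i, ‖φ i‖) (k := k)
        (fun τ => by
          calc |A τ φ| ≤ ‖A τ‖ * ∏ i, ‖φ i‖ := (A τ).le_opNorm φ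
            _ ≤ C * |τ| ^ k * ∏ i, ‖φ i‖ := by gcongr; exact hb τ
            _ = _ := by ring) t
      calc _ ≤ _ := this
        _ = _ := by ring
  rw [pointwiseIntegral, dif_pos h]
  exact h.choose_spec φ

theorem norm_pointwiseIntegral_le {p : ℕ} {A : ℝ → E [×p]→L[ℝ] ℝ} {C : ℝ} {k : ℕ}
    (hA : ∀ φ, Continuous fun τ => A τ φ) (hC : 0 ≤ C) (hb : ∀ τ, ‖A τ‖ ≤ C * |τ| ^ k) (t : ℝ) :
    ‖pointwiseIntegral A t‖ ≤ C * (|t| ^ (k + 1) / (k + 1)) := by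
  refine ContinuousMultilinearMap.opNorm_le_bound (by positivity) fun φ => ?_
  rw [pointwiseIntegral_apply hA hb]
  have := abs_integral_le_of_pow_bound (g := fun τ => A τ φ) (C := C * ∏ i, ‖φ i‖) (k := k)
    (fun τ => by
      calc |A τ φ| ≤ ‖A τ‖ * ∏ i, ‖φ i‖ := (A τ).le_opNorm φ
        _ ≤ C * |τ| ^ k * ∏ i, ‖φ i‖ := by gcongr; exact hb τ
        _ = _ := by ring) t
  calc _ ≤ _ := this
    _ = _ := by ring

/-- The integrand is continuous only after evaluation, but a locally uniform norm bound makes its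
integral locally Lipschitz in norm. This gain is what lets the iteration proceed. -/
theorem continuous_pointwiseIntegral {p : ℕ} {A : ℝ → E [×p]→L[ℝ] ℝ} {C : ℝ} {k : ℕ}
    (hA : ∀ φ, Continuous fun τ => A τ φ) (hC : 0 ≤ C) (hb : ∀ τ, ‖A τ‖ ≤ C * |τ| ^ k) :
    Continuous (pointwiseIntegral A) := by
  refine continuous_iff_continuousAt.mpr fun t₀ => ?_
  -- For |t - t₀| ≤ 1 every intermediate time satisfies |τ| ≤ |t₀| + 1, which gives the Lipschitz
  -- constant.
  have hlip : ∀ t, |t - t₀| ≤ 1 → ‖pointwiseIntegral A t - pointwiseIntegral A t₀‖ ≤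
      C * (|t₀| + 1) ^ k * |t - t₀| := by
    intro t ht
    refine ContinuousMultilinearMap.opNorm_le_bound (by positivity) fun φ => ?_
    rw [sub_apply, pointwiseIntegral_apply hA hb,
      pointwiseIntegral_apply hA hb, intervalIntegral.integral_interval_sub_left
        ((hA φ).intervalIntegrable _ _) ((hA φ).intervalIntegrable _ _)]
    have := intervalIntegral.norm_integral_le_of_norm_le_const (a := t₀) (b := t)
      (f := fun τ => A τ φ) (C := C * (|t₀| + 1) ^ k * ∏ i, ‖φ i‖) fun τ hτ => by
        have h1 : |τ - t₀| ≤ |t - t₀| := Set.abs_sub_left_of_mem_uIcc (Set.uIoc_subset_uIcc hτ)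
        have h2 : |τ| ≤ |t₀| + 1 := by
          have := abs_sub_abs_le_abs_sub τ t₀
          linarith
        calc ‖A τ φ‖ ≤ ‖A τ‖ * ∏ i, ‖φ i‖ := (A τ).le_opNorm φ
          _ ≤ C * |τ| ^ k * ∏ i, ‖φ i‖ := by gcongr; exact hb τ
          _ ≤ _ := by gcongr
    calc _ ≤ _ := this
      _ = _ := by ring
  rw [ContinuousAt, tendsto_iff_norm_sub_tendsto_zero]
  refine squeeze_zero' (Eventually.of_forall fun _ => norm_nonneg _) (g := fun t =>
    C * (|t₀| + 1) ^ k * |t - t₀|) ?_ ?_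
  · filter_upwards [Metric.closedBall_mem_nhds t₀ one_pos] with t ht
    exact hlip t (by simpa [Real.dist_eq] using ht)
  · have : Continuous fun t => C * (|t₀| + 1) ^ k * |t - t₀| := by fun_prop
    simpa using this.tendsto t₀

theorem hasDerivAt_pointwiseIntegral {p : ℕ} {A : ℝ → E [×p]→L[ℝ] ℝ} {C : ℝ} {k : ℕ}
    (hA : ∀ φ, Continuous fun τ => A τ φ) (hb : ∀ τ, ‖A τ‖ ≤ C * |τ| ^ k) (t : ℝ)
    (φ : Fin p → E) : HasDerivAt (fun t => pointwiseIntegral A t φ) (A t φ) t := by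
  rw [show (fun t => pointwiseIntegral A t φ) = fun t => ∫ τ in (0 : ℝ)..t, A τ φ from
    funext fun t => pointwiseIntegral_apply hA hb t φ]
  exact intervalIntegral.integral_hasDerivAt_right ((hA φ).intervalIntegrable _ _)
    ((hA φ).stronglyMeasurableAtFilter _ _) (hA φ).continuousAt

/-- The iterated integrals `∫_0^t ds₁ ⋯ ∫_0^(s_(k-1)) ds_k D(s₁) ⋯ D(s_k) f`, where `D(s)` is the
derivative along the field `∑ W_q` at time `s`. -/
noncomputable def iteratedIntegral (W : ℝ → FormalMultilinearSeries ℝ E E)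
    (f : FormalMultilinearSeries ℝ E ℝ) : ℕ → ℝ → FormalMultilinearSeries ℝ E ℝ
  | 0 => fun _ => f
  | k + 1 => fun t p => pointwiseIntegral (fun τ => alongField (W τ) (iteratedIntegral W f k τ) p) t

variable {W : ℝ → FormalMultilinearSeries ℝ E E} {w : ℕ → ℝ} {f : FormalMultilinearSeries ℝ E ℝ}

theorem norm_alongField_le_of_bound (hw : ∀ τ q, ‖W τ q‖ ≤ w q)
    {F : ℝ → FormalMultilinearSeries ℝ E ℝ} {b : ℕ → ℝ} {k : ℕ}
    (hF : ∀ τ p, ‖F τ p‖ ≤ |τ| ^ k / k.factorial * b p) (τ : ℝ) (p : ℕ) :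
    ‖alongField (W τ) (F τ) p‖ ≤ fieldDeriv w b p / k.factorial * |τ| ^ k := by
  have hw0 : ∀ q, 0 ≤ w q := fun q => (norm_nonneg _).trans (hw 0 q)
  refine (norm_alongField_le (hw τ) _ p).trans
    ((fieldDeriv_mono (b' := fun p => |τ| ^ k / k.factorial * b p) hw0 (hF τ) p).trans ?_)
  rw [fieldDeriv_const_mul]
  apply le_of_eq
  ring

/-- Norm continuity and the bound have to be proved in one induction: the continuity of the
integrand uses the first at level k, its integrability as a form uses the second. Integrating
|τ|^k/k! produces the next factorial. -/
theorem iteratedIntegral_spec (hw : ∀ τ q, ‖W τ q‖ ≤ w q)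
    (hW : ∀ q φ, Continuous fun τ => W τ q φ) (k : ℕ) :
    (∀ p, Continuous fun τ => iteratedIntegral W f k τ p) ∧
    ∀ τ p, ‖iteratedIntegral W f k τ p‖ ≤
      |τ| ^ k / k.factorial * (fieldDeriv w)^[k] (fun p => ‖f p‖) p := by
  have hw0 : ∀ q, 0 ≤ w q := fun q => (norm_nonneg _).trans (hw 0 q)
  induction k with
  | zero => exact ⟨fun p => continuous_const, fun τ p => by simp [iteratedIntegral]⟩
  | succ k ih =>
    have hb := norm_alongField_le_of_bound hw ih.2
    have hc := continuous_alongField hW ih.1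
    have hC : ∀ p, 0 ≤ fieldDeriv w ((fieldDeriv w)^[k] fun p => ‖f p‖) p / k.factorial := fun p =>
      div_nonneg (fieldDeriv_nonneg hw0 (iterate_fieldDeriv_nonneg hw0 (fun _ => norm_nonneg _) k) p)
        (by positivity)
    refine ⟨fun p => continuous_pointwiseIntegral (hc p) (hC p) fun τ => hb τ p, fun τ p => ?_⟩
    refine (norm_pointwiseIntegral_le (hc p) (hC p) (fun τ => hb τ p) τ).trans (le_of_eq ?_)
    rw [Function.iterate_succ_apply', Nat.factorial_succ]
    push_cast
    have : (k.factorial : ℝ) ≠ 0 := by positivity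
    field_simp

theorem continuous_alongField_iteratedIntegral (hw : ∀ τ q, ‖W τ q‖ ≤ w q)
    (hW : ∀ q φ, Continuous fun τ => W τ q φ) (k p : ℕ) (φ : Fin p → E) :
    Continuous fun τ => alongField (W τ) (iteratedIntegral W f k τ) p φ :=
  continuous_alongField hW (iteratedIntegral_spec hw hW k).1 p φ

theorem iteratedIntegral_succ_apply (hw : ∀ τ q, ‖W τ q‖ ≤ w q)
    (hW : ∀ q φ, Continuous fun τ => W τ q φ) (k p : ℕ) (φ : Fin p → E) (t : ℝ) :
    iteratedIntegral W f (k + 1) t p φ =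
      ∫ τ in (0 : ℝ)..t, alongField (W τ) (iteratedIntegral W f k τ) p φ :=
  pointwiseIntegral_apply (continuous_alongField_iteratedIntegral hw hW k p)
    (fun τ => norm_alongField_le_of_bound hw (iteratedIntegral_spec hw hW k).2 τ p) t φ

theorem hasDerivAt_iteratedIntegral_succ (hw : ∀ τ q, ‖W τ q‖ ≤ w q)
    (hW : ∀ q φ, Continuous fun τ => W τ q φ) (k p : ℕ) (φ : Fin p → E) (t : ℝ) :
    HasDerivAt (fun t => iteratedIntegral W f (k + 1) t p φ)
      (alongField (W t) (iteratedIntegral W f k t) p φ) t :=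
  hasDerivAt_pointwiseIntegral (continuous_alongField_iteratedIntegral hw hW k p)
    (fun τ => norm_alongField_le_of_bound hw (iteratedIntegral_spec hw hW k).2 τ p) t φ

theorem isSymmetric_iteratedIntegral (hw : ∀ τ q, ‖W τ q‖ ≤ w q)
    (hW : ∀ q φ, Continuous fun τ => W τ q φ) (hf : IsSymmetric f) (k : ℕ) (t : ℝ) :
    IsSymmetric (iteratedIntegral W f k t) := by
  cases k with
  | zero => exact hf
  | succ k =>
    intro p σ φ
    rw [iteratedIntegral_succ_apply hw hW, iteratedIntegral_succ_apply hw hW]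
    exact intervalIntegral.integral_congr fun τ _ => alongField_comp_perm _ _ p σ φ

end TimeOrdered

/-! ### The functional `α` and its time derivative -/

section Transport

variable {E : Type*} [NormedAddCommGroup E] [NormedSpace ℝ E]

theorem norm_apply_cons_le {j : ℕ} (g : E [×(j + 1)]→L[ℝ] ℝ) (x φ : E) :
    ‖g (Fin.cons x fun _ => φ)‖ ≤ ‖g‖ * (‖x‖ * ‖φ‖ ^ j) := by
  have := g.le_opNorm (Fin.cons x fun _ => φ)
  rw [Fin.prod_univ_succ] at this
  simpa using this

theorem norm_apply_const_le {p : ℕ} (g : E [×p]→L[ℝ] ℝ) (φ : E) :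
    ‖g fun _ => φ‖ ≤ ‖g‖ * ‖φ‖ ^ p := by
  simpa using g.le_opNorm fun _ => φ

/-- The sum of `∑ p f_p(W ⊗ φ^(p-1))`, sorted by degrees. -/
theorem tsum_alongField {W : FormalMultilinearSeries ℝ E E} {w : ℕ → ℝ} (hw : ∀ q, ‖W q‖ ≤ w q)
    {g : FormalMultilinearSeries ℝ E ℝ} {c : ℕ → ℝ} (hg : ∀ p, ‖g p‖ ≤ c p) {z : ℝ} (hz : 0 ≤ z)
    (hws : Summable fun q => w q * z ^ q)
    (hcs : Summable fun j : ℕ => ((j : ℝ) + 1) * c (j + 1) * z ^ j) {φ ξ : E} (hφ : ‖φ‖ ≤ z)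
    (hξ : HasSum (fun q => W q fun _ => φ) ξ) :
    ∑' p, alongField W g p (fun _ => φ) =
      ∑' j : ℕ, ((j : ℝ) + 1) * g (j + 1) (Fin.cons ξ fun _ => φ) := by
  have hw0 : ∀ q, 0 ≤ w q := fun q => (norm_nonneg _).trans (hw q)
  have hc0 : ∀ q, 0 ≤ c q := fun q => (norm_nonneg _).trans (hg q)
  -- Both sides are sums of this absolutely convergent double family: grouped by the total degree q
  -- + j on the left, and summed over q first on the right, where multilinearity and continuity put
  -- Σ W_q inside.
  set F : ℕ × ℕ → ℝ := fun qj =>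
    ((qj.2 : ℝ) + 1) * g (qj.2 + 1) (Fin.cons (W qj.1 fun _ => φ) fun _ => φ) with hF
  have hFs : Summable F := by
    refine Summable.of_norm_bounded (hws.mul_of_nonneg hcs (fun q => ?_) fun j => ?_) fun qj => ?_
    · have := hw0 q
      simp only [Pi.zero_apply]
      positivity
    · have := hc0 (j + 1)
      simp only [Pi.zero_apply]
      positivity
    · rw [hF, norm_mul, Real.norm_of_nonneg (by positivity)]
      have h1 : ‖W qj.1 fun _ => φ‖ ≤ w qj.1 * z ^ qj.1 := by
        refine ((W qj.1).le_opNorm _).trans ?_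
        have := hw0 qj.1
        simp only [Finset.prod_const, Finset.card_univ, Fintype.card_fin]
        gcongr
        exact hw _
      have := hw0 qj.1
      have := hc0 (qj.2 + 1)
      calc _ ≤ ((qj.2 : ℝ) + 1) * (c (qj.2 + 1) * ((w qj.1 * z ^ qj.1) * z ^ qj.2)) := by
            gcongr
            refine (norm_apply_cons_le _ _ _).trans ?_
            gcongr
            exact hg _
        _ = _ := by ring
  have e1 : ∑' p, alongField W g p (fun _ => φ) = ∑' qj, F qj := by
    rw [← Finset.HasAntidiagonal.sigmaAntidiagonalEquivProd.tsum_eq F]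
    refine Eq.trans ?_ ((Finset.HasAntidiagonal.sigmaAntidiagonalEquivProd.summable_iff.mpr
      hFs).tsum_sigma' fun p => (hasSum_fintype _).summable).symm
    refine tsum_congr fun p => ?_
    rw [alongField_diagonal, tsum_fintype, ← Finset.sum_coe_sort]
    rfl
  rw [e1, ← (Equiv.prodComm ℕ ℕ).tsum_eq F]
  refine (((Equiv.prodComm ℕ ℕ).summable_iff.mpr hFs).tsum_prod).trans ?_
  refine tsum_congr fun j => ?_
  have h := hξ.mapL (g (j + 1)).curryLeft
  have h' := (ContinuousMultilinearMap.apply ℝ (fun _ : Fin j => E) ℝ fun _ => φ).hasSum h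
  exact (h'.mul_left ((j : ℝ) + 1)).tsum_eq

/-- A product rule in which G is differentiable only at the fixed argument ψ(t₀). Norm continuity of
G replaces norm differentiability: it controls the mixed term. -/
theorem hasDerivAt_apply_curve {p : ℕ} {G : ℝ → E [×p]→L[ℝ] ℝ} {ψ : ℝ → E} {ψ' : E} {G' t₀ : ℝ}
    (hG : ContinuousAt G t₀) (hG' : HasDerivAt (fun t => G t fun _ => ψ t₀) G' t₀)
    (hψ : HasDerivAt ψ ψ' t₀) :
    HasDerivAt (fun t => G t fun _ => ψ t)
      (G' + ∑ i, G t₀ (Function.update (fun _ => ψ t₀) i ψ')) t₀ := by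
  have hpi : HasDerivAt (fun t => fun _ : Fin p => ψ t) (fun _ => ψ') t₀ :=
    hasDerivAt_pi.mpr fun _ => hψ
  have h1 : HasDerivAt (fun t => G t₀ fun _ => ψ t)
      (∑ i, G t₀ (Function.update (fun _ => ψ t₀) i ψ')) t₀ := by
    have := ((G t₀).hasFDerivAt (fun _ => ψ t₀)).comp_hasDerivAt t₀ hpi
    simpa [Function.comp_def] using this
  -- The mixed second difference is bounded by ‖G t - G t₀‖ times a multiple of ‖ψ t - ψ t₀‖, that
  -- is, by o(1)·O(t - t₀).
  set rem : ℝ → ℝ := fun t => (G t - G t₀) (fun _ => ψ t) - (G t - G t₀) fun _ => ψ t₀ with hrem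
  have h2 : HasDerivAt rem 0 t₀ := by
    rw [hasDerivAt_iff_isLittleO]
    have hb : ∀ᶠ t in 𝓝 t₀, ‖rem t‖ ≤ ‖G t - G t₀‖ * (p * (‖ψ t₀‖ + 1) ^ (p - 1)) *
        ‖ψ t - ψ t₀‖ := by
      have hn : ∀ᶠ t in 𝓝 t₀, ‖ψ t‖ < ‖ψ t₀‖ + 1 :=
        hψ.continuousAt.norm.eventually (gt_mem_nhds (by linarith))
      filter_upwards [hn] with t ht
      refine ((G t - G t₀).norm_image_sub_le _ _).trans ?_
      have hm : ∀ x : E, ‖(fun _ : Fin p => x)‖ ≤ ‖x‖ := fun x => pi_norm_const_le x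
      have e : ((fun _ : Fin p => ψ t) - fun _ => ψ t₀) = fun _ => ψ t - ψ t₀ := rfl
      rw [e, Fintype.card_fin, ← mul_assoc]
      gcongr
      · exact max_le ((hm _).trans ht.le) ((hm _).trans (by linarith))
      · exact hm _
    have h0 : Tendsto (fun t => ‖G t - G t₀‖ * (p * (‖ψ t₀‖ + 1) ^ (p - 1))) (𝓝 t₀) (𝓝 0) := by
      have := (tendsto_iff_norm_sub_tendsto_zero.mp hG).mul_const
        (p * (‖ψ t₀‖ + 1) ^ (p - 1) : ℝ)
      simpa using this
    have h3 : (fun t => ‖G t - G t₀‖ * (p * (‖ψ t₀‖ + 1) ^ (p - 1)) * ‖ψ t - ψ t₀‖)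
        =o[𝓝 t₀] fun t => t - t₀ := by
      have ho := (Asymptotics.isLittleO_one_iff ℝ).mpr h0
      have hO : (fun t => ‖ψ t - ψ t₀‖) =O[𝓝 t₀] fun t => t - t₀ :=
        (hψ.isBigO_sub).norm_left
      simpa using ho.mul_isBigO hO
    have hr0 : rem t₀ = 0 := by simp [hrem]
    simp only [hr0, sub_zero, smul_zero]
    refine Asymptotics.IsBigO.trans_isLittleO (Asymptotics.IsBigO.of_bound' ?_) h3
    filter_upwards [hb] with t ht
    exact ht.trans (Real.le_norm_self _)
  have h3 := (hG'.add h1).add h2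
  have hc : HasDerivAt (fun _ : ℝ => G t₀ fun _ => ψ t₀) 0 t₀ := hasDerivAt_const _ _
  have h4 := h3.sub hc
  refine (h4.congr_deriv (by simp)).congr_of_eventuallyEq (Eventually.of_forall fun t => ?_)
  simp only [hrem, Pi.add_apply, Pi.sub_apply, sub_apply]
  ring

/-- The transposition of 0 and i carries one tuple to the other. -/
theorem apply_update_eq_of_symmetric {j : ℕ} {g : E [×(j + 1)]→L[ℝ] ℝ}
    (hg : ∀ (σ : Equiv.Perm (Fin (j + 1))) (φ : Fin (j + 1) → E), g (φ ∘ σ) = g φ) (x φ : E)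
    (i : Fin (j + 1)) :
    g (Function.update (fun _ => φ) i x) = g (Fin.cons x fun _ => φ) := by
  rw [← hg (Equiv.swap 0 i) (Fin.cons x fun _ => φ)]
  congr 1
  funext l
  by_cases h : l = i
  · subst h
    simp
  · rw [Function.update_of_ne h, Function.comp_apply]
    by_cases h0 : l = 0
    · subst h0
      rw [Equiv.swap_apply_left]
      obtain ⟨i', rfl⟩ := Fin.exists_succ_eq.mpr (Ne.symm h)
      simp
    · rw [Equiv.swap_apply_of_ne_of_ne h0 h]
      obtain ⟨l', rfl⟩ := Fin.exists_succ_eq.mpr h0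
      simp

variable (W : ℝ → FormalMultilinearSeries ℝ E E) (f : FormalMultilinearSeries ℝ E ℝ)

/-- The value at `ψ(t)` of the time ordered exponential, applied to `f`. -/
noncomputable def orderedExpAt (ψ : ℝ → E) (t : ℝ) : ℝ :=
  ∑' kp : ℕ × ℕ, iteratedIntegral W f kp.1 t kp.2 fun _ => ψ t

/-- The bound of the norms of the iterated integrals up to time `T`. -/
noncomputable def iteratedBound (w : ℕ → ℝ) (T : ℝ) (k p : ℕ) : ℝ :=
  T ^ k / k.factorial * (fieldDeriv w)^[k] (fun p => ‖f p‖) p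

variable {W f} {w : ℕ → ℝ} {T z ρ : ℝ}

theorem iteratedBound_nonneg (hw : ∀ q, 0 ≤ w q) (hT : 0 ≤ T) (k p : ℕ) :
    0 ≤ iteratedBound f w T k p :=
  mul_nonneg (by positivity) (iterate_fieldDeriv_nonneg hw (fun _ => norm_nonneg _) k p)

theorem norm_iteratedIntegral_le (hw : ∀ τ q, ‖W τ q‖ ≤ w q)
    (hW : ∀ q φ, Continuous fun τ => W τ q φ) {t : ℝ} (ht : |t| ≤ T) (k p : ℕ) :
    ‖iteratedIntegral W f k t p‖ ≤ iteratedBound f w T k p := by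
  have hw0 : ∀ q, 0 ≤ w q := fun q => (norm_nonneg _).trans (hw 0 q)
  refine ((iteratedIntegral_spec hw hW k).2 t p).trans ?_
  have := iterate_fieldDeriv_nonneg hw0 (b := fun p => ‖f p‖) (fun _ => norm_nonneg _) k p
  unfold iteratedBound
  gcongr

theorem continuousOn_orderedExpAt (hw : ∀ τ q, ‖W τ q‖ ≤ w q)
    (hW : ∀ q φ, Continuous fun τ => W τ q φ) {U : Set ℝ} {ψ : ℝ → E} (hψ : ContinuousOn ψ U)
    (hTU : ∀ t ∈ U, |t| ≤ T) (hz : ∀ t ∈ U, ‖ψ t‖ ≤ z)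
    (hs : Summable fun kp : ℕ × ℕ => iteratedBound f w T kp.1 kp.2 * z ^ kp.2) :
    ContinuousOn (orderedExpAt W f ψ) U := by
  refine continuousOn_tsum (fun kp => ?_) hs fun kp t ht => ?_
  · exact ((iteratedIntegral_spec hw hW kp.1).1 kp.2).continuousOn.eval
      (continuousOn_pi.mpr fun _ => hψ)
  · have hw0 : ∀ q, 0 ≤ w q := fun q => (norm_nonneg _).trans (hw 0 q)
    have hT : 0 ≤ T := (abs_nonneg t).trans (hTU t ht)
    have := iteratedBound_nonneg (f := f) hw0 hT kp.1 kp.2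
    refine (norm_apply_const_le _ _).trans ?_
    gcongr
    · exact norm_iteratedIntegral_le hw hW (hTU t ht) _ _
    · exact hz t ht

/-- The loss of radius from ρ to z pays for the factor j + 1, with the constant 1/(ρ - z) for all k
at once. -/
theorem summable_iteratedBound_deriv (hw : ∀ q, 0 ≤ w q) (hT : 0 ≤ T) (hz : 0 ≤ z) (hzρ : z < ρ)
    (hs : Summable fun kp : ℕ × ℕ => iteratedBound f w T kp.1 kp.2 * ρ ^ kp.2) :
    Summable fun kj : ℕ × ℕ =>
      ((kj.2 : ℝ) + 1) * iteratedBound f w T kj.1 (kj.2 + 1) * z ^ kj.2 := by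
  have hd : 0 < ρ - z := sub_pos.mpr hzρ
  have hinj : Function.Injective fun kj : ℕ × ℕ => (kj.1, kj.2 + 1) := fun a b h => by
    simp only [Prod.mk.injEq, add_left_inj] at h
    exact Prod.ext h.1 h.2
  refine ((hs.comp_injective hinj).div_const (ρ - z)).of_nonneg_of_le (fun kj => ?_) fun kj => ?_
  · have := iteratedBound_nonneg (f := f) hw hT kj.1 (kj.2 + 1)
    positivity
  · have := iteratedBound_nonneg (f := f) hw hT kj.1 (kj.2 + 1)
    rw [le_div_iff₀ hd]
    calc _ = iteratedBound f w T kj.1 (kj.2 + 1) *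
          (((kj.2 : ℝ) + 1) * z ^ kj.2 * (ρ - z)) := by ring
      _ ≤ _ := mul_le_mul_of_nonneg_left (succ_mul_pow_mul_sub_le hz hzρ.le _) this

/-- Along a curve with `ψ' = -∑ W_q(ψ, …, ψ)`, the value of the time ordered exponential does not
change. -/
theorem hasDerivAt_orderedExpAt (hw : ∀ τ q, ‖W τ q‖ ≤ w q)
    (hW : ∀ q φ, Continuous fun τ => W τ q φ) (hf : IsSymmetric f) (hz : 0 ≤ z) (hzρ : z < ρ)
    (hws : Summable fun q => w q * z ^ q)
    (hs : Summable fun kp : ℕ × ℕ => iteratedBound f w T kp.1 kp.2 * ρ ^ kp.2)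
    {U : Set ℝ} (hU : IsOpen U) (hU' : IsPreconnected U) {ψ ξ : ℝ → E}
    (hψ : ∀ t ∈ U, HasDerivAt ψ (-ξ t) t)
    (hξ : ∀ t ∈ U, HasSum (fun q => W t q fun _ => ψ t) (ξ t))
    (hTU : ∀ t ∈ U, |t| ≤ T) (hψz : ∀ t ∈ U, ‖ψ t‖ ≤ z) {t : ℝ} (ht : t ∈ U) :
    HasDerivAt (orderedExpAt W f ψ) 0 t := by
  have hT : 0 ≤ T := (abs_nonneg t).trans (hTU t ht)
  have hw0 : ∀ q, 0 ≤ w q := fun q => (norm_nonneg _).trans (hw 0 q)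
  set c : ℕ → ℕ → ℝ := iteratedBound f w T with hc
  have hc0 : ∀ k p, 0 ≤ c k p := iteratedBound_nonneg hw0 hT
  have hG : ∀ t ∈ U, ∀ k p, ‖iteratedIntegral W f k t p‖ ≤ c k p := fun t ht k p =>
    norm_iteratedIntegral_le hw hW (hTU t ht) k p
  have hX : 0 ≤ powSum w z := powSum_nonneg hw0 hz
  have hξX : ∀ t ∈ U, ‖ξ t‖ ≤ powSum w z := by
    intro t ht
    refine (hξ t ht).norm_le_of_bounded hws.hasSum fun q => ?_
    refine ((W t q).le_opNorm _).trans ?_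
    have := hw0 q
    simp only [Finset.prod_const, Finset.card_univ, Fintype.card_fin]
    gcongr
    exacts [hw t q, hψz t ht]
  -- A is the explicit time derivative of the term (k, p), zero for k = 0, where the term is f. B
  -- below is minus the contribution of the motion of ψ. The families a and b dominate them
  -- uniformly on U.
  set A : ℕ → ℕ → ℝ → ℝ := fun k p t => match k with
    | 0 => 0
    | k + 1 => alongField (W t) (iteratedIntegral W f k t) p fun _ => ψ t with hA
  set B : ℕ → ℕ → ℝ → ℝ := fun k p t =>
    ∑ i, iteratedIntegral W f k t p (Function.update (fun _ => ψ t) i (ξ t)) with hB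
  set a : ℕ × ℕ → ℝ := fun kp => match kp.1 with
    | 0 => 0
    | k + 1 => fieldDeriv w (c k) kp.2 * z ^ kp.2 with ha
  set b : ℕ × ℕ → ℝ := fun kp => match kp.2 with
    | 0 => 0
    | j + 1 => powSum w z * (((j : ℝ) + 1) * c kp.1 (j + 1) * z ^ j) with hb
  have hS := summable_iteratedBound_deriv hw0 hT hz hzρ hs
  have hS1 : ∀ k, Summable fun j : ℕ => ((j : ℝ) + 1) * c k (j + 1) * z ^ j := fun k =>
    hS.prod_factor k
  have hS2 := hS.prod
  have hterm : ∀ (kp : ℕ × ℕ), ∀ t ∈ U, HasDerivAt (fun t => iteratedIntegral W f kp.1 t kp.2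
      fun _ => ψ t) (A kp.1 kp.2 t - B kp.1 kp.2 t) t := by
    rintro ⟨k, p⟩ t ht
    have hcont := ((iteratedIntegral_spec (f := f) hw hW k).1 p).continuousAt (x := t)
    have hG' : HasDerivAt (fun τ => iteratedIntegral W f k τ p fun _ => ψ t) (A k p t) t := by
      cases k with
      | zero => exact hasDerivAt_const t (f p fun _ => ψ t)
      | succ k => exact hasDerivAt_iteratedIntegral_succ (f := f) hw hW k p (fun _ => ψ t) t
    refine (hasDerivAt_apply_curve hcont hG' (hψ t ht)).congr_deriv ?_
    rw [sub_eq_add_neg, hB, ← Finset.sum_neg_distrib]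
    have hneg : -ξ t = (-1 : ℝ) • ξ t := (neg_one_smul ℝ _).symm
    simp only [hneg, ContinuousMultilinearMap.map_update_smul]
    simp
  have hBsymm : ∀ t ∈ U, ∀ k j, B k (j + 1) t = ((j : ℝ) + 1) *
      iteratedIntegral W f k t (j + 1) (Fin.cons (ξ t) fun _ => ψ t) := by
    intro t ht k j
    have hsym := isSymmetric_iteratedIntegral hw hW hf k t (j + 1)
    simp only [hB, apply_update_eq_of_symmetric hsym, Finset.sum_const, Finset.card_univ,
      Fintype.card_fin, nsmul_eq_mul]
    push_cast
    ring
  have hAle : ∀ t ∈ U, ∀ kp : ℕ × ℕ, ‖A kp.1 kp.2 t‖ ≤ a kp := by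
    rintro t ht ⟨k, p⟩
    cases k with
    | zero => simp [hA, ha]
    | succ k =>
      refine (norm_apply_const_le _ _).trans ?_
      have := fieldDeriv_nonneg hw0 (hc0 k) p
      simp only [ha]
      gcongr
      · exact (norm_alongField_le (hw t) _ p).trans (fieldDeriv_mono hw0 (hG t ht k) p)
      · exact hψz t ht
  have hBle : ∀ t ∈ U, ∀ kp : ℕ × ℕ, ‖B kp.1 kp.2 t‖ ≤ b kp := by
    rintro t ht ⟨k, p⟩
    cases p with
    | zero => simp [hB, hb]
    | succ j =>
      simp only [hBsymm t ht, hb]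
      rw [norm_mul, Real.norm_of_nonneg (by positivity)]
      have := hc0 k (j + 1)
      calc _ ≤ ((j : ℝ) + 1) * (c k (j + 1) * (powSum w z * z ^ j)) := by
            gcongr
            refine (norm_apply_cons_le _ _ _).trans ?_
            gcongr
            exacts [hG t ht k _, hξX t ht, hψz t ht]
        _ = _ := by ring
  have hfd : ∀ k, (Summable fun p => fieldDeriv w (c k) p * z ^ p) ∧
      powSum (fieldDeriv w (c k)) z =
        powSum w z * ∑' j : ℕ, ((j : ℝ) + 1) * c k (j + 1) * z ^ j := fun k =>
    summable_fieldDeriv hws (hS1 k)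
  have has : Summable a := by
    rw [summable_prod_of_nonneg fun kp => (norm_nonneg _).trans (hAle t ht kp)]
    refine ⟨fun k => ?_, ?_⟩
    · cases k with
      | zero => exact summable_zero
      | succ k => exact (hfd k).1
    · rw [← summable_nat_add_iff 1]
      exact (hS2.mul_left (powSum w z)).congr fun k => ((hfd k).2).symm
  have hbs : Summable b := by
    rw [summable_prod_of_nonneg fun kp => (norm_nonneg _).trans (hBle t ht kp)]
    have h1 : ∀ k, Summable fun p => b (k, p) := fun k => by
      rw [← summable_nat_add_iff 1]
      exact (hS1 k).mul_left _
    refine ⟨h1, (hS2.mul_left (powSum w z)).congr fun k => ?_⟩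
    rw [(h1 k).tsum_eq_zero_add, ← tsum_mul_left]
    simp [hb, hc]
  -- The transport equation in terms of series: after summation over degrees, A at level k + 1
  -- equals B at level k, since both are the derivative of the k-th iterated integral along W. The
  -- shift by one in k is harmless because A vanishes at k = 0.
  have hsum : ∑' kp : ℕ × ℕ, (A kp.1 kp.2 t - B kp.1 kp.2 t) = 0 := by
    have hAs : Summable fun kp : ℕ × ℕ => A kp.1 kp.2 t := has.of_norm_bounded (hAle t ht)
    have hBs : Summable fun kp : ℕ × ℕ => B kp.1 kp.2 t := hbs.of_norm_bounded (hBle t ht)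
    rw [hAs.tsum_sub hBs, hAs.tsum_prod, hBs.tsum_prod, hAs.prod.tsum_eq_zero_add, sub_eq_zero]
    have e0 : ∑' p, A 0 p t = 0 := tsum_zero
    rw [e0, zero_add]
    refine tsum_congr fun k => ?_
    have hBk : Summable fun p => B k p t := hBs.prod_factor k
    rw [hBk.tsum_eq_zero_add]
    have e1 : B k 0 t = 0 := by simp [hB]
    rw [e1, zero_add]
    simp only [hBsymm t ht]
    exact tsum_alongField (hw t) (hG t ht k) hz hws (hS1 k) (hψz t ht) (hξ t ht)
  have hzρs : Summable fun kp : ℕ × ℕ => iteratedIntegral W f kp.1 t kp.2 fun _ => ψ t := by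
    refine Summable.of_norm_bounded hs fun kp => ?_
    have := hc0 kp.1 kp.2
    refine (norm_apply_const_le _ _).trans ?_
    gcongr
    exacts [hG t ht _ _, (hψz t ht).trans hzρ.le]
  have := hasDerivAt_tsum_of_isPreconnected (has.add hbs) hU hU' hterm
    (fun kp t ht => (norm_sub_le _ _).trans (add_le_add (hAle t ht kp) (hBle t ht kp))) ht hzρs ht
  rwa [hsum] at this

end Transport

/-! ### Convergence in Fock spaces and exponentials of derivations -/

section FockSpace

variable {n : ℕ} {m s : ℝ} [Fact (0 < m)]

theorem summable_of_fockNorm_lt_top {r : ℝ} (hr : 0 ≤ r) {f : Series n m s}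
    (h : fockNorm r f < ⊤) : Summable fun p => ‖f p‖ * r ^ p := by
  refine (ENNReal.summable_toReal h.ne).congr fun p => ?_
  exact ENNReal.toReal_ofReal (by positivity)

theorem fockNorm_lt_top_of_summable {r : ℝ} {f : Series n m s}
    (h : Summable fun p => ‖f p‖ * r ^ p) : fockNorm r f < ⊤ := by
  unfold fockNorm
  simpa [lt_top_iff_ne_top] using h.tsum_ofReal_ne_top

theorem tsum_fockNorm_lt_top_of_summable {r : ℝ} {F : ℕ → Series n m s}
    (h : Summable fun kp : ℕ × ℕ => ‖F kp.1 kp.2‖ * r ^ kp.2) : ∑' k, fockNorm r (F k) < ⊤ := by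
  unfold fockNorm
  rw [← ENNReal.tsum_prod (f := fun k p => ENNReal.ofReal (‖F k p‖ * r ^ p))]
  exact lt_top_iff_ne_top.mpr h.tsum_ofReal_ne_top

/-- An absolutely convergent series in `𝔽_r` has a sum in `𝔽_r`. -/
theorem exists_hasSum_fock {r : ℝ} (hr : 0 < r) {F : ℕ → Series n m s}
    (hsym : ∀ k, IsSymmetric (F k))
    (h : Summable fun kp : ℕ × ℕ => ‖F kp.1 kp.2‖ * r ^ kp.2) :
    ∃ g ∈ Fock n m s r, ∀ p, HasSum (fun k => F k p) (g p) := by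
  have h' := h.prod_symm
  -- Dividing by r^p requires r > 0; for r = 0 only degree 0 would be controlled.
  have hp : ∀ p, Summable fun k => ‖F k p‖ := fun p => by
    have hne : r ^ p ≠ 0 := (pow_pos hr p).ne'
    exact (summable_mul_right_iff hne).mp (h'.prod_factor p)
  have hs : ∀ p, HasSum (fun k => F k p) (∑' k, F k p) := fun p => (hp p).of_norm.hasSum
  refine ⟨fun p => ∑' k, F k p, ⟨fun p σ φ => ?_, fockNorm_lt_top_of_summable ?_⟩, hs⟩
  · have e : ∀ φ, HasSum (fun k => F k p φ) ((∑' k, F k p) φ) := fun φ =>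
      (ContinuousMultilinearMap.apply ℝ (fun _ : Fin p => Free n m s) ℝ φ).hasSum (hs p)
    refine (e (φ ∘ σ)).unique ((e φ).congr_fun ?_)
    exact fun k => hsym k p σ φ
  · refine h'.prod.of_nonneg_of_le (fun p => by positivity) fun p => ?_
    calc _ ≤ (∑' k, ‖F k p‖) * r ^ p := by
          gcongr
          exact norm_tsum_le_tsum_norm (hp p)
      _ = ∑' k, ‖F k p‖ * r ^ p := tsum_mul_right.symm

theorem delta_apply (ψ : Free n m s) (f : Series n m s) (k : ℕ) (φ : Fin k → Free n m s) :
    delta ψ f k φ = ((k : ℝ) + 1) * f (k + 1) (Fin.cons ψ φ) := rfl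

theorem norm_delta_le (ψ : Free n m s) (f : Series n m s) (k : ℕ) :
    ‖delta ψ f k‖ ≤ ((k : ℝ) + 1) * (‖f (k + 1)‖ * ‖ψ‖) := by
  unfold delta
  rw [norm_smul, Real.norm_of_nonneg (by positivity)]
  gcongr
  exact MultilinearMap.mkContinuous_norm_le _ (by positivity) _

theorem isSymmetric_delta (ψ : Free n m s) {f : Series n m s} (hf : IsSymmetric f) :
    IsSymmetric (delta ψ f) := by
  intro k σ φ
  -- The permutation σ of the last k slots is extended by fixing slot 0, which is occupied by ψ.
  rw [delta_apply, delta_apply, ← hf (k + 1) (Equiv.Perm.decomposeFin.symm (0, σ)) (Fin.cons ψ φ)]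
  congr 2
  funext i
  refine Fin.cases ?_ (fun i => ?_) i
  · simp
  · simp

theorem isSymmetric_iterate_delta (ψ : Free n m s) {f : Series n m s} (hf : IsSymmetric f)
    (k : ℕ) : IsSymmetric ((delta ψ)^[k] f) := by
  induction k with
  | zero => exact hf
  | succ k ih =>
    rw [Function.iterate_succ_apply']
    exact isSymmetric_delta ψ ih

theorem norm_iterate_delta_le (ψ : Free n m s) (f : Series n m s) (k : ℕ) : ∀ p,
    ‖(delta ψ)^[k] f p‖ ≤ ((p + k).factorial / p.factorial : ℝ) * (‖f (p + k)‖ * ‖ψ‖ ^ k) := by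
  induction k with
  | zero =>
    intro p
    have : (p.factorial : ℝ) ≠ 0 := by positivity
    simp [div_self this]
  | succ k ih =>
    intro p
    rw [Function.iterate_succ_apply']
    refine (norm_delta_le _ _ _).trans ?_
    calc _ ≤ ((p : ℝ) + 1) * (((p + 1 + k).factorial / (p + 1).factorial : ℝ) *
          (‖f (p + 1 + k)‖ * ‖ψ‖ ^ k) * ‖ψ‖) := by gcongr; exact ih (p + 1)
      _ = _ := by
        rw [show p + 1 + k = p + (k + 1) by ring, Nat.factorial_succ p]
        push_cast
        have : (p.factorial : ℝ) ≠ 0 := by positivity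
        field_simp
        ring

theorem iterate_delta_const (ψ : Free n m s) (f : Series n m s) (k : ℕ) : ∀ p,
    (delta ψ)^[k] f p (fun _ => ψ) =
      ((p + k).factorial / p.factorial : ℝ) * f (p + k) fun _ => ψ := by
  induction k with
  | zero =>
    intro p
    have : (p.factorial : ℝ) ≠ 0 := by positivity
    simp [div_self this]
  | succ k ih =>
    intro p
    have e : (Fin.cons ψ fun _ => ψ : Fin (p + 1) → Free n m s) = fun _ => ψ := by
      funext i
      refine Fin.cases ?_ (fun i => ?_) i <;> simp
    rw [Function.iterate_succ_apply', delta_apply, e, ih (p + 1),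
      show p + 1 + k = p + (k + 1) by ring, Nat.factorial_succ p]
    push_cast
    have : (p.factorial : ℝ) ≠ 0 := by positivity
    field_simp

/-- The exponential of `δ/δψ` maps `𝔽_ρ` to `𝔽_(ρ-σ)` if `‖ψ‖ ≤ σ < ρ`. -/
theorem exists_hasExp_delta {ρ σ : ℝ} {ψ : Free n m s} (hψ : ‖ψ‖ ≤ σ) (hσ : σ < ρ)
    {g : Series n m s} (hg : g ∈ Fock n m s ρ) :
    ∃ h ∈ Fock n m s (ρ - σ), HasExp (delta ψ) (ρ - σ) g h := by
  have hσ0 : 0 ≤ σ := (norm_nonneg _).trans hψ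
  have hd : 0 < ρ - σ := sub_pos.mpr hσ
  set F : ℕ → Series n m s := fun k => ((k.factorial : ℝ)⁻¹) • (delta ψ)^[k] g with hF
  have hsum : Summable fun kp : ℕ × ℕ => ‖F kp.1 kp.2‖ * (ρ - σ) ^ kp.2 := by
    -- The degree p part of δ^k g/k! costs the binomial coefficient of k + p over k. Summation over
    -- k + p = n is the binomial formula for (σ + (ρ - σ))^n = ρ^n, so the whole series is N_ρ(g).
    have h1 : Summable fun kp : ℕ × ℕ => ((kp.1 + kp.2).choose kp.1 : ℝ) *
        (σ ^ kp.1 * (ρ - σ) ^ kp.2) * ‖g (kp.1 + kp.2)‖ := by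
      rw [← Finset.HasAntidiagonal.sigmaAntidiagonalEquivProd.summable_iff,
        summable_sigma_of_nonneg fun x => by
          simp only [Function.comp_apply]
          positivity]
      refine ⟨fun n => (hasSum_fintype _).summable,
        (summable_of_fockNorm_lt_top (by linarith) hg.2).congr fun n => ?_⟩
      rw [tsum_fintype]
      have e := (Commute.all σ (ρ - σ)).add_pow' n
      rw [add_sub_cancel] at e
      rw [e, Finset.mul_sum, ← Finset.sum_coe_sort (Finset.HasAntidiagonal.antidiagonal n)]
      refine Finset.sum_congr rfl fun kp _ => ?_
      have hkp : (kp : ℕ × ℕ).1 + (kp : ℕ × ℕ).2 = n :=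
        Finset.HasAntidiagonal.mem_antidiagonal.mp kp.2
      change _ = (((kp : ℕ × ℕ).1 + (kp : ℕ × ℕ).2).choose (kp : ℕ × ℕ).1 : ℝ) *
        (σ ^ (kp : ℕ × ℕ).1 * (ρ - σ) ^ (kp : ℕ × ℕ).2) * ‖g ((kp : ℕ × ℕ).1 + (kp : ℕ × ℕ).2)‖
      rw [hkp, nsmul_eq_mul]
      ring
    refine h1.of_nonneg_of_le (fun kp => by positivity) fun kp => ?_
    have h2 := norm_iterate_delta_le ψ g kp.1 kp.2
    have e : ‖F kp.1 kp.2‖ = ((kp.1.factorial : ℝ)⁻¹) * ‖(delta ψ)^[kp.1] g kp.2‖ := by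
      change ‖((kp.1.factorial : ℝ)⁻¹) • (delta ψ)^[kp.1] g kp.2‖ = _
      rw [norm_smul, Real.norm_of_nonneg (by positivity)]
    rw [e, Nat.cast_add_choose]
    calc _ ≤ ((kp.1.factorial : ℝ)⁻¹) * (((kp.2 + kp.1).factorial / kp.2.factorial : ℝ) *
          (‖g (kp.2 + kp.1)‖ * σ ^ kp.1)) * (ρ - σ) ^ kp.2 := by
          gcongr
          refine h2.trans ?_
          gcongr
      _ = _ := by
          rw [add_comm kp.2 kp.1]
          have : (kp.1.factorial : ℝ) ≠ 0 := by positivity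
          field_simp
  have hsym : ∀ k, IsSymmetric (F k) := fun k p τ φ => by
    change ((k.factorial : ℝ)⁻¹) • (delta ψ)^[k] g p (φ ∘ τ) = _
    rw [isSymmetric_iterate_delta ψ hg.1 k p τ φ]
    rfl
  obtain ⟨h, hh, hh'⟩ := exists_hasSum_fock hd hsym hsum
  exact ⟨h, hh, tsum_fockNorm_lt_top_of_summable hsum, hh'⟩

/-- Taylor's formula at 0: the factor k! from differentiating the degree k term k times cancels
1/k!, so the exponential evaluates g at ψ. -/
theorem HasExp.vacuum_eq {ρ : ℝ} {ψ : Free n m s} {g h : Series n m s}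
    (hh : HasExp (delta ψ) ρ g h) : vacuum h = ∑' k, g k fun _ => ψ := by
  have h0 := (ContinuousMultilinearMap.apply ℝ (fun _ : Fin 0 => Free n m s) ℝ
    fun _ => 0).hasSum (hh.2 0)
  refine h0.tsum_eq.symm.trans (tsum_congr fun k => ?_)
  change ((k.factorial : ℝ)⁻¹) • (delta ψ)^[k] g 0 (fun _ => 0) = _
  have e : (fun _ => 0 : Fin 0 → Free n m s) = fun _ => ψ := Subsingleton.elim _ _
  rw [e, iterate_delta_const, Nat.zero_add, smul_eq_mul]
  have : (k.factorial : ℝ) ≠ 0 := by positivity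
  field_simp
  simp

/-- The iterated integrals are determined by the operators `D(s)` and by `f`. -/
theorem IsOrderedIntegral.unique {D : ℝ → Series n m s → Series n m s} {f : Series n m s}
    {G G' : ℕ → ℝ → Series n m s} (h : IsOrderedIntegral D f G) (h' : IsOrderedIntegral D f G') :
    G = G' := by
  funext k
  induction k with
  | zero => funext t; rw [h.zero, h'.zero]
  | succ k ih =>
    funext t p
    ext φ
    rw [h.succ, h'.succ, ih]

theorem HasTimeOrderedExp.unique {D : ℝ → Series n m s → Series n m s} {t ρ : ℝ}
    {f g g' : Series n m s} (h : HasTimeOrderedExp D t ρ f g) (h' : HasTimeOrderedExp D t ρ f g') :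
    g = g' := by
  obtain ⟨G, hG, -, hs⟩ := h
  obtain ⟨G', hG', -, hs'⟩ := h'
  obtain rfl := hG.unique hG'
  funext p
  exact (hs p).unique (hs' p)

theorem HasExp.unique {T : Series n m s → Series n m s} {ρ : ℝ} {f g g' : Series n m s}
    (h : HasExp T ρ f g) (h' : HasExp T ρ f g') : g = g' := by
  funext p
  exact (h.2 p).unique (h'.2 p)

theorem IsAlpha.unique {V : FormalMultilinearSeries ℝ (Data n m s) (Sobolev n m s)}
    {u : ℝ → Sobolev n m (s + 1)} {ρ t : ℝ} {f : Series n m s} {a a' : ℝ}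
    (h : IsAlpha V u ρ t f a) (h' : IsAlpha V u ρ t f a') : a = a' := by
  obtain ⟨g, -, hg, k, -, hk, rfl⟩ := h
  obtain ⟨g', -, hg', k', -, hk', rfl⟩ := h'
  obtain rfl := hg.unique hg'
  rw [hk.unique hk']

end FockSpace

/-! ### Multiplication operators on `L²` -/

/-- The space `L²(ℝⁿ)` of functions of the frequency variable. -/
abbrev L2 (n : ℕ) : Type := Lp ℂ 2 (volume : Measure (Space n))

section MulOp

variable {n : ℕ}

theorem memLp_top_bcf (g : Space n →ᵇ ℂ) : MemLp g ∞ (volume : Measure (Space n)) :=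
  memLp_top_of_bound g.continuous.aestronglyMeasurable ‖g‖
    (Eventually.of_forall g.norm_coe_le_norm)

/-- The product of a bounded continuous function and an element of `L²`. -/
noncomputable def bcfSMul (g : Space n →ᵇ ℂ) (f : L2 n) : L2 n := (memLp_top_bcf g).toLp _ • f

theorem coeFn_bcfSMul (g : Space n →ᵇ ℂ) (f : L2 n) :
    bcfSMul g f =ᵐ[volume] fun ξ => g ξ * f ξ := by
  filter_upwards [Lp.coeFn_lpSMul (r := 2) ((memLp_top_bcf g).toLp _) f,
    (memLp_top_bcf g).coeFn_toLp] with ξ h1 h2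
  rw [bcfSMul, h1, Pi.smul_apply', h2, smul_eq_mul]

theorem norm_bcfSMul_le (g : Space n →ᵇ ℂ) (f : L2 n) : ‖bcfSMul g f‖ ≤ ‖g‖ * ‖f‖ := by
  refine Lp.norm_le_mul_norm_of_ae_le_mul ?_
  filter_upwards [coeFn_bcfSMul g f] with ξ h
  rw [h, norm_mul]
  gcongr
  exact g.norm_coe_le_norm ξ

theorem bcfSMul_add (g : Space n →ᵇ ℂ) (f f' : L2 n) :
    bcfSMul g (f + f') = bcfSMul g f + bcfSMul g f' := by
  ext1
  filter_upwards [coeFn_bcfSMul g (f + f'), coeFn_bcfSMul g f, coeFn_bcfSMul g f',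
    Lp.coeFn_add f f', Lp.coeFn_add (bcfSMul g f) (bcfSMul g f')] with ξ h1 h2 h3 h4 h5
  rw [h1, h5, Pi.add_apply, h2, h3, h4, Pi.add_apply, mul_add]

theorem bcfSMul_smul (g : Space n →ᵇ ℂ) (c : ℝ) (f : L2 n) :
    bcfSMul g (c • f) = c • bcfSMul g f := by
  ext1
  filter_upwards [coeFn_bcfSMul g (c • f), coeFn_bcfSMul g f, Lp.coeFn_smul c f,
    Lp.coeFn_smul c (bcfSMul g f)] with ξ h1 h2 h3 h4
  rw [h1, h4, Pi.smul_apply, h2, h3, Pi.smul_apply, mul_smul_comm]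

theorem add_bcfSMul (g g' : Space n →ᵇ ℂ) (f : L2 n) :
    bcfSMul (g + g') f = bcfSMul g f + bcfSMul g' f := by
  ext1
  filter_upwards [coeFn_bcfSMul (g + g') f, coeFn_bcfSMul g f, coeFn_bcfSMul g' f,
    Lp.coeFn_add (bcfSMul g f) (bcfSMul g' f)] with ξ h1 h2 h3 h4
  rw [h1, h4, Pi.add_apply, h2, h3, BoundedContinuousFunction.add_apply, add_mul]

theorem smul_bcfSMul (c : ℝ) (g : Space n →ᵇ ℂ) (f : L2 n) :
    bcfSMul (c • g) f = c • bcfSMul g f := by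
  ext1
  filter_upwards [coeFn_bcfSMul (c • g) f, coeFn_bcfSMul g f, Lp.coeFn_smul c (bcfSMul g f)]
    with ξ h1 h2 h3
  rw [h1, h3, Pi.smul_apply, h2, BoundedContinuousFunction.smul_apply, smul_mul_assoc]

/-- Multiplication by a bounded continuous function on `L²`. -/
noncomputable def mulOp : (Space n →ᵇ ℂ) →L[ℝ] L2 n →L[ℝ] L2 n :=
  LinearMap.mkContinuous₂
    (LinearMap.mk₂ ℝ bcfSMul add_bcfSMul smul_bcfSMul bcfSMul_add fun c g f => bcfSMul_smul g c f)
    1 fun g f => by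
      rw [one_mul]
      exact norm_bcfSMul_le g f

theorem coeFn_mulOp (g : Space n →ᵇ ℂ) (f : L2 n) :
    mulOp g f =ᵐ[volume] fun ξ => g ξ * f ξ := coeFn_bcfSMul g f

theorem norm_mulOp_le (g : Space n →ᵇ ℂ) (f : L2 n) : ‖mulOp g f‖ ≤ ‖g‖ * ‖f‖ :=
  norm_bcfSMul_le g f

theorem mulOp_mul (g g' : Space n →ᵇ ℂ) (f : L2 n) : mulOp (g * g') f = mulOp g (mulOp g' f) := by
  ext1
  filter_upwards [coeFn_mulOp (g * g') f, coeFn_mulOp g (mulOp g' f), coeFn_mulOp g' f]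
    with ξ h1 h2 h3
  rw [h1, h2, h3, BoundedContinuousFunction.mul_apply, mul_assoc]

theorem mulOp_one (f : L2 n) : mulOp (1 : Space n →ᵇ ℂ) f = f := by
  ext1
  filter_upwards [coeFn_mulOp 1 f] with ξ h
  simp [h]

/-- Used with powers of 1/ε, which vanish nowhere although their inverses are in general unbounded.
-/
theorem mulOp_injective {g : Space n →ᵇ ℂ} (hg : ∀ ξ, g ξ ≠ 0) :
    Function.Injective (mulOp g : L2 n → L2 n) := by
  rw [injective_iff_map_eq_zero]
  intro f hf
  ext1
  have h0 : mulOp g f =ᵐ[volume] (0 : Space n → ℂ) := by rw [hf]; exact Lp.coeFn_zero ℂ 2 _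
  filter_upwards [coeFn_mulOp g f, h0, Lp.coeFn_zero ℂ 2 (volume : Measure (Space n))]
    with ξ h1 h2 h3
  rw [h1] at h2
  rw [h3]
  exact (mul_eq_zero.mp h2).resolve_left (hg ξ)

theorem norm_sq_L2 (f : L2 n) : ‖f‖ ^ 2 = ∫ ξ, ‖f ξ‖ ^ 2 := by
  have h := congrArg Complex.re (L2.inner_def (𝕜 := ℂ) f f)
  have h1 : (inner ℂ f f).re = ‖f‖ ^ 2 := inner_self_eq_norm_sq (𝕜 := ℂ) f
  rw [h1] at h
  rw [h]
  have h2 : ∀ ξ, inner ℂ (f ξ) (f ξ) = ((‖f ξ‖ ^ 2 : ℝ) : ℂ) := fun ξ => by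
    rw [inner_self_eq_norm_sq_to_K]
    norm_cast
  simp only [h2]
  rw [integral_complex_ofReal, Complex.ofReal_re]

theorem integrable_norm_sq_L2 (f : L2 n) : Integrable fun ξ => ‖f ξ‖ ^ 2 :=
  (Lp.memLp f).integrable_norm_pow (by norm_num)

/-- A rotation by a variable real angle preserves the norm of `L² × L²`. -/
theorem norm_sq_rotation {c d : Space n →ᵇ ℂ} {θ : Space n → ℝ}
    (hc : ∀ ξ, c ξ = (Real.cos (θ ξ) : ℂ)) (hd : ∀ ξ, d ξ = (Real.sin (θ ξ) : ℂ)) (a b : L2 n) :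
    ‖mulOp c a + mulOp d b‖ ^ 2 + ‖mulOp c b - mulOp d a‖ ^ 2 = ‖a‖ ^ 2 + ‖b‖ ^ 2 := by
  simp only [norm_sq_L2]
  rw [← integral_add (integrable_norm_sq_L2 _) (integrable_norm_sq_L2 _),
    ← integral_add (integrable_norm_sq_L2 _) (integrable_norm_sq_L2 _)]
  refine integral_congr_ae ?_
  filter_upwards [coeFn_mulOp c a, coeFn_mulOp d b, coeFn_mulOp c b, coeFn_mulOp d a,
    Lp.coeFn_add (mulOp c a) (mulOp d b), Lp.coeFn_sub (mulOp c b) (mulOp d a)]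
    with ξ h1 h2 h3 h4 h5 h6
  rw [h5, h6, Pi.add_apply, Pi.sub_apply, h1, h2, h3, h4, hc, hd]
  have key := Real.sin_sq_add_cos_sq (θ ξ)
  simp only [← Complex.normSq_eq_norm_sq, Complex.normSq_apply, Complex.add_re, Complex.add_im,
    Complex.sub_re, Complex.sub_im, Complex.re_ofReal_mul, Complex.im_ofReal_mul]
  linear_combination ((a ξ).re ^ 2 + (a ξ).im ^ 2 + (b ξ).re ^ 2 + (b ξ).im ^ 2) * key

end MulOp

/-! ### Temperate symbols -/

section Symbols

variable (n : ℕ) (m : ℝ)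

/-- The dispersion relation `ε(ξ) = √(m² + |ξ|²)`, in the frequency variable of `weight`. -/
noncomputable def dispersion (ξ : Space n) : ℝ := (m ^ 2 + (2 * Real.pi * ‖ξ‖) ^ 2) ^ ((1 : ℝ) / 2)

theorem dispersion_temperate {m : ℝ} (hm : 0 < m) : (dispersion n m).HasTemperateGrowth :=
  Function.HasTemperateGrowth.comp (g := Complex.reCLM) (f := weight n m 1)
    Complex.reCLM.hasTemperateGrowth (weight_temperate n hm 1)

theorem dispersion_pos {m : ℝ} (hm : 0 < m) (ξ : Space n) : 0 < dispersion n m ξ :=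
  Real.rpow_pos_of_pos (base_pos n hm ξ) _

theorem continuous_dispersion {m : ℝ} (hm : 0 < m) : Continuous (dispersion n m) :=
  (dispersion_temperate n hm).1.continuous

theorem weight_neg_one_eq {m : ℝ} (hm : 0 < m) (ξ : Space n) :
    weight n m (-1) ξ = ((dispersion n m ξ)⁻¹ : ℝ) := by
  rw [weight, dispersion, ← Real.rpow_neg (base_pos n hm ξ).le]
  norm_num

theorem hasTemperateGrowth_cos : Real.cos.HasTemperateGrowth := by
  refine ⟨Real.contDiff_cos, fun k => ⟨0, 1, fun x => ?_⟩⟩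
  rw [norm_iteratedFDeriv_eq_norm_iteratedDeriv]
  simpa using Real.abs_iteratedDeriv_cos_le_one k x

theorem hasTemperateGrowth_sin : Real.sin.HasTemperateGrowth := by
  refine ⟨Real.contDiff_sin, fun k => ⟨0, 1, fun x => ?_⟩⟩
  rw [norm_iteratedFDeriv_eq_norm_iteratedDeriv]
  simpa using Real.abs_iteratedDeriv_sin_le_one k x

variable [hm : Fact (0 < m)]

/-- The function `1/ε`. -/
noncomputable def invE : Space n →ᵇ ℂ :=
  BoundedContinuousFunction.ofNormedAddCommGroup (weight n m (-1))
    (weight_temperate n hm.out (-1)).1.continuous ((m ^ 2) ^ ((-1 : ℝ) / 2)) fun ξ => by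
      rw [weight, Complex.norm_real, Real.norm_eq_abs,
        abs_of_nonneg (Real.rpow_nonneg (base_pos n hm.out ξ).le _)]
      have := hm.out
      exact Real.rpow_le_rpow_of_nonpos (by positivity)
        (by nlinarith [sq_nonneg (2 * Real.pi * ‖ξ‖)]) (by norm_num)

/-- The function `cos (tε)`. -/
noncomputable def cosE (t : ℝ) : Space n →ᵇ ℂ :=
  BoundedContinuousFunction.ofNormedAddCommGroup
    (fun ξ => (Real.cos (t * dispersion n m ξ) : ℂ))
    (by have := continuous_dispersion n hm.out; fun_prop) 1 fun ξ => by
      rw [Complex.norm_real]; exact Real.abs_cos_le_one _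

/-- The function `sin (tε)`. -/
noncomputable def sinE (t : ℝ) : Space n →ᵇ ℂ :=
  BoundedContinuousFunction.ofNormedAddCommGroup
    (fun ξ => (Real.sin (t * dispersion n m ξ) : ℂ))
    (by have := continuous_dispersion n hm.out; fun_prop) 1 fun ξ => by
      rw [Complex.norm_real]; exact Real.abs_sin_le_one _

theorem cosE_apply (t : ℝ) (ξ : Space n) : cosE n m t ξ = (Real.cos (t * dispersion n m ξ) : ℂ) :=
  rfl

theorem sinE_apply (t : ℝ) (ξ : Space n) : sinE n m t ξ = (Real.sin (t * dispersion n m ξ) : ℂ) :=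
  rfl

theorem invE_apply (ξ : Space n) : invE n m ξ = ((dispersion n m ξ)⁻¹ : ℝ) :=
  weight_neg_one_eq n hm.out ξ

theorem invE_ne_zero (ξ : Space n) : invE n m ξ ≠ 0 := by
  rw [invE_apply]
  exact_mod_cast inv_ne_zero (dispersion_pos n hm.out ξ).ne'

theorem invE_temperate : (invE n m : Space n → ℂ).HasTemperateGrowth :=
  weight_temperate n hm.out (-1)

theorem cosE_temperate (t : ℝ) : (cosE n m t : Space n → ℂ).HasTemperateGrowth :=
  Function.Complex.hasTemperateGrowth_ofReal.comp (hasTemperateGrowth_cos.comp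
    ((Function.HasTemperateGrowth.const t).mul (dispersion_temperate n hm.out)))

theorem sinE_temperate (t : ℝ) : (sinE n m t : Space n → ℂ).HasTemperateGrowth :=
  Function.Complex.hasTemperateGrowth_ofReal.comp (hasTemperateGrowth_sin.comp
    ((Function.HasTemperateGrowth.const t).mul (dispersion_temperate n hm.out)))

/-- The mean value inequality for y ↦ cos y + y sin x, whose derivative sin x - sin y is at most |δ|
between x and x + δ. -/
theorem abs_cos_add_sub_le (x δ : ℝ) :
    |Real.cos (x + δ) - Real.cos x + δ * Real.sin x| ≤ δ ^ 2 := by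
  have h := (convex_uIcc x (x + δ)).norm_image_sub_le_of_norm_hasDerivWithin_le
    (f := fun y => Real.cos y + y * Real.sin x) (f' := fun y => -Real.sin y + 1 * Real.sin x)
    (C := |δ|) (fun y _ => ((Real.hasDerivAt_cos y).add
      ((hasDerivAt_id y).mul_const _)).hasDerivWithinAt) (fun y hy => ?_)
    Set.left_mem_uIcc Set.right_mem_uIcc
  · rw [Real.norm_eq_abs, Real.norm_eq_abs] at h
    have e : x + δ - x = δ := by ring
    rw [e, abs_mul_abs_self] at h
    calc _ = |Real.cos (x + δ) + (x + δ) * Real.sin x - (Real.cos x + x * Real.sin x)| := by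
          congr 1; ring
      _ ≤ _ := by rw [sq]; exact h
  · have h1 := Set.abs_sub_left_of_mem_uIcc hy
    rw [Real.norm_eq_abs, neg_add_eq_sub, one_mul]
    calc |Real.sin x - Real.sin y| ≤ |x - y| := Real.abs_sin_sub_sin_le x y
      _ ≤ |δ| := by rw [abs_sub_comm]; simpa using h1

theorem abs_sin_add_sub_le (x δ : ℝ) :
    |Real.sin (x + δ) - Real.sin x - δ * Real.cos x| ≤ δ ^ 2 := by
  have h := abs_cos_add_sub_le (x - Real.pi / 2) δ
  rw [show x - Real.pi / 2 + δ = x + δ - Real.pi / 2 by ring, Real.cos_sub_pi_div_two,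
    Real.cos_sub_pi_div_two, Real.sin_sub_pi_div_two] at h
  simpa [sub_eq_add_neg] using h

theorem hasDerivAt_of_norm_sub_le_sq {F : Type*} [NormedAddCommGroup F] [NormedSpace ℝ F]
    {g : ℝ → F} {g' : F} {t C : ℝ} (h : ∀ δ, ‖g (t + δ) - g t - δ • g'‖ ≤ C * δ ^ 2) :
    HasDerivAt g g' t := by
  rw [hasDerivAt_iff_isLittleO_nhds_zero]
  refine (Asymptotics.IsBigO.of_bound C (Eventually.of_forall fun δ => ?_)).trans_isLittleO
    (g := fun δ : ℝ => δ ^ 2) ?_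
  · rw [Real.norm_of_nonneg (sq_nonneg δ)]
    exact h δ
  · simpa using Asymptotics.isLittleO_pow_id (𝕜 := ℝ) one_lt_two

/-- The second order remainder of cos(tε) is at most (δε)², and the factor ε^(-2) makes this uniform
in ξ. Without such a factor differentiability fails in the sup norm as soon as ε is unbounded. -/
theorem hasDerivAt_invE_sq_mul_cosE (t : ℝ) :
    HasDerivAt (fun t => invE n m * invE n m * cosE n m t) (-(invE n m * sinE n m t)) t := by
  refine hasDerivAt_of_norm_sub_le_sq (C := 1) fun δ => ?_
  rw [BoundedContinuousFunction.norm_le (by positivity)]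
  intro ξ
  have hε := dispersion_pos n hm.out ξ
  have key := abs_cos_add_sub_le (t * dispersion n m ξ) (δ * dispersion n m ξ)
  have e : (invE n m * invE n m * cosE n m (t + δ) - invE n m * invE n m * cosE n m t -
      δ • -(invE n m * sinE n m t)) ξ = (((dispersion n m ξ)⁻¹ ^ 2 *
        (Real.cos (t * dispersion n m ξ + δ * dispersion n m ξ) - Real.cos (t * dispersion n m ξ) +
          δ * dispersion n m ξ * Real.sin (t * dispersion n m ξ)) : ℝ) : ℂ) := by
    simp only [BoundedContinuousFunction.sub_apply, BoundedContinuousFunction.mul_apply,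
      BoundedContinuousFunction.smul_apply, BoundedContinuousFunction.neg_apply, invE_apply,
      cosE_apply, sinE_apply, Complex.real_smul, ← add_mul]
    have hε' : ((dispersion n m ξ : ℝ) : ℂ) ≠ 0 := by exact_mod_cast hε.ne'
    push_cast
    field_simp
    ring
  rw [e, Complex.norm_real, Real.norm_eq_abs, abs_mul, abs_of_nonneg (by positivity)]
  calc _ ≤ (dispersion n m ξ)⁻¹ ^ 2 * (δ * dispersion n m ξ) ^ 2 := by gcongr
    _ = 1 * δ ^ 2 := by field_simp

theorem hasDerivAt_invE_sq_mul_sinE (t : ℝ) :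
    HasDerivAt (fun t => invE n m * invE n m * sinE n m t) (invE n m * cosE n m t) t := by
  refine hasDerivAt_of_norm_sub_le_sq (C := 1) fun δ => ?_
  rw [BoundedContinuousFunction.norm_le (by positivity)]
  intro ξ
  have hε := dispersion_pos n hm.out ξ
  have key := abs_sin_add_sub_le (t * dispersion n m ξ) (δ * dispersion n m ξ)
  have e : (invE n m * invE n m * sinE n m (t + δ) - invE n m * invE n m * sinE n m t -
      δ • (invE n m * cosE n m t)) ξ = (((dispersion n m ξ)⁻¹ ^ 2 *
        (Real.sin (t * dispersion n m ξ + δ * dispersion n m ξ) - Real.sin (t * dispersion n m ξ) -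
          δ * dispersion n m ξ * Real.cos (t * dispersion n m ξ)) : ℝ) : ℂ) := by
    simp only [BoundedContinuousFunction.sub_apply, BoundedContinuousFunction.mul_apply,
      BoundedContinuousFunction.smul_apply, invE_apply,
      cosE_apply, sinE_apply, Complex.real_smul, ← add_mul]
    have hε' : ((dispersion n m ξ : ℝ) : ℂ) ≠ 0 := by exact_mod_cast hε.ne'
    push_cast
    field_simp
  rw [e, Complex.norm_real, Real.norm_eq_abs, abs_mul, abs_of_nonneg (by positivity)]
  calc _ ≤ (dispersion n m ξ)⁻¹ ^ 2 * (δ * dispersion n m ξ) ^ 2 := by gcongr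
    _ = 1 * δ ^ 2 := by field_simp

end Symbols

/-! ### The rotation in frequency space and Duhamel's formula -/

section Rotation

variable {n : ℕ} {m : ℝ} [hm : Fact (0 < m)]

theorem norm_mulOp_cosE_le (t : ℝ) (f : L2 n) : ‖mulOp (cosE n m t) f‖ ≤ ‖f‖ := by
  refine (norm_mulOp_le _ _).trans (mul_le_of_le_one_left (norm_nonneg _) ?_)
  exact BoundedContinuousFunction.norm_ofNormedAddCommGroup_le _ zero_le_one _

theorem norm_mulOp_sinE_le (t : ℝ) (f : L2 n) : ‖mulOp (sinE n m t) f‖ ≤ ‖f‖ := by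
  refine (norm_mulOp_le _ _).trans (mul_le_of_le_one_left (norm_nonneg _) ?_)
  exact BoundedContinuousFunction.norm_ofNormedAddCommGroup_le _ zero_le_one _

-- Every Schwartz function is 1/ε times a Schwartz function, and Schwartz functions are dense in L².
variable (n m) in
theorem denseRange_mulOp_invE : DenseRange (mulOp (invE n m) : L2 n → L2 n) := by
  have h := SchwartzMap.denseRange_toLpCLM (E := Space n) (F := ℂ) (p := 2)
    (μ := (volume : Measure (Space n))) ENNReal.ofNat_ne_top
  refine h.mono ?_
  rintro _ ⟨φ, rfl⟩
  have ht := weight_temperate n hm.out 1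
  refine ⟨(SchwartzMap.smulLeftCLM ℂ (weight n m 1) φ).toLp 2, ?_⟩
  ext1
  filter_upwards [coeFn_mulOp (invE n m) ((SchwartzMap.smulLeftCLM ℂ (weight n m 1) φ).toLp 2),
    (SchwartzMap.smulLeftCLM ℂ (weight n m 1) φ).coeFn_toLp 2 volume,
    φ.coeFn_toLp 2 volume] with ξ h1 h2 h3
  have e : (SchwartzMap.toLpCLM ℝ ℂ 2 (volume : Measure (Space n))) φ = φ.toLp 2 := rfl
  rw [h1, h2, e, h3, SchwartzMap.smulLeftCLM_apply_apply ht, smul_eq_mul, ← mul_assoc]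
  have := congrFun (weight_mul n hm.out (-1) 1) ξ
  rw [Pi.mul_apply] at this
  change weight n m (-1) ξ * weight n m 1 ξ * _ = _
  rw [this, neg_add_cancel, weight_zero, one_mul]

/-- A family of contractions that is norm continuous after multiplication by `1/ε` is strongly
continuous. -/
theorem continuous_mulOp_of_invE {g : ℝ → Space n →ᵇ ℂ} (hg : ∀ t f, ‖mulOp (g t) f‖ ≤ ‖f‖)
    (hc : Continuous fun t => g t * invE n m) (f : L2 n) : Continuous fun t => mulOp (g t) f := by
  refine continuous_of_uniform_approx_of_continuous fun u hu => ?_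
  obtain ⟨ε, hε, hεu⟩ := Metric.mem_uniformity_dist.mp hu
  obtain ⟨f', hf'⟩ := (denseRange_mulOp_invE n m).exists_dist_lt f hε
  refine ⟨fun t => mulOp (g t) (mulOp (invE n m) f'), ?_, fun t => hεu ?_⟩
  · simp only [← mulOp_mul]
    exact (mulOp.continuous.comp hc).clm_apply continuous_const
  · rw [dist_eq_norm, ← map_sub]
    exact (hg t _).trans_lt (by rwa [← dist_eq_norm])

theorem norm_bcf_le_of_real {c : ℝ} (hc : 0 ≤ c) {g : Space n →ᵇ ℂ} {h : Space n → ℝ}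
    (hg : ∀ ξ, g ξ = (h ξ : ℂ)) (hh : ∀ ξ, |h ξ| ≤ c) : ‖g‖ ≤ c := by
  rw [BoundedContinuousFunction.norm_le hc]
  intro ξ
  rw [hg, Complex.norm_real]
  exact hh ξ

variable (n m) in
theorem continuous_cosE_mul_invE : Continuous fun t => cosE n m t * invE n m := by
  refine (LipschitzWith.of_dist_le_mul (K := 1) fun t t' => ?_).continuous
  rw [dist_eq_norm, Real.dist_eq, NNReal.coe_one, one_mul]
  refine norm_bcf_le_of_real (abs_nonneg _) (h := fun ξ => (Real.cos (t * dispersion n m ξ) -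
    Real.cos (t' * dispersion n m ξ)) * (dispersion n m ξ)⁻¹) (fun ξ => ?_) fun ξ => ?_
  · simp only [BoundedContinuousFunction.sub_apply, BoundedContinuousFunction.mul_apply, cosE_apply,
      invE_apply]
    push_cast
    ring
  · have hε := dispersion_pos n hm.out ξ
    rw [abs_mul, abs_of_pos (inv_pos.mpr hε), ← div_eq_mul_inv, div_le_iff₀ hε]
    refine (Real.abs_cos_sub_cos_le _ _).trans (le_of_eq ?_)
    rw [← sub_mul, abs_mul, abs_of_pos hε]

variable (n m) in
theorem continuous_sinE_mul_invE : Continuous fun t => sinE n m t * invE n m := by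
  refine (LipschitzWith.of_dist_le_mul (K := 1) fun t t' => ?_).continuous
  rw [dist_eq_norm, Real.dist_eq, NNReal.coe_one, one_mul]
  refine norm_bcf_le_of_real (abs_nonneg _) (h := fun ξ => (Real.sin (t * dispersion n m ξ) -
    Real.sin (t' * dispersion n m ξ)) * (dispersion n m ξ)⁻¹) (fun ξ => ?_) fun ξ => ?_
  · simp only [BoundedContinuousFunction.sub_apply, BoundedContinuousFunction.mul_apply, sinE_apply,
      invE_apply]
    push_cast
    ring
  · have hε := dispersion_pos n hm.out ξ
    rw [abs_mul, abs_of_pos (inv_pos.mpr hε), ← div_eq_mul_inv, div_le_iff₀ hε]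
    refine (Real.abs_sin_sub_sin_le _ _).trans (le_of_eq ?_)
    rw [← sub_mul, abs_mul, abs_of_pos hε]

theorem continuous_mulOp_cosE (f : L2 n) : Continuous fun t => mulOp (cosE n m t) f :=
  continuous_mulOp_of_invE norm_mulOp_cosE_le (continuous_cosE_mul_invE n m) f

theorem continuous_mulOp_sinE (f : L2 n) : Continuous fun t => mulOp (sinE n m t) f :=
  continuous_mulOp_of_invE norm_mulOp_sinE_le (continuous_sinE_mul_invE n m) f

/-- Strong continuity together with a uniform bound on the operators allows the vector to vary as
well. -/
theorem continuousOn_mulOp_of_contraction {g : ℝ → Space n →ᵇ ℂ}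
    (hg : ∀ t f, ‖mulOp (g t) f‖ ≤ ‖f‖) (hc : ∀ f, Continuous fun t => mulOp (g t) f)
    {K : Set ℝ} {j : ℝ → L2 n} (hj : ContinuousOn j K) :
    ContinuousOn (fun t => mulOp (g t) (j t)) K := by
  intro t₀ ht₀
  rw [ContinuousWithinAt, tendsto_iff_norm_sub_tendsto_zero]
  have h1 := tendsto_iff_norm_sub_tendsto_zero.mp (hj t₀ ht₀)
  have h2 := (tendsto_iff_norm_sub_tendsto_zero.mp ((hc (j t₀)).tendsto t₀)).mono_left
    (nhdsWithin_le_nhds (s := K))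
  refine squeeze_zero (fun _ => norm_nonneg _) (fun t => ?_) (by simpa using h1.add h2)
  calc _ = ‖mulOp (g t) (j t - j t₀) + (mulOp (g t) (j t₀) - mulOp (g t₀) (j t₀))‖ := by
        rw [map_sub]; congr 1; abel
    _ ≤ _ := (norm_add_le _ _).trans (add_le_add (hg t _) le_rfl)

/-- A curve in `L²` is differentiable if it is so after an injective multiplication, provided that
the candidate for the derivative is continuous. -/
theorem hasDerivAt_of_mulOp {g : Space n →ᵇ ℂ} (hg : ∀ ξ, g ξ ≠ 0) {K : Set ℝ} (hK : IsOpen K)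
    {y w : ℝ → L2 n} (hw : ContinuousOn w K)
    (h : ∀ t ∈ K, HasDerivAt (fun t => mulOp g (y t)) (mulOp g (w t)) t) {t₀ : ℝ} (ht₀ : t₀ ∈ K) :
    HasDerivAt y (w t₀) t₀ := by
  obtain ⟨ε, hε, hball⟩ := Metric.isOpen_iff.mp hK t₀ ht₀
  have hsub : ∀ t ∈ Metric.ball t₀ ε, Set.uIcc t₀ t ⊆ K := fun t ht =>
    ((convex_ball t₀ ε).ordConnected.uIcc_subset (Metric.mem_ball_self hε) ht).trans hball
  have hint : ∀ t ∈ Metric.ball t₀ ε, IntervalIntegrable w volume t₀ t := fun t ht =>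
    (hw.mono (hsub t ht)).intervalIntegrable
  -- The fundamental theorem of calculus holds after multiplication by g. The multiplication
  -- commutes with the integral and is injective, so it can be removed; continuity of w then gives
  -- the derivative of y.
  have key : ∀ t ∈ Metric.ball t₀ ε, y t = y t₀ + ∫ τ in t₀..t, w τ := by
    intro t ht
    apply mulOp_injective hg
    rw [map_add, ← ContinuousLinearMap.intervalIntegral_comp_comm _ (hint t ht),
      intervalIntegral.integral_eq_sub_of_hasDerivAt (fun τ hτ => h τ (hsub t ht hτ))
        (((mulOp g).continuous.comp_continuousOn (hw.mono (hsub t ht))).intervalIntegrable)]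
    abel
  have hd : HasDerivAt (fun t => y t₀ + ∫ τ in t₀..t, w τ) (w t₀) t₀ :=
    (intervalIntegral.integral_hasDerivAt_right (by simp)
      (hw.stronglyMeasurableAtFilter hK t₀ ht₀)
      (hw.continuousAt (hK.mem_nhds ht₀))).const_add _
  exact hd.congr_of_eventuallyEq (eventually_of_mem (Metric.ball_mem_nhds t₀ hε) key)

variable {K : Set ℝ} {a b j : ℝ → L2 n}

/-- Duhamel's formula, in frequency space and in differential form. -/
theorem hasDerivAt_rotation (hK : IsOpen K) (hj : ContinuousOn j K)
    (ha : ∀ t ∈ K, HasDerivAt (fun t => mulOp (invE n m) (a t)) (b t) t)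
    (hb : ∀ t ∈ K, HasDerivAt (fun t => mulOp (invE n m) (b t))
      (-a t - mulOp (invE n m) (j t)) t) {t : ℝ} (ht : t ∈ K) :
    HasDerivAt (fun t => mulOp (cosE n m t) (a t) - mulOp (sinE n m t) (b t))
      (mulOp (sinE n m t) (j t)) t ∧
    HasDerivAt (fun t => mulOp (cosE n m t) (b t) + mulOp (sinE n m t) (a t))
      (-mulOp (cosE n m t) (j t)) t := by
  -- The identities are checked after multiplication by ε^(-3): one factor makes the curves a and b
  -- differentiable, the other two make the rotation differentiable in norm. The terms in a and b
  -- then cancel and only the source j remains.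
  have hne : ∀ ξ, (invE n m * invE n m * invE n m) ξ ≠ 0 := fun ξ => by
    have := invE_ne_zero n m ξ
    simp [this]
  have hC : ∀ t, HasDerivAt (fun t => mulOp (invE n m * invE n m * cosE n m t))
      (mulOp (-(invE n m * sinE n m t))) t := fun t =>
    mulOp.hasFDerivAt.comp_hasDerivAt t (hasDerivAt_invE_sq_mul_cosE n m t)
  have hS : ∀ t, HasDerivAt (fun t => mulOp (invE n m * invE n m * sinE n m t))
      (mulOp (invE n m * cosE n m t)) t := fun t =>
    mulOp.hasFDerivAt.comp_hasDerivAt t (hasDerivAt_invE_sq_mul_sinE n m t)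
  constructor
  · refine hasDerivAt_of_mulOp hne hK (continuousOn_mulOp_of_contraction
      norm_mulOp_sinE_le continuous_mulOp_sinE hj) (fun t ht => ?_) ht
    have h1 := ((hC t).clm_apply (ha t ht)).sub ((hS t).clm_apply (hb t ht))
    refine (h1.congr_deriv ?_).congr_of_eventuallyEq (Eventually.of_forall fun τ => ?_)
    · simp only [map_neg, map_sub, neg_apply, ← mulOp_mul]
      rw [show invE n m * sinE n m t * invE n m = invE n m * invE n m * sinE n m t by ring,
        show invE n m * cosE n m t * invE n m = invE n m * invE n m * cosE n m t by ring,
        show invE n m * invE n m * sinE n m t * invE n m =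
          invE n m * invE n m * invE n m * sinE n m t by ring]
      abel
    · simp only [Pi.sub_apply, map_sub, ← mulOp_mul]
      rw [show invE n m * invE n m * cosE n m τ * invE n m =
          invE n m * invE n m * invE n m * cosE n m τ by ring,
        show invE n m * invE n m * sinE n m τ * invE n m =
          invE n m * invE n m * invE n m * sinE n m τ by ring]
  · refine hasDerivAt_of_mulOp hne hK (continuousOn_mulOp_of_contraction
      norm_mulOp_cosE_le continuous_mulOp_cosE hj).neg (fun t ht => ?_) ht
    have h1 := ((hC t).clm_apply (hb t ht)).add ((hS t).clm_apply (ha t ht))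
    refine (h1.congr_deriv ?_).congr_of_eventuallyEq (Eventually.of_forall fun τ => ?_)
    · simp only [Pi.neg_apply, map_neg, map_sub, neg_apply, ← mulOp_mul]
      rw [show invE n m * sinE n m t * invE n m = invE n m * invE n m * sinE n m t by ring,
        show invE n m * cosE n m t * invE n m = invE n m * invE n m * cosE n m t by ring,
        show invE n m * invE n m * cosE n m t * invE n m =
          invE n m * invE n m * invE n m * cosE n m t by ring]
      abel
    · simp only [Pi.add_apply, map_add, ← mulOp_mul]
      rw [show invE n m * invE n m * cosE n m τ * invE n m =
          invE n m * invE n m * invE n m * cosE n m τ by ring,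
        show invE n m * invE n m * sinE n m τ * invE n m =
          invE n m * invE n m * invE n m * sinE n m τ by ring]

end Rotation

/-! ### Symbols -/

section Symbol

variable {n : ℕ} {m s : ℝ} [hm : Fact (0 < m)]

theorem isometry_symbol : Isometry (symbol : Sobolev n m s → L2 n) :=
  AddMonoidHomClass.isometry_of_norm (symbol (n := n) (m := m) (s := s))
    fun T => (norm_eq_norm_symbol T).symm

omit hm in
theorem symbol_eq_of_isSymbol {T : Sobolev n m s} {g : L2 n} (h : IsSymbol m s (toDist T) g) :
    symbol T = g :=
  toTD_injective ((symbol_spec T).symm.trans h)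

theorem toTD_mulOp {c : Space n →ᵇ ℂ} (hc : (c : Space n → ℂ).HasTemperateGrowth) (g : L2 n) :
    ((mulOp c g : L2 n) : 𝓢'(Space n, ℂ)) = smulLeftCLM ℂ c (g : 𝓢'(Space n, ℂ)) :=
  Lp.toTemperedDistribution_smul_eq hc (memLp_top_bcf c) g

theorem toDist_incl (T : Sobolev n m (s + 1)) :
    toDist (incl T : Sobolev n m s) = toDist T := by
  delta toDist incl Sobolev
  exact congrFun (congrArg DFunLike.coe
    (Submodule.subtype_comp_inclusion _ _ (sobolev_mono n m s))) T

variable (n m) in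
theorem coe_invE : (invE n m : Space n → ℂ) = weight n m (-1) := rfl

theorem symbol_incl (T : Sobolev n m (s + 1)) :
    symbol (incl T : Sobolev n m s) = mulOp (invE n m) (symbol T) := by
  apply symbol_eq_of_isSymbol
  have h : smulLeftCLM ℂ (weight n m (s + 1)) (𝓕 (toDist T)) = (symbol T : 𝓢'(Space n, ℂ)) :=
    symbol_spec T
  unfold IsSymbol
  rw [toTD_mulOp (invE_temperate n m), ← h, coe_invE,
    smulLeftCLM_smulLeftCLM_apply (weight_temperate n hm.out (s + 1))
      (weight_temperate n hm.out (-1)), weight_mul n hm.out, add_neg_cancel_right, toDist_incl]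

theorem hasDerivAt_iff_symbol {y : ℝ → Sobolev n m s} {y' : Sobolev n m s} {t : ℝ} :
    HasDerivAt y y' t ↔ HasDerivAt (fun τ => symbol (y τ)) (symbol y') t := by
  rw [hasDerivAt_iff_isLittleO, hasDerivAt_iff_isLittleO, ← Asymptotics.isLittleO_norm_left,
    ← Asymptotics.isLittleO_norm_left (f' := fun τ => symbol (y τ) - _ - _)]
  simp only [norm_eq_norm_symbol, map_sub, map_smul]

/-- A Hermitian function has a real Fourier transform. -/
theorem im_fourier_eq_zero {h : Space n → ℂ} (hh : ∀ ξ, h (-ξ) = starRingEnd ℂ (h ξ))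
    (x : Space n) : (𝓕 h x).im = 0 := by
  rw [← Complex.conj_eq_iff_im, Real.fourier_eq', ← integral_conj, ← integral_neg_eq_self]
  congr 1
  funext ξ
  rw [smul_eq_mul, smul_eq_mul, map_mul, ← hh, neg_neg, ← Complex.exp_conj, map_mul,
    Complex.conj_ofReal, Complex.conj_I, inner_neg_left]
  push_cast
  ring_nf

theorem fourierInv_neg_of_im_eq_zero {f : Space n → ℂ} (hf : ∀ x, (f x).im = 0) (ξ : Space n) :
    𝓕⁻ f (-ξ) = starRingEnd ℂ (𝓕⁻ f ξ) := by
  rw [Real.fourierInv_eq', Real.fourierInv_eq', ← integral_conj]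
  congr 1
  funext x
  rw [smul_eq_mul, smul_eq_mul, map_mul, Complex.conj_eq_iff_im.mpr (hf x), ← Complex.exp_conj,
    map_mul, Complex.conj_ofReal, Complex.conj_I, inner_neg_right]
  push_cast
  ring_nf

/-- A Fourier multiplier that is real and even preserves real distributions. -/
theorem IsRealDistribution.fourierMultiplier {T : 𝓢'(Space n, ℂ)} (hT : IsRealDistribution T)
    {c : Space n → ℂ} (hc : c.HasTemperateGrowth) (hr : ∀ ξ, (c ξ).im = 0)
    (he : ∀ ξ, c (-ξ) = c ξ) : IsRealDistribution (𝓕⁻ (smulLeftCLM ℂ c (𝓕 T))) := by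
  intro ψ hψ
  rw [fourierInv_apply, smulLeftCLM_apply_apply, TemperedDistribution.fourier_apply]
  refine hT _ fun x => ?_
  rw [SchwartzMap.fourier_coe]
  refine im_fourier_eq_zero (fun ξ => ?_) x
  rw [SchwartzMap.smulLeftCLM_apply_apply hc, SchwartzMap.smulLeftCLM_apply_apply hc,
    SchwartzMap.fourierInv_coe, smul_eq_mul, smul_eq_mul, map_mul, he,
    Complex.conj_eq_iff_im.mpr (hr ξ), fourierInv_neg_of_im_eq_zero hψ]

theorem exists_symbol_eq {g : L2 n}
    (hg : IsRealDistribution (𝓕⁻ (smulLeftCLM ℂ (weight n m (-s)) (g : 𝓢'(Space n, ℂ))))) :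
    ∃ T : Sobolev n m s, symbol T = g := by
  have h : IsSymbol m s (𝓕⁻ (smulLeftCLM ℂ (weight n m (-s)) (g : 𝓢'(Space n, ℂ)))) g := by
    unfold IsSymbol
    rw [FourierTransform.fourier_fourierInv_eq]
    simpa using weight_cancel (n := n) hm.out (-s) (g : 𝓢'(Space n, ℂ))
  exact ⟨⟨_, hg, g, h⟩, symbol_eq_of_isSymbol h⟩

/-- Changing the Sobolev order from s to s' only inserts weights, which are real and even like c, so
the resulting distribution is again real. -/
theorem exists_symbol_eq_mulOp (s' : ℝ) {c : Space n →ᵇ ℂ}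
    (hc : (c : Space n → ℂ).HasTemperateGrowth) (hr : ∀ ξ, (c ξ).im = 0)
    (he : ∀ ξ, c (-ξ) = c ξ) (T : Sobolev n m s) :
    ∃ T' : Sobolev n m s', symbol T' = mulOp c (symbol T) := by
  apply exists_symbol_eq
  have h : smulLeftCLM ℂ (weight n m s) (𝓕 (toDist T)) = (symbol T : 𝓢'(Space n, ℂ)) :=
    symbol_spec T
  have h1 := weight_temperate n hm.out s
  have h2 := weight_temperate n hm.out (-s')
  rw [toTD_mulOp hc, ← h, smulLeftCLM_smulLeftCLM_apply h1 hc,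
    smulLeftCLM_smulLeftCLM_apply (h1.mul hc) h2]
  refine IsRealDistribution.fourierMultiplier T.2.1 ((h1.mul hc).mul h2) (fun ξ => ?_) fun ξ => ?_
  · simp [weight, Complex.mul_im, hr ξ]
  · simp [weight, he]

/-- The isometry `symbol` has closed range: its range is cut out of L² by the reality conditions,
which are continuous in g. Completeness is needed to sum the power series 𝒱. -/
instance : CompleteSpace (Sobolev n m s) := by
  rw [completeSpace_iff_isComplete_range
    (isometry_symbol (n := n) (m := m) (s := s)).isUniformInducing]
  apply IsClosed.isComplete
  have h : Set.range (symbol : Sobolev n m s → L2 n) =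
      ⋂ (ψ : 𝓢(Space n, ℂ)) (_ : ∀ x, (ψ x).im = 0), {g : L2 n |
        (smulLeftCLM ℂ (weight n m (-s)) (Lp.toTemperedDistributionCLM ℂ volume 2 g)
          (𝓕⁻ ψ)).im = 0} := by
    ext g
    simp only [Set.mem_range, Set.mem_iInter, Set.mem_ofPred_eq]
    constructor
    · rintro ⟨T, rfl⟩ ψ hψ
      have h := T.2.1 ψ hψ
      change (toDist T ψ).im = 0 at h
      rwa [toDist_eq hm.out, fourierInv_apply] at h
    · intro hg
      exact exists_symbol_eq fun ψ hψ => by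
        rw [fourierInv_apply]
        exact hg ψ hψ
  rw [h]
  refine isClosed_iInter fun ψ => isClosed_iInter fun _ => ?_
  refine isClosed_eq (Complex.continuous_im.comp ?_) continuous_const
  exact (continuous_eval_const (𝓕⁻ ψ)).comp ((smulLeftCLM ℂ (weight n m (-s))).continuous.comp
    (Lp.toTemperedDistributionCLM ℂ volume 2).continuous)

/-- The pairing `g ↦ ∫ φ g` of `L²` with a test function. -/
noncomputable def pairing (φ : 𝓢(Space n, ℂ)) : L2 n →L[ℝ] ℂ where
  toFun g := Lp.toTemperedDistributionCLM ℂ volume 2 g φ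
  map_add' g g' := by rw [map_add]; rfl
  map_smul' c g := by
    have e : c • g = (c : ℂ) • g := by
      ext1
      filter_upwards [Lp.coeFn_smul c g, Lp.coeFn_smul (c : ℂ) g] with x h1 h2
      rw [h1, h2]
      simp
    rw [e, map_smul]
    rfl
  cont := (continuous_eval_const φ).comp (Lp.toTemperedDistributionCLM ℂ volume 2).continuous

theorem pairing_mulOp {c : Space n →ᵇ ℂ} (hc : (c : Space n → ℂ).HasTemperateGrowth)
    (φ : 𝓢(Space n, ℂ)) (g : L2 n) :
    pairing φ (mulOp c g) = pairing (SchwartzMap.smulLeftCLM ℂ c φ) g := by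
  change ((mulOp c g : L2 n) : 𝓢'(Space n, ℂ)) φ = _
  rw [toTD_mulOp hc, smulLeftCLM_apply_apply]
  rfl

theorem toDist_apply (T : Sobolev n m s) (ψ : 𝓢(Space n, ℂ)) :
    toDist T ψ = pairing (SchwartzMap.smulLeftCLM ℂ (weight n m (-s)) (𝓕⁻ ψ)) (symbol T) := by
  rw [toDist_eq hm.out, fourierInv_apply, smulLeftCLM_apply_apply]
  rfl

variable (m s) in
/-- The test function of frequency that corresponds to `ψ` in the pairings below. -/
noncomputable def testFreq : 𝓢(Space n, ℂ) →L[ℂ] 𝓢(Space n, ℂ) :=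
  SchwartzMap.smulLeftCLM ℂ (weight n m (1 - s)) ∘L
    (FourierTransform.fourierCLE ℂ 𝓢(Space n, ℂ)).symm.toContinuousLinearMap

omit hm in
theorem testFreq_apply (ψ : 𝓢(Space n, ℂ)) :
    testFreq m s ψ = SchwartzMap.smulLeftCLM ℂ (weight n m (1 - s)) (𝓕⁻ ψ) := rfl

/-- The inverse Fourier transform and multiplication by a power of ε are both invertible on Schwartz
functions. -/
theorem testFreq_surjective : Function.Surjective (testFreq (n := n) m s) := by
  intro φ
  have h1 := weight_temperate n hm.out (1 - s)
  have h2 := weight_temperate n hm.out (-(1 - s))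
  refine ⟨𝓕 (SchwartzMap.smulLeftCLM ℂ (weight n m (-(1 - s))) φ), ?_⟩
  rw [testFreq_apply, FourierTransform.fourierInv_fourier_eq,
    SchwartzMap.smulLeftCLM_smulLeftCLM_apply h1 h2, weight_mul n hm.out, add_neg_cancel,
    weight_zero]
  ext ξ
  rw [SchwartzMap.smulLeftCLM_apply_apply (Function.HasTemperateGrowth.const _), one_smul]

theorem toDist_apply_eq_pairing (T : Sobolev n m s) (ψ : 𝓢(Space n, ℂ)) :
    toDist T ψ = pairing (testFreq m s ψ) (mulOp (invE n m) (symbol T)) := by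
  rw [toDist_apply, pairing_mulOp (invE_temperate n m), testFreq_apply, coe_invE,
    SchwartzMap.smulLeftCLM_smulLeftCLM_apply (weight_temperate n hm.out _)
      (weight_temperate n hm.out _), weight_mul n hm.out, show -1 + (1 - s) = -s by ring]

theorem toDist_succ_apply_eq_pairing (T : Sobolev n m (s + 1)) (ψ : 𝓢(Space n, ℂ)) :
    toDist T ψ = pairing (testFreq m s ψ) (mulOp (invE n m) (mulOp (invE n m) (symbol T))) := by
  rw [← symbol_incl, ← toDist_apply_eq_pairing, toDist_incl]

/-- The multiplier of m² - Δ is ε², and ε²·ε^(-(s+1)) = ε^(1-s). This is the reason for the exponent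
in `testFreq`: the elliptic part of the equation becomes the plain pairing with the symbol, and each
lower order costs one factor 1/ε. -/
theorem toDist_laplacian_eq_pairing (T : Sobolev n m (s + 1)) (ψ : 𝓢(Space n, ℂ)) :
    (m : ℂ) ^ 2 * toDist T ψ - toDist T (Δ ψ) = pairing (testFreq m s ψ) (symbol T) := by
  have h1 := weight_temperate n hm.out (-(s + 1))
  have h2 : (fun ξ : Space n => Complex.ofReal (‖ξ‖ ^ 2)).HasTemperateGrowth := by fun_prop
  have e1 := toDist_apply T ψ
  have e2 : toDist T (Δ ψ) = -(2 * Real.pi) ^ 2 • pairing (SchwartzMap.smulLeftCLM ℂ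
      (weight n m (-(s + 1))) (SchwartzMap.smulLeftCLM ℂ (fun ξ : Space n =>
        Complex.ofReal (‖ξ‖ ^ 2)) (𝓕⁻ ψ))) (symbol T) := by
    rw [← laplacian_apply_apply, TemperedDistribution.laplacian_eq_fourierMultiplierCLM,
      TemperedDistribution.fourierMultiplierCLM_apply, toDist_eq hm.out,
      FourierTransform.fourier_fourierInv_eq]
    rfl
  have e3 : testFreq m s ψ = (m : ℂ) ^ 2 • SchwartzMap.smulLeftCLM ℂ (weight n m (-(s + 1)))
      (𝓕⁻ ψ) - ((-(2 * Real.pi) ^ 2 : ℝ) : ℂ) • SchwartzMap.smulLeftCLM ℂ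
      (weight n m (-(s + 1))) (SchwartzMap.smulLeftCLM ℂ (fun ξ : Space n =>
        Complex.ofReal (‖ξ‖ ^ 2)) (𝓕⁻ ψ)) := by
    ext ξ
    have e4 := congrFun (weight_mul n hm.out (-(s + 1)) 2) ξ
    rw [show -(s + 1) + 2 = 1 - s by ring, Pi.mul_apply] at e4
    have e5 : weight n m 2 ξ = m ^ 2 + (2 * Real.pi * ‖ξ‖) ^ 2 := by
      simp [weight]
    rw [e5] at e4
    rw [testFreq_apply, SchwartzMap.smulLeftCLM_apply_apply (weight_temperate n hm.out _), ← e4]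
    simp only [sub_apply, smul_apply,
      SchwartzMap.smulLeftCLM_apply_apply h1, SchwartzMap.smulLeftCLM_apply_apply h2,
      smul_eq_mul]
    push_cast
    ring
  rw [e1, e2, e3]
  change _ = (Lp.toTemperedDistributionCLM ℂ volume 2 (symbol T)) (_ - _)
  rw [map_sub, map_smul, map_smul, ← Complex.coe_smul]
  rfl

end Symbol

/-! ### Density of the compactly supported test functions -/

section Cutoff

variable {E : Type*} [NormedAddCommGroup E] [NormedSpace ℝ E]

/-- Each derivative of X(δ·) of positive order i carries δ^i ≤ δ. In order zero the factor δ comes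
from the mean value inequality, at the cost of ‖x‖. -/
theorem norm_iteratedFDeriv_cutoff_sub_one_le (X : 𝓢(E, ℂ)) (hX : X 0 = 1) {δ : ℝ} (hδ : 0 < δ)
    (hδ' : δ ≤ 1) (i : ℕ) (x : E) :
    ‖iteratedFDeriv ℝ i (fun y => X (δ • y) - 1) x‖ ≤ δ * ((SchwartzMap.seminorm ℝ 0 i X +
      SchwartzMap.seminorm ℝ 0 1 X) * (1 + ‖x‖)) := by
  have h0 : ∀ j, 0 ≤ SchwartzMap.seminorm ℝ 0 j X := fun j => apply_nonneg _ _
  cases i with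
  | zero =>
    rw [norm_iteratedFDeriv_zero]
    have h1 := convex_univ.norm_image_sub_le_of_norm_fderiv_le (𝕜 := ℝ) (f := X)
      (C := SchwartzMap.seminorm ℝ 0 1 X) (x := 0) (y := δ • x)
      (fun y _ => X.differentiable y) (fun y _ => by
        rw [← norm_iteratedFDeriv_one]; exact SchwartzMap.norm_iteratedFDeriv_le_seminorm ℝ X 1 y)
      (Set.mem_univ _) (Set.mem_univ _)
    rw [hX, sub_zero, norm_smul, Real.norm_of_nonneg hδ.le] at h1
    refine h1.trans ?_
    have := h0 0
    have := h0 1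
    have := norm_nonneg x
    calc _ = δ * (SchwartzMap.seminorm ℝ 0 1 X * ‖x‖) := by ring
      _ ≤ _ := by
        gcongr
        · linarith
        · linarith
  | succ i =>
    have hs : ContDiff ℝ ((i + 1 : ℕ) : ℕ∞ω) X := X.smooth _
    have hs' : ContDiff ℝ ((i + 1 : ℕ) : ℕ∞ω) fun y => X (δ • y) := by fun_prop
    have e : iteratedFDeriv ℝ (i + 1) (fun y => X (δ • y) - 1) x =
        δ ^ (i + 1) • iteratedFDeriv ℝ (i + 1) X (δ • x) := by
      rw [← congrFun (iteratedFDeriv_comp_const_smul δ hs) x]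
      have := iteratedFDeriv_add_apply (x := x) hs'.contDiffAt
        (contDiff_const (c := (-1 : ℂ))).contDiffAt
      rw [iteratedFDeriv_const_of_ne (Nat.succ_ne_zero i), Pi.zero_apply, add_zero] at this
      rw [← this]
      rfl
    rw [e, norm_smul, Real.norm_of_nonneg (by positivity)]
    have h2 := SchwartzMap.norm_iteratedFDeriv_le_seminorm ℝ X (i + 1) (δ • x)
    have := h0 (i + 1)
    have := h0 1
    have := norm_nonneg x
    refine mul_le_mul (pow_le_of_le_one hδ.le hδ' (Nat.succ_ne_zero i)) ?_ (norm_nonneg _) hδ.le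
    refine h2.trans ?_
    nlinarith

/-- Leibniz's rule for (X(δ·) - 1)ψ; the growth 1 + ‖x‖ of the first factor is absorbed by the
seminorm of ψ with one more power of ‖x‖. -/
theorem seminorm_cutoff_sub_le (X : 𝓢(E, ℂ)) (hX : X 0 = 1) (ψ : 𝓢(E, ℂ)) (k l : ℕ) :
    ∃ C, ∀ δ : ℝ, 0 < δ → δ ≤ 1 → ∀ ψ' : 𝓢(E, ℂ), (∀ x, ψ' x = X (δ • x) * ψ x) →
      SchwartzMap.seminorm ℝ k l (ψ' - ψ) ≤ δ * C := by
  refine ⟨∑ i ∈ Finset.range (l + 1), (l.choose i : ℝ) * ((SchwartzMap.seminorm ℝ 0 i X +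
    SchwartzMap.seminorm ℝ 0 1 X) * (SchwartzMap.seminorm ℝ k (l - i) ψ +
      SchwartzMap.seminorm ℝ (k + 1) (l - i) ψ)), fun δ hδ hδ' ψ' hψ' => ?_⟩
  have h0 : ∀ (φ : 𝓢(E, ℂ)) k j, 0 ≤ SchwartzMap.seminorm ℝ k j φ := fun φ k j => apply_nonneg _ _
  refine SchwartzMap.seminorm_le_bound ℝ k l _ (mul_nonneg hδ.le (Finset.sum_nonneg fun i _ =>
    mul_nonneg (by positivity) (mul_nonneg (add_nonneg (h0 _ _ _) (h0 _ _ _))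
      (add_nonneg (h0 _ _ _) (h0 _ _ _))))) fun x => ?_
  have hs : ContDiff ℝ ∞ X := X.smooth _
  have hs' : ContDiff ℝ ∞ fun y => X (δ • y) - 1 := by fun_prop
  have e : ((ψ' - ψ : 𝓢(E, ℂ)) : E → ℂ) = fun y => (X (δ • y) - 1) • ψ y := by
    funext y
    rw [sub_apply, hψ', smul_eq_mul]
    ring
  rw [e]
  have h1 := norm_iteratedFDeriv_smul_le (𝕜 := ℝ) hs' (ψ.smooth ⊤) x (n := l)
    (by exact_mod_cast le_top)
  refine (mul_le_mul_of_nonneg_left h1 (by positivity)).trans ?_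
  rw [Finset.mul_sum, Finset.mul_sum]
  refine Finset.sum_le_sum fun i _ => ?_
  have h2 := norm_iteratedFDeriv_cutoff_sub_one_le X hX hδ hδ' i x
  have h3 := ψ.le_seminorm ℝ k (l - i) x
  have h4 := ψ.le_seminorm ℝ (k + 1) (l - i) x
  have h5 := add_nonneg (h0 X 0 i) (h0 X 0 1)
  calc _ = (l.choose i : ℝ) * (‖iteratedFDeriv ℝ i (fun y => X (δ • y) - 1) x‖ *
        (‖x‖ ^ k * ‖iteratedFDeriv ℝ (l - i) ψ x‖)) := by ring
    _ ≤ (l.choose i : ℝ) * (δ * ((SchwartzMap.seminorm ℝ 0 i X +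
      SchwartzMap.seminorm ℝ 0 1 X) * (1 + ‖x‖)) *
        (‖x‖ ^ k * ‖iteratedFDeriv ℝ (l - i) ψ x‖)) := by gcongr
    _ = δ * ((l.choose i : ℝ) * ((SchwartzMap.seminorm ℝ 0 i X +
      SchwartzMap.seminorm ℝ 0 1 X) * (‖x‖ ^ k * ‖iteratedFDeriv ℝ (l - i) ψ x‖ +
        ‖x‖ ^ (k + 1) * ‖iteratedFDeriv ℝ (l - i) ψ x‖))) := by ring
    _ ≤ _ := by gcongr

/-- The cutoffs X(x/(N+1))ψ(x) converge to ψ in every seminorm. The weak equation is tested only on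
compactly supported ψ, while the Fourier side needs all Schwartz functions. -/
theorem dense_hasCompactSupport (n : ℕ) : Dense {ψ : 𝓢(Space n, ℂ) | HasCompactSupport ψ} := by
  obtain ⟨χ, -, hc, hχ, -, h1⟩ := exists_contDiff_tsupport_subset (E := Space n) (n := ⊤)
    (univ_mem (f := 𝓝 (0 : Space n)))
  have hc' : HasCompactSupport (Complex.ofRealCLM ∘ χ) := hc.comp_left rfl
  have hχ' : ContDiff ℝ ∞ (Complex.ofRealCLM ∘ χ) := by fun_prop
  set X := hc'.toSchwartzMap hχ' with hXdef
  have hX : ∀ x, X x = χ x := fun x => rfl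
  intro ψ
  have hδ : ∀ N : ℕ, (0 : ℝ) < 1 / ((N : ℝ) + 1) := fun N => by positivity
  have hcN : ∀ N : ℕ, HasCompactSupport fun x => X ((1 / ((N : ℝ) + 1)) • x) * ψ x := fun N => by
    have : HasCompactSupport fun x => X ((1 / ((N : ℝ) + 1)) • x) :=
      hc'.comp_smul (hδ N).ne'
    exact this.mul_right
  have hsN : ∀ N : ℕ, ContDiff ℝ ∞ fun x => X ((1 / ((N : ℝ) + 1)) • x) * ψ x := fun N => by
    have := X.smooth ⊤
    have := ψ.smooth ⊤
    fun_prop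
  refine mem_closure_of_tendsto (f := fun N => (hcN N).toSchwartzMap (hsN N)) (b := atTop) ?_
    (Eventually.of_forall fun N => hcN N)
  rw [(schwartz_withSeminorms ℝ (Space n) ℂ).tendsto_nhds_atTop]
  rintro ⟨k, l⟩ ε hε
  obtain ⟨C, hC⟩ := seminorm_cutoff_sub_le X (by rw [hX, h1, Complex.ofReal_one]) ψ k l
  have ht : Tendsto (fun N : ℕ => 1 / ((N : ℝ) + 1) * C) atTop (𝓝 (0 * C)) :=
    tendsto_one_div_add_atTop_nhds_zero_nat.mul_const C
  rw [zero_mul] at ht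
  obtain ⟨N₀, hN₀⟩ := eventually_atTop.mp (ht.eventually_lt_const hε)
  refine ⟨N₀, fun N hN => ?_⟩
  refine (hC _ (hδ N) ?_ _ fun x => rfl).trans_lt (hN₀ N hN)
  rw [div_le_one (by positivity)]
  have : (0 : ℝ) ≤ N := by positivity
  linarith

end Cutoff

/-! ### Weak derivatives in time -/

section WeakDerivative

/-- `χ` is a test function on the open set `K` of times. -/
def IsTestOn (K : Set ℝ) (χ : ℝ → ℝ) : Prop :=
  ContDiff ℝ ∞ χ ∧ HasCompactSupport χ ∧ tsupport χ ⊆ K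

variable {K : Set ℝ} {χ : ℝ → ℝ}

theorem IsTestOn.mono {K' : Set ℝ} (hχ : IsTestOn K χ) (h : K ⊆ K') : IsTestOn K' χ :=
  ⟨hχ.1, hχ.2.1, hχ.2.2.trans h⟩

theorem IsTestOn.deriv (hχ : IsTestOn K χ) : IsTestOn K (deriv χ) :=
  ⟨(contDiff_infty_iff_deriv.mp hχ.1).2, hχ.2.1.deriv, tsupport_deriv_subset.trans hχ.2.2⟩

theorem IsTestOn.sub {χ' : ℝ → ℝ} (hχ : IsTestOn K χ) (hχ' : IsTestOn K χ') (c : ℝ) :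
    IsTestOn K fun t => χ t - c * χ' t := by
  refine ⟨hχ.1.sub (contDiff_const.mul hχ'.1), hχ.2.1.sub hχ'.2.1.mul_left, ?_⟩
  refine (tsupport_sub _ _).trans (Set.union_subset hχ.2.2 ?_)
  exact (tsupport_mul_subset_right (f := fun _ => c)).trans hχ'.2.2

theorem IsTestOn.integrable_smul (hχ : IsTestOn K χ) (hK : IsOpen K) {g : ℝ → ℂ}
    (hg : ContinuousOn g K) : Integrable fun t => χ t • g t := by
  refine Continuous.integrable_of_hasCompactSupport ?_ hχ.2.1.smul_right
  exact (hχ.1.continuous.continuousOn.smul hg).continuous_of_tsupport_subset hK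
    ((tsupport_smul_subset_left χ g).trans hχ.2.2)

/-- Integration by parts for F that is differentiable only on K: outside the support of χ the
product is locally zero, whatever F is there. -/
theorem IsTestOn.integral_deriv_smul_add (hχ : IsTestOn K χ) (hK : IsOpen K) {F f : ℝ → ℂ}
    (hF : ∀ t ∈ K, HasDerivAt F (f t) t) (hf : ContinuousOn f K) :
    ∫ t, (_root_.deriv χ t • F t + χ t • f t) = 0 := by
  have hFc : ContinuousOn F K := fun t ht => (hF t ht).continuousAt.continuousWithinAt
  refine integral_eq_zero_of_hasDerivAt_of_integrable (f := fun t => χ t • F t) (fun t => ?_)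
    ((hχ.deriv.integrable_smul hK hFc).add (hχ.integrable_smul hK hf))
    (hχ.integrable_smul hK hFc)
  by_cases ht : t ∈ K
  · rw [add_comm]
    exact ((contDiff_infty_iff_deriv.mp hχ.1).1 t).hasDerivAt.smul (hF t ht)
  · have h1 : t ∉ tsupport χ := fun h => ht (hχ.2.2 h)
    have h2 : t ∉ tsupport (_root_.deriv χ) := fun h => ht (hχ.deriv.2.2 h)
    rw [image_eq_zero_of_notMem_tsupport h1, image_eq_zero_of_notMem_tsupport h2, zero_smul,
      zero_smul, add_zero]
    refine (hasDerivAt_const t (0 : ℂ)).congr_of_eventuallyEq ?_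
    filter_upwards [notMem_tsupport_iff_eventuallyEq.mp h1] with τ hτ
    rw [hτ, Pi.zero_apply, zero_smul]

/-- The primitive of θ from a vanishes to the right of b because the total integral is zero, so it
is again a test function. -/
theorem exists_isTestOn_deriv_eq {a b : ℝ} (hK : Set.Icc a b ⊆ K)
    {θ : ℝ → ℝ} (hθ : IsTestOn (Set.Ioo a b) θ) (h0 : ∫ t, θ t = 0) :
    ∃ χ, IsTestOn K χ ∧ deriv χ = θ := by
  have hs : ∀ x, x ∉ Set.Ioo a b → θ x = 0 := fun x hx =>
    image_eq_zero_of_notMem_tsupport fun h => hx (hθ.2.2 h)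
  have hd : deriv (fun t => ∫ τ in a..t, θ τ) = θ := by
    funext t
    exact hθ.1.continuous.deriv_integral θ a t
  have hsupp : Function.support (fun t => ∫ τ in a..t, θ τ) ⊆ Set.Icc a b := by
    intro t ht
    by_contra h
    rw [Set.mem_Icc, not_and_or, not_le, not_le] at h
    refine ht ?_
    change ∫ τ in a..t, θ τ = 0
    rcases h with h | h
    · rw [intervalIntegral.integral_congr (g := fun _ => 0), intervalIntegral.integral_zero]
      intro x hx
      rw [Set.uIcc_of_ge h.le] at hx
      exact hs x fun h' => absurd h'.1 (not_lt.mpr hx.2)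
    · rw [intervalIntegral.integral_eq_integral_of_support_subset, h0]
      intro x hx
      have : x ∈ Set.Ioo a b := by
        by_contra h'
        exact hx (hs x h')
      exact ⟨this.1, (this.2.trans h).le⟩
  refine ⟨_, ⟨?_, ?_, ?_⟩, hd⟩
  · rw [contDiff_infty_iff_deriv, hd]
    refine ⟨fun t => ?_, hθ.1⟩
    exact (intervalIntegral.integral_hasDerivAt_right
      (hθ.1.continuous.intervalIntegrable _ _)
      hθ.1.continuous.stronglyMeasurable.stronglyMeasurableAtFilter
      hθ.1.continuous.continuousAt).differentiableAt
  · exact HasCompactSupport.of_support_subset_isCompact isCompact_Icc hsupp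
  · exact (closure_minimal hsupp isClosed_Icc).trans hK

/-- The lemma of du Bois-Reymond. -/
theorem exists_eqOn_const_of_weak {a b : ℝ} (hab : a < b)
    (habK : Set.Icc a b ⊆ K) {Q : ℝ → ℂ} (hQ : ContinuousOn Q K)
    (h : ∀ χ, IsTestOn K χ → ∫ t, deriv χ t • Q t = 0) :
    ∃ c, Set.EqOn Q (fun _ => c) (Set.Ioo a b) := by
  have hQ' : ContinuousOn Q (Set.Ioo a b) := hQ.mono (Set.Ioo_subset_Icc_self.trans habK)
  let B : ContDiffBump ((a + b) / 2) := ⟨(b - a) / 8, (b - a) / 4, by linarith, by linarith⟩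
  set η := B.normed volume with hηdef
  have hη : IsTestOn (Set.Ioo a b) η := by
    refine ⟨B.contDiff_normed, B.hasCompactSupport_normed, ?_⟩
    rw [hηdef, B.tsupport_normed_eq, Real.closedBall_eq_Icc]
    intro x hx
    have h1 : (a + b) / 2 - (b - a) / 4 ≤ x := hx.1
    have h2 : x ≤ (a + b) / 2 + (b - a) / 4 := hx.2
    constructor <;> linarith
  have hη1 : ∫ t, η t = 1 := B.integral_normed
  -- Since η has integral 1, the constant can only be the η-mean of Q. A test function θ is reduced
  -- to a derivative by subtracting (∫θ)η.
  refine ⟨∫ t, η t • Q t, ?_⟩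
  refine Measure.eqOn_open_of_ae_eq (μ := volume) ?_ isOpen_Ioo hQ' continuousOn_const
  rw [Filter.EventuallyEq, ae_restrict_iff' measurableSet_Ioo]
  have key := isOpen_Ioo.ae_eq_zero_of_integral_contDiff_smul_eq_zero (μ := volume)
    (f := fun t => Q t - ∫ t, η t • Q t) (U := Set.Ioo a b)
    ((hQ'.sub continuousOn_const).locallyIntegrableOn measurableSet_Ioo) fun θ h1 h2 h3 => ?_
  · filter_upwards [key] with t ht hmem
    exact sub_eq_zero.mp (ht hmem)
  · have hθ : IsTestOn (Set.Ioo a b) θ := ⟨h1, h2, h3⟩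
    have i1 : Integrable θ := h1.continuous.integrable_of_hasCompactSupport h2
    have i2 : Integrable η := hη.1.continuous.integrable_of_hasCompactSupport hη.2.1
    obtain ⟨χ, hχ, hχd⟩ := exists_isTestOn_deriv_eq habK (hθ.sub hη (∫ t, θ t)) (by
      rw [integral_sub i1 (i2.const_mul _), integral_const_mul, hη1, mul_one, sub_self])
    have e := h χ hχ
    rw [hχd] at e
    have j1 := hθ.integrable_smul isOpen_Ioo hQ'
    have j2 := hη.integrable_smul isOpen_Ioo hQ'
    have j2' : Integrable fun t => (∫ t, θ t) • η t • Q t :=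
      j2.smul (∫ t, θ t)
    simp only [sub_smul, mul_smul] at e
    rw [integral_sub j1 j2', integral_smul] at e
    simp only [smul_sub]
    rw [integral_sub j1 (i1.smul_const _), integral_smul_const, e]

/-- The function q minus a primitive of f has weak derivative zero, hence is constant near t₀ by du
Bois-Reymond's lemma. -/
theorem hasDerivAt_of_weak (hK : IsOpen K) {q f : ℝ → ℂ} (hq : ContinuousOn q K)
    (hf : ContinuousOn f K)
    (h : ∀ χ, IsTestOn K χ → ∫ t, (deriv χ t • q t + χ t • f t) = 0) {t₀ : ℝ} (ht₀ : t₀ ∈ K) :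
    HasDerivAt q (f t₀) t₀ := by
  obtain ⟨ε, hε, hball⟩ := Metric.isOpen_iff.mp hK t₀ ht₀
  have hsub : ∀ t ∈ Metric.ball t₀ ε, Set.uIcc t₀ t ⊆ K := fun t ht =>
    ((convex_ball t₀ ε).ordConnected.uIcc_subset (Metric.mem_ball_self hε) ht).trans hball
  have hF : ∀ t ∈ Metric.ball t₀ ε, HasDerivAt (fun t => ∫ τ in t₀..t, f τ) (f t) t :=
    fun t ht => intervalIntegral.integral_hasDerivAt_right
      (hf.mono (hsub t ht)).intervalIntegrable
      (hf.stronglyMeasurableAtFilter hK t (hball ht))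
      (hf.continuousAt (hK.mem_nhds (hball ht)))
  have hFc : ContinuousOn (fun t => ∫ τ in t₀..t, f τ) (Metric.ball t₀ ε) := fun t ht =>
    (hF t ht).continuousAt.continuousWithinAt
  obtain ⟨c, hc⟩ := exists_eqOn_const_of_weak (K := Metric.ball t₀ ε) (a := t₀ - ε / 2)
    (b := t₀ + ε / 2) (Q := fun t => q t - ∫ τ in t₀..t, f τ) (by linarith)
    (by
      rw [← Real.closedBall_eq_Icc]
      exact Metric.closedBall_subset_ball (by linarith))
    ((hq.mono hball).sub hFc) fun χ hχ => by
      have e1 := h χ (hχ.mono hball)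
      have e2 := hχ.integral_deriv_smul_add Metric.isOpen_ball hF (hf.mono hball)
      have i1 := hχ.deriv.integrable_smul Metric.isOpen_ball (hq.mono hball)
      have i2 := hχ.integrable_smul Metric.isOpen_ball (hf.mono hball)
      have i3 := hχ.deriv.integrable_smul Metric.isOpen_ball hFc
      rw [integral_add i1 i2] at e1
      rw [integral_add i3 i2] at e2
      simp only [smul_sub]
      rw [integral_sub i1 i3]
      linear_combination e1 - e2
  refine ((hF t₀ (Metric.mem_ball_self hε)).const_add c).congr_of_eventuallyEq ?_
  filter_upwards [Ioo_mem_nhds (show t₀ - ε / 2 < t₀ by linarith)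
    (show t₀ < t₀ + ε / 2 by linarith)] with t ht
  exact sub_eq_iff_eq_add.mp (hc ht)

end WeakDerivative

/-! ### From the weak equation to a differential equation in L². -/

section WeakSolution

variable {n : ℕ} {m s : ℝ} [hm : Fact (0 < m)] {K : Set ℝ}

/-- Density extends the vanishing to all Schwartz ψ, and `testFreq` reaches every Schwartz function
of the frequency. -/
theorem eq_zero_of_pairing_testFreq (s : ℝ) {g : L2 n}
    (h : ∀ ψ : 𝓢(Space n, ℂ), HasCompactSupport ψ → pairing (testFreq m s ψ) g = 0) : g = 0 := by
  have hc : Continuous fun ψ => pairing (testFreq (n := n) m s ψ) g :=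
    (ContinuousLinearMap.continuous (Lp.toTemperedDistributionCLM ℂ volume 2 g)).comp
      (testFreq m s).continuous
  have h1 : (fun ψ => pairing (testFreq (n := n) m s ψ) g) = fun _ => 0 :=
    hc.ext_on (dense_hasCompactSupport n) continuous_const h
  apply toTD_injective
  ext φ
  obtain ⟨ψ, rfl⟩ := testFreq_surjective (m := m) (s := s) φ
  rw [← Lp.toTemperedDistributionCLM_apply, ← Lp.toTemperedDistributionCLM_apply, map_zero]
  exact congrFun h1 ψ

/-- Scalar derivatives give the integral identity for y against every test function, hence in L². As
w is continuous in norm, the derivative then exists in norm. -/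
theorem hasDerivAt_of_pairing_testFreq (s : ℝ) (hK : IsOpen K) {y w : ℝ → L2 n}
    (hw : ContinuousOn w K) (h : ∀ ψ : 𝓢(Space n, ℂ), HasCompactSupport ψ → ∀ t ∈ K,
      HasDerivAt (fun τ => pairing (testFreq m s ψ) (y τ)) (pairing (testFreq m s ψ) (w t)) t)
    {t₀ : ℝ} (ht₀ : t₀ ∈ K) : HasDerivAt y (w t₀) t₀ := by
  obtain ⟨ε, hε, hball⟩ := Metric.isOpen_iff.mp hK t₀ ht₀
  have hsub : ∀ t ∈ Metric.ball t₀ ε, Set.uIcc t₀ t ⊆ K := fun t ht =>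
    ((convex_ball t₀ ε).ordConnected.uIcc_subset (Metric.mem_ball_self hε) ht).trans hball
  have hint : ∀ t ∈ Metric.ball t₀ ε, IntervalIntegrable w volume t₀ t := fun t ht =>
    (hw.mono (hsub t ht)).intervalIntegrable
  have key : ∀ t ∈ Metric.ball t₀ ε, y t = y t₀ + ∫ τ in t₀..t, w τ := by
    intro t ht
    rw [← sub_eq_zero]
    refine eq_zero_of_pairing_testFreq (m := m) s fun ψ hψ => ?_
    rw [map_sub, map_add, ← ContinuousLinearMap.intervalIntegral_comp_comm _ (hint t ht),
      intervalIntegral.integral_eq_sub_of_hasDerivAt (fun τ hτ => h ψ hψ τ (hsub t ht hτ))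
        (((pairing _).continuous.comp_continuousOn (hw.mono (hsub t ht))).intervalIntegrable)]
    ring
  have hd : HasDerivAt (fun t => y t₀ + ∫ τ in t₀..t, w τ) (w t₀) t₀ :=
    (intervalIntegral.integral_hasDerivAt_right (by simp)
      (hw.stronglyMeasurableAtFilter hK t₀ ht₀)
      (hw.continuousAt (hK.mem_nhds ht₀))).const_add _
  exact hd.congr_of_eventuallyEq (eventually_of_mem (Metric.ball_mem_nhds t₀ hε) key)

variable {u : ℝ → Sobolev n m (s + 1)} {j : ℝ → Sobolev n m s}

theorem TimeRegular.hasDerivAt_incl (hK : IsOpen K) (hu : TimeRegular (s := s) K u) {t : ℝ}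
    (ht : t ∈ K) : HasDerivAt (fun τ => (incl (u τ) : Sobolev n m s)) (timeDeriv u t) t :=
  ((hu.2.contDiffAt (hK.mem_nhds ht)).differentiableAt one_ne_zero).hasDerivAt

theorem TimeRegular.hasDerivAt_symbol (hK : IsOpen K) (hu : TimeRegular (s := s) K u) {t : ℝ}
    (ht : t ∈ K) : HasDerivAt (fun τ => mulOp (invE n m) (symbol (u τ)))
      (symbol (timeDeriv (s := s) u t)) t := by
  have h := hasDerivAt_iff_symbol.mp (hu.hasDerivAt_incl hK ht)
  simpa only [symbol_incl] using h

theorem TimeRegular.continuousOn_timeDeriv (hK : IsOpen K) (hu : TimeRegular (s := s) K u) :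
    ContinuousOn (timeDeriv (s := s) u) K :=
  hu.2.continuousOn_deriv_of_isOpen hK le_rfl

/-- The first order system in frequency space: ε^(-1)∂_t b = -a - ε^(-1)j, where a and b are the
symbols of u and ∂_t u. One of the two time derivatives on χ is moved back to u, which is C¹; the
other one leaves a weak first order equation. -/
theorem IsWeakSolution.hasDerivAt_symbol (hK : IsOpen K) (hu : TimeRegular (s := s) K u)
    (hj : ContinuousOn j K) (h : IsWeakSolution K u j) {t : ℝ} (ht : t ∈ K) :
    HasDerivAt (fun τ => mulOp (invE n m) (symbol (timeDeriv (s := s) u τ)))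
      (-symbol (u t) - mulOp (invE n m) (symbol (j t))) t := by
  have hsym : ∀ {s : ℝ}, Continuous (symbol : Sobolev n m s → L2 n) := isometry_symbol.continuous
  have ca : ContinuousOn (fun τ => symbol (u τ)) K := hsym.comp_continuousOn hu.1
  have cj : ContinuousOn (fun τ => mulOp (invE n m) (symbol (j τ))) K :=
    (mulOp (invE n m)).continuous.comp_continuousOn (hsym.comp_continuousOn hj)
  have cb : ContinuousOn (fun τ => symbol (timeDeriv (s := s) u τ)) K :=
    hsym.comp_continuousOn (hu.continuousOn_timeDeriv hK)
  refine hasDerivAt_of_pairing_testFreq (m := m) s hK (ca.neg.sub cj) (fun ψ hψ t ht => ?_) ht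
  have hq : ContinuousOn (fun τ => pairing (testFreq m s ψ)
      (mulOp (invE n m) (symbol (timeDeriv (s := s) u τ)))) K :=
    (pairing _).continuous.comp_continuousOn ((mulOp (invE n m)).continuous.comp_continuousOn cb)
  have hp : ∀ t ∈ K, HasDerivAt (fun τ => toDist (u τ) ψ) (pairing (testFreq m s ψ)
      (mulOp (invE n m) (symbol (timeDeriv (s := s) u t)))) t := fun t ht => by
    simp only [toDist_succ_apply_eq_pairing]
    exact (pairing (testFreq m s ψ)).hasFDerivAt.comp_hasDerivAt t
      ((mulOp (invE n m)).hasFDerivAt.comp_hasDerivAt t (hu.hasDerivAt_symbol hK ht))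
  refine hasDerivAt_of_weak hK hq
    ((pairing (testFreq m s ψ)).continuous.comp_continuousOn (ca.neg.sub cj)) (fun χ hχ => ?_) ht
  have e1 := h χ ψ hχ.1 hχ.2.1 hχ.2.2 hψ
  have e2 := hχ.deriv.integral_deriv_smul_add hK hp hq
  have hpc : ContinuousOn (fun τ => toDist (u τ) ψ) K := fun t ht =>
    (hp t ht).continuousAt.continuousWithinAt
  have hf : ContinuousOn (fun τ => pairing (testFreq m s ψ)
      (-symbol (u τ) - mulOp (invE n m) (symbol (j τ)))) K :=
    (pairing (testFreq m s ψ)).continuous.comp_continuousOn (ca.neg.sub cj)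
  have i1 := hχ.deriv.deriv.integrable_smul hK hpc
  have i2 := hχ.deriv.integrable_smul hK hq
  have i3 := hχ.integrable_smul hK hf
  have e3 : ∀ t, ((deriv (deriv χ) t : ℝ) : ℂ) * toDist (u t) ψ +
      (χ t : ℂ) * ((m : ℂ) ^ 2 * toDist (u t) ψ - toDist (u t) (Δ ψ) + toDist (j t) ψ) =
      deriv (deriv χ) t • toDist (u t) ψ - χ t • pairing (testFreq m s ψ)
        (-symbol (u t) - mulOp (invE n m) (symbol (j t))) := fun t => by
    rw [toDist_laplacian_eq_pairing, toDist_apply_eq_pairing (j t), map_sub, map_neg,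
      Complex.real_smul, Complex.real_smul]
    ring
  simp only [e3] at e1
  rw [integral_sub i1 i3] at e1
  rw [integral_add i1 i2] at e2
  change ∫ t, (deriv χ t • pairing (testFreq m s ψ)
    (mulOp (invE n m) (symbol (timeDeriv (s := s) u t))) + χ t • pairing (testFreq m s ψ)
      (-symbol (u t) - mulOp (invE n m) (symbol (j t)))) = 0
  rw [integral_add i2 i3]
  linear_combination e2 - e1

end WeakSolution

/-! ### Duhamel's formula and the space of free solutions -/

section FreeSpace

variable {n : ℕ} {m s : ℝ} [hm : Fact (0 < m)]

/-- The first component, in frequency space, of the Cauchy data `Φ` at time `t` transported to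
time `0` by the free evolution. -/
noncomputable def pullFst (t : ℝ) (Φ : Data n m s) : L2 n :=
  mulOp (cosE n m t) (symbol Φ.fst) - mulOp (sinE n m t) (symbol Φ.snd)

/-- The second component, in frequency space, of the Cauchy data `Φ` at time `t` transported to
time `0` by the free evolution. -/
noncomputable def pullSnd (t : ℝ) (Φ : Data n m s) : L2 n :=
  mulOp (cosE n m t) (symbol Φ.snd) + mulOp (sinE n m t) (symbol Φ.fst)

theorem norm_sq_pull (t : ℝ) (Φ : Data n m s) :
    ‖pullFst t Φ‖ ^ 2 + ‖pullSnd t Φ‖ ^ 2 = ‖Φ‖ ^ 2 := by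
  -- The velocity is taken as the first component: in this order the two squares are those of
  -- `pullSnd` and `pullFst`.
  have h := norm_sq_rotation (fun ξ => cosE_apply n m t ξ) (fun ξ => sinE_apply n m t ξ)
    (symbol Φ.snd) (symbol Φ.fst)
  rw [WithLp.prod_norm_sq_eq_of_L2, norm_eq_norm_symbol, norm_eq_norm_symbol Φ.snd, pullFst,
    pullSnd]
  linarith

variable (n m) in
theorem cosE_zero : cosE n m 0 = 1 := by
  ext ξ
  simp [cosE_apply]

variable (n m) in
theorem sinE_zero : sinE n m 0 = 0 := by
  ext ξ
  simp [sinE_apply]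

theorem pullFst_zero (Φ : Data n m s) : pullFst 0 Φ = symbol Φ.fst := by
  rw [pullFst, cosE_zero, sinE_zero, mulOp_one, map_zero, zero_apply, sub_zero]

theorem pullSnd_zero (Φ : Data n m s) : pullSnd 0 Φ = symbol Φ.snd := by
  rw [pullSnd, cosE_zero, sinE_zero, mulOp_one, map_zero, zero_apply, add_zero]

/-- Duhamel's formula in differential form. -/
theorem IsWeakSolution.hasDerivAt_pull {K : Set ℝ} {u : ℝ → Sobolev n m (s + 1)}
    {j : ℝ → Sobolev n m s} (hK : IsOpen K) (hu : TimeRegular (s := s) K u)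
    (hj : ContinuousOn j K) (h : IsWeakSolution K u j) {t : ℝ} (ht : t ∈ K) :
    HasDerivAt (fun τ => pullFst τ (cauchyData (s := s) u τ))
      (mulOp (sinE n m t) (symbol (j t))) t ∧
    HasDerivAt (fun τ => pullSnd τ (cauchyData (s := s) u τ))
      (-mulOp (cosE n m t) (symbol (j t))) t :=
  hasDerivAt_rotation (a := fun τ => symbol (u τ)) (b := fun τ => symbol (timeDeriv (s := s) u τ))
    (j := fun τ => symbol (j τ)) hK (isometry_symbol.continuous.comp_continuousOn hj)
    (fun _ hτ => hu.hasDerivAt_symbol hK hτ) (fun _ hτ => h.hasDerivAt_symbol hK hu hj hτ) ht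

theorem freeData_fst (t : ℝ) (φ : Free n m s) : (freeData t φ).fst = φ.1 t := rfl

/-- Duhamel's formula without source: the data pulled back to time 0 are constant in time. -/
theorem pull_freeData (t : ℝ) (φ : Free n m s) :
    pullFst t (freeData t φ) = symbol (freeData 0 φ).fst ∧
      pullSnd t (freeData t φ) = symbol (freeData 0 φ).snd := by
  have h : ∀ τ, HasDerivAt (fun τ => pullFst τ (freeData τ φ)) 0 τ ∧
      HasDerivAt (fun τ => pullSnd τ (freeData τ φ)) 0 τ := fun τ => by
    have h0 : IsWeakSolution (s := s) Set.univ φ.1 (0 : ℝ → Sobolev n m s) := φ.2.2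
    have h := h0.hasDerivAt_pull isOpen_univ φ.2.1 continuous_zero.continuousOn (Set.mem_univ τ)
    rwa [Pi.zero_apply, map_zero, map_zero, map_zero, neg_zero] at h
  rw [← pullFst_zero, ← pullSnd_zero]
  exact ⟨is_const_of_deriv_eq_zero (fun τ => (h τ).1.differentiableAt) (fun τ => (h τ).1.deriv) t 0,
    is_const_of_deriv_eq_zero (fun τ => (h τ).2.differentiableAt) (fun τ => (h τ).2.deriv) t 0⟩

/-- The norm of the Cauchy data of a free solution does not depend on the time. -/
theorem norm_freeData (t : ℝ) (φ : Free n m s) : ‖freeData t φ‖ = ‖φ‖ := by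
  have h : ‖freeData t φ‖ ^ 2 = ‖freeData 0 φ‖ ^ 2 := by
    rw [← norm_sq_pull t, (pull_freeData t φ).1, (pull_freeData t φ).2, ← pullFst_zero,
      ← pullSnd_zero, norm_sq_pull]
  exact (sq_eq_sq₀ (norm_nonneg _) (norm_nonneg _)).mp h

/-- The seminorm sees the data at time 0 only; conservation makes the data vanish at every time, so
the solution is zero as a curve. -/
theorem Free.eq_zero_of_norm {φ : Free n m s} (h : ‖φ‖ = 0) : φ = 0 := by
  refine Subtype.ext (funext fun t => ?_)
  have h1 : freeData t φ = 0 := norm_eq_zero.mp ((norm_freeData t φ).trans h)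
  rw [← freeData_fst, h1]
  rfl

noncomputable instance : NormedAddCommGroup (Free n m s) :=
  NormedAddCommGroup.ofSeparation fun _ => Free.eq_zero_of_norm

theorem freeData_injective (t : ℝ) : Function.Injective (freeData (n := n) (m := m) (s := s) t) :=
  (injective_iff_map_eq_zero _).mpr fun φ h =>
    Free.eq_zero_of_norm (by rw [← norm_freeData t, h, norm_zero])

theorem exists_symbol_eq_add (s' : ℝ) {c d : Space n →ᵇ ℂ}
    (hc : (c : Space n → ℂ).HasTemperateGrowth) (hcr : ∀ ξ, (c ξ).im = 0)
    (hce : ∀ ξ, c (-ξ) = c ξ) (hd : (d : Space n → ℂ).HasTemperateGrowth)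
    (hdr : ∀ ξ, (d ξ).im = 0) (hde : ∀ ξ, d (-ξ) = d ξ) (Φ : Data n m s) :
    ∃ T : Sobolev n m s', symbol T = mulOp c (symbol Φ.fst) + mulOp d (symbol Φ.snd) := by
  obtain ⟨T, hT⟩ := exists_symbol_eq_mulOp s' hc hcr hce Φ.fst
  obtain ⟨T', hT'⟩ := exists_symbol_eq_mulOp s' hd hdr hde Φ.snd
  exact ⟨T + T', by rw [map_add, hT, hT']⟩

theorem cosE_neg_apply (t : ℝ) (ξ : Space n) : cosE n m t (-ξ) = cosE n m t ξ := by
  simp [cosE_apply, dispersion]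

theorem sinE_neg_apply (t : ℝ) (ξ : Space n) : sinE n m t (-ξ) = sinE n m t ξ := by
  simp [sinE_apply, dispersion]

theorem hasDerivAt_mulOp_cosE_invE (f : L2 n) (t : ℝ) :
    HasDerivAt (fun t => mulOp (invE n m) (mulOp (cosE n m t) f)) (-mulOp (sinE n m t) f) t := by
  refine hasDerivAt_of_mulOp (invE_ne_zero n m) isOpen_univ
    (continuous_mulOp_sinE f).neg.continuousOn (fun t _ => ?_) (Set.mem_univ t)
  have h := (mulOp.hasFDerivAt.comp_hasDerivAt t (hasDerivAt_invE_sq_mul_cosE n m t)).clm_apply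
    (hasDerivAt_const t f)
  simpa [← mulOp_mul, mul_assoc] using h

theorem hasDerivAt_mulOp_sinE_invE (f : L2 n) (t : ℝ) :
    HasDerivAt (fun t => mulOp (invE n m) (mulOp (sinE n m t) f)) (mulOp (cosE n m t) f) t := by
  refine hasDerivAt_of_mulOp (invE_ne_zero n m) isOpen_univ
    (continuous_mulOp_cosE f).continuousOn (fun t _ => ?_) (Set.mem_univ t)
  have h := (mulOp.hasFDerivAt.comp_hasDerivAt t (hasDerivAt_invE_sq_mul_sinE n m t)).clm_apply
    (hasDerivAt_const t f)
  simpa [← mulOp_mul, mul_assoc] using h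

/-- A curve that satisfies the Klein-Gordon equation in frequency space is a free solution. -/
theorem mem_freeSubmodule_of_symbol {φ : ℝ → Sobolev n m (s + 1)} {φ' : ℝ → Sobolev n m s}
    (hc : Continuous fun t => symbol (φ t)) (hc' : Continuous fun t => symbol (φ' t))
    (h : ∀ t, HasDerivAt (fun t => mulOp (invE n m) (symbol (φ t))) (symbol (φ' t)) t)
    (h' : ∀ t, HasDerivAt (fun t => mulOp (invE n m) (symbol (φ' t))) (-symbol (φ t)) t) :
    φ ∈ freeSubmodule n m s ∧ timeDeriv φ = φ' := by
  have cφ : Continuous φ := isometry_symbol.isEmbedding.continuous_iff.mpr hc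
  have cφ' : Continuous φ' := isometry_symbol.isEmbedding.continuous_iff.mpr hc'
  have hd : ∀ t, HasDerivAt (fun t => (incl (φ t) : Sobolev n m s)) (φ' t) t := fun t => by
    rw [hasDerivAt_iff_symbol]
    simpa only [symbol_incl] using h t
  have hde : timeDeriv φ = φ' := funext fun t => (hd t).deriv
  refine ⟨⟨⟨cφ.continuousOn, ?_⟩, fun χ ψ hχ hχc hχs hψ => ?_⟩, hde⟩
  · rw [contDiffOn_univ, contDiff_one_iff_deriv]
    exact ⟨fun t => (hd t).differentiableAt, by rwa [show deriv _ = φ' from hde]⟩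
  · have hT : IsTestOn Set.univ χ := ⟨hχ, hχc, hχs⟩
    let P := pairing (testFreq (n := n) m s ψ)
    have d1 : ∀ t ∈ Set.univ, HasDerivAt (fun t => P (mulOp (invE n m) (mulOp (invE n m)
        (symbol (φ t))))) (P (mulOp (invE n m) (symbol (φ' t)))) t := fun t _ =>
      P.hasFDerivAt.comp_hasDerivAt t ((mulOp (invE n m)).hasFDerivAt.comp_hasDerivAt t (h t))
    have d2 : ∀ t ∈ Set.univ, HasDerivAt (fun t => P (mulOp (invE n m) (symbol (φ' t))))
        (P (-symbol (φ t))) t := fun t _ => P.hasFDerivAt.comp_hasDerivAt t (h' t)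
    have c1 : Continuous fun t => P (mulOp (invE n m) (symbol (φ' t))) :=
      P.continuous.comp ((mulOp (invE n m)).continuous.comp hc')
    have c2 : Continuous fun t => P (-symbol (φ t)) := P.continuous.comp hc.neg
    have c0 : Continuous fun t => P (mulOp (invE n m) (mulOp (invE n m) (symbol (φ t)))) :=
      P.continuous.comp ((mulOp (invE n m)).continuous.comp ((mulOp (invE n m)).continuous.comp hc))
    have e1 := hT.deriv.integral_deriv_smul_add isOpen_univ d1 c1.continuousOn
    have e2 := hT.integral_deriv_smul_add isOpen_univ d2 c2.continuousOn
    have i0 := hT.deriv.deriv.integrable_smul isOpen_univ c0.continuousOn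
    have i1 := hT.deriv.integrable_smul isOpen_univ c1.continuousOn
    have i2 := hT.integrable_smul isOpen_univ c2.continuousOn
    rw [integral_add i0 i1] at e1
    rw [integral_add i1 i2] at e2
    have e3 : ∀ t, ((deriv (deriv χ) t : ℝ) : ℂ) * toDist (φ t) ψ +
        (χ t : ℂ) * ((m : ℂ) ^ 2 * toDist (φ t) ψ - toDist (φ t) (Δ ψ) +
          toDist ((0 : ℝ → Sobolev n m s) t) ψ) =
        deriv (deriv χ) t • P (mulOp (invE n m) (mulOp (invE n m) (symbol (φ t)))) -
          χ t • P (-symbol (φ t)) := fun t => by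
      rw [toDist_laplacian_eq_pairing, toDist_succ_apply_eq_pairing, map_neg, Complex.real_smul,
        Complex.real_smul, Pi.zero_apply, map_zero, zero_apply]
      ring
    simp only [e3]
    rw [integral_sub i0 i2]
    linear_combination e1 - e2

/-- The explicit solution with multipliers cos((t-t₀)ε) and sin((t-t₀)ε). The usual factors 1/ε and
ε in front of the sine are absorbed by the different weights of the two components, so the matrix is
a pure rotation. -/
theorem freeData_surjective (t₀ : ℝ) :
    Function.Surjective (freeData (n := n) (m := m) (s := s) t₀) := by
  intro Φ
  have hC := fun t => cosE_temperate n m t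
  have hS := fun t => sinE_temperate n m t
  choose φ hφ using fun t => exists_symbol_eq_add (s + 1) (hC (t - t₀))
    (fun ξ => Complex.ofReal_im _) (cosE_neg_apply _) (hS (t - t₀))
    (fun ξ => Complex.ofReal_im _) (sinE_neg_apply _) Φ
  choose φ' hφ' using fun t => exists_symbol_eq_add s (c := -sinE n m (t - t₀)) (hS (t - t₀)).neg
    (fun ξ => by
      rw [BoundedContinuousFunction.neg_apply, sinE_apply, Complex.neg_im, Complex.ofReal_im, neg_zero]) (fun ξ => congrArg Neg.neg (sinE_neg_apply _ ξ)) (hC (t - t₀))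
    (fun ξ => Complex.ofReal_im _) (cosE_neg_apply _) Φ
  have g1 : Continuous fun t => symbol (φ t) := by
    simp only [hφ]
    exact ((continuous_mulOp_cosE _).comp (continuous_sub_right t₀)).add
      ((continuous_mulOp_sinE _).comp (continuous_sub_right t₀))
  have g2 : Continuous fun t => symbol (φ' t) := by
    simp only [hφ', map_neg, neg_apply]
    exact ((continuous_mulOp_sinE _).comp (continuous_sub_right t₀)).neg.add
      ((continuous_mulOp_cosE _).comp (continuous_sub_right t₀))
  obtain ⟨h1, h2⟩ := mem_freeSubmodule_of_symbol g1 g2 (fun t => by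
    simp only [hφ, hφ', map_add, map_neg, neg_apply]
    exact ((hasDerivAt_mulOp_cosE_invE _ (t - t₀)).comp_sub_const t t₀).add
      ((hasDerivAt_mulOp_sinE_invE _ (t - t₀)).comp_sub_const t t₀)) fun t => by
    simp only [hφ, hφ', map_add, map_neg, neg_apply, neg_add]
    exact ((hasDerivAt_mulOp_sinE_invE _ (t - t₀)).comp_sub_const t t₀).neg.add
      ((hasDerivAt_mulOp_cosE_invE _ (t - t₀)).comp_sub_const t t₀)
  refine ⟨(⟨φ, h1⟩ : freeSubmodule n m s), ?_⟩
  have e1 : φ t₀ = Φ.fst := by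
    apply symbol_injective n hm.out
    rw [hφ, sub_self, cosE_zero, sinE_zero, mulOp_one, map_zero, zero_apply, add_zero]
  have e2 : φ' t₀ = Φ.snd := by
    apply symbol_injective n hm.out
    rw [hφ', sub_self, cosE_zero, sinE_zero, mulOp_one, neg_zero, map_zero, zero_apply, zero_add]
  change WithLp.toLp 2 (φ t₀, timeDeriv φ t₀) = Φ
  rw [h2, e1, e2]
  rfl

/-- The isometry of `𝓔₀^(s+1)` with the space of Cauchy data at time `t`. -/
noncomputable def freeIso (t : ℝ) : Free n m s ≃ₗᵢ[ℝ] Data n m s where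
  toLinearEquiv := LinearEquiv.ofBijective (freeData t) ⟨freeData_injective t, freeData_surjective t⟩
  norm_map' := norm_freeData t

theorem freeIso_apply (t : ℝ) (φ : Free n m s) : freeIso t φ = freeData t φ := rfl

/-- Surjectivity makes the `Function.invFun` in the definition a genuine inverse. -/
theorem freeSolution_eq (t : ℝ) (Φ : Data n m s) : freeSolution t Φ = (freeIso t).symm Φ := by
  apply (freeIso t).injective
  rw [LinearIsometryEquiv.apply_symm_apply]
  exact Function.invFun_eq (freeData_surjective t Φ)

theorem norm_freeSolution (t : ℝ) (Φ : Data n m s) : ‖freeSolution t Φ‖ = ‖Φ‖ := by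
  rw [freeSolution_eq, LinearIsometryEquiv.norm_map]

theorem freeData_freeSolution (t : ℝ) (Φ : Data n m s) : freeData t (freeSolution t Φ) = Φ := by
  rw [freeSolution_eq, ← freeIso_apply, LinearIsometryEquiv.apply_symm_apply]

theorem continuous_freeData (φ : Free n m s) : Continuous fun t => freeData t φ := by
  have h1 := continuousOn_univ.mp φ.2.1.1
  have h2 := continuousOn_univ.mp (φ.2.1.continuousOn_timeDeriv isOpen_univ)
  exact (WithLp.prod_continuous_toLp 2 _ _).comp (h1.prodMk h2)

/-- The norm may be measured on the Cauchy data at time t. There the difference becomes Φ(t) minus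
the data of one fixed free solution, which are continuous in t. -/
theorem continuousOn_freeSolution {K : Set ℝ} {Φ : ℝ → Data n m s} (hΦ : ContinuousOn Φ K) :
    ContinuousOn (fun t => freeSolution t (Φ t)) K := by
  intro t₀ ht₀
  rw [ContinuousWithinAt, tendsto_iff_norm_sub_tendsto_zero]
  have e : ∀ t, ‖freeSolution t (Φ t) - freeSolution t₀ (Φ t₀)‖ =
      ‖Φ t - freeData t (freeSolution t₀ (Φ t₀))‖ := fun t => by
    rw [← norm_freeData t, map_sub, freeData_freeSolution]
  simp only [e]
  have h : Tendsto (fun t => ‖Φ t - freeData t (freeSolution t₀ (Φ t₀))‖) (𝓝[K] t₀)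
      (𝓝 ‖Φ t₀ - freeData t₀ (freeSolution t₀ (Φ t₀))‖) := ((hΦ t₀ ht₀).sub (((continuous_freeData (freeSolution t₀ (Φ t₀))).tendsto t₀).mono_left
    nhdsWithin_le_nhds)).norm
  rwa [freeData_freeSolution, sub_self, norm_zero] at h

end FreeSpace

/-! ### The curve of free solutions tangent to a solution, and the field of the nonlinearity -/

section Interaction

variable {n : ℕ} {m s : ℝ} [hm : Fact (0 < m)]

/-- The free solution whose Cauchy data at time `t` are `(0, v)`, as a linear map of `v`. -/
noncomputable def freeOfVelocity (t : ℝ) : Sobolev n m s →L[ℝ] Free n m s :=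
  (freeIso (n := n) (m := m) (s := s) t).symm.toLinearIsometry.toContinuousLinearMap ∘L
    ((WithLp.prodContinuousLinearEquiv 2 ℝ (Sobolev n m (s + 1)) (Sobolev n m s)).symm :
      _ →L[ℝ] Data n m s) ∘L ContinuousLinearMap.inr ℝ (Sobolev n m (s + 1)) (Sobolev n m s)

theorem freeOfVelocity_eq (t : ℝ) (v : Sobolev n m s) :
    freeOfVelocity t v = freeSolution t (WithLp.toLp 2 (0, v)) :=
  (freeSolution_eq t _).symm

theorem sharp_eq (t : ℝ) (v : Sobolev n m s) : sharp t v = -freeOfVelocity t v := by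
  rw [sharp, ← freeOfVelocity_eq, map_neg]

theorem norm_freeOfVelocity (t : ℝ) (v : Sobolev n m s) : ‖freeOfVelocity t v‖ = ‖v‖ := by
  rw [freeOfVelocity_eq, norm_freeSolution]
  exact WithLp.norm_toLp_snd 2 _ _ v

/-- The curve of free solutions that have the Cauchy data of `u` at time `t`. -/
noncomputable def tangentSolution (u : ℝ → Sobolev n m (s + 1)) (t : ℝ) : Free n m s :=
  freeSolution t (cauchyData u t)

variable {u : ℝ → Sobolev n m (s + 1)} {K : Set ℝ}

theorem TimeRegular.continuousOn_cauchyData (hK : IsOpen K) (hu : TimeRegular (s := s) K u) :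
    ContinuousOn (cauchyData (s := s) u) K :=
  (WithLp.prod_continuous_toLp 2 _ _).comp_continuousOn
    (hu.1.prodMk (hu.continuousOn_timeDeriv hK))

theorem TimeRegular.continuousOn_cauchySize (hK : IsOpen K) (hu : TimeRegular (s := s) K u) :
    ContinuousOn (cauchySize (s := s) u) K :=
  hu.1.norm.add (hu.continuousOn_timeDeriv hK).norm

theorem norm_cauchyData_le (u : ℝ → Sobolev n m (s + 1)) (t : ℝ) :
    ‖cauchyData (s := s) u t‖ ≤ cauchySize (s := s) u t := by
  have h := WithLp.prod_norm_sq_eq_of_L2 (cauchyData (s := s) u t)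
  have h0 : 0 ≤ ‖u t‖ := norm_nonneg _
  have h1 : 0 ≤ ‖timeDeriv (s := s) u t‖ := norm_nonneg _
  change _ = ‖u t‖ ^ 2 + ‖timeDeriv (s := s) u t‖ ^ 2 at h
  refine abs_le_of_sq_le_sq' ?_ (add_nonneg h0 h1) |>.2
  rw [h]
  nlinarith

theorem norm_tangentSolution_le (u : ℝ → Sobolev n m (s + 1)) (t : ℝ) :
    ‖tangentSolution (s := s) u t‖ ≤ cauchySize (s := s) u t :=
  (norm_freeSolution t _).trans_le (norm_cauchyData_le u t)

theorem TimeRegular.continuousOn_tangentSolution (hK : IsOpen K)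
    (hu : TimeRegular (s := s) K u) : ContinuousOn (tangentSolution (s := s) u) K :=
  continuousOn_freeSolution (hu.continuousOn_cauchyData hK)

theorem symbol_freeData_zero (t : ℝ) (Φ : Data n m s) :
    symbol (freeData 0 (freeSolution t Φ)).fst = pullFst t Φ ∧
      symbol (freeData 0 (freeSolution t Φ)).snd = pullSnd t Φ := by
  have h := pull_freeData t (freeSolution t Φ)
  rw [freeData_freeSolution] at h
  exact ⟨h.1.symm, h.2.symm⟩

/-- Along a solution of the Klein-Gordon equation with source `j`, the tangent free solution moves
with the velocity `-freeOfVelocity t (j t)`. -/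
theorem IsWeakSolution.hasDerivAt_tangentSolution {j : ℝ → Sobolev n m s} (hK : IsOpen K)
    (hu : TimeRegular (s := s) K u) (hj : ContinuousOn j K) (h : IsWeakSolution K u j) {t : ℝ}
    (ht : t ∈ K) :
    HasDerivAt (tangentSolution (s := s) u) (-freeOfVelocity t (j t)) t := by
  obtain ⟨h1, h2⟩ := h.hasDerivAt_pull hK hu hj ht
  have e := symbol_freeData_zero t (WithLp.toLp 2 (0, j t) : Data n m s)
  have e1 : pullFst t (WithLp.toLp 2 (0, j t) : Data n m s) =
      -mulOp (sinE n m t) (symbol (j t)) := by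
    change mulOp (cosE n m t) (symbol (0 : Sobolev n m (s + 1))) - _ = _
    rw [map_zero, map_zero, zero_sub]
    rfl
  have e2 : pullSnd t (WithLp.toLp 2 (0, j t) : Data n m s) =
      mulOp (cosE n m t) (symbol (j t)) := by
    change _ + mulOp (sinE n m t) (symbol (0 : Sobolev n m (s + 1))) = _
    rw [map_zero, map_zero, add_zero]
    rfl
  rw [e1, e2] at e
  have d1 : HasDerivAt (fun τ => (freeData 0 (tangentSolution (s := s) u τ)).fst)
      (freeData 0 (-freeOfVelocity t (j t))).fst t := by
    rw [hasDerivAt_iff_symbol, map_neg, WithLp.neg_fst, map_neg, freeOfVelocity_eq, e.1, neg_neg]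
    simpa only [tangentSolution, symbol_freeData_zero] using h1
  have d2 : HasDerivAt (fun τ => (freeData 0 (tangentSolution (s := s) u τ)).snd)
      (freeData 0 (-freeOfVelocity t (j t))).snd t := by
    rw [hasDerivAt_iff_symbol, map_neg, WithLp.neg_snd, map_neg, freeOfVelocity_eq, e.2]
    simpa only [tangentSolution, symbol_freeData_zero] using h2
  -- A free solution is a continuous linear function of its two data at time 0, so it is enough to
  -- differentiate these.
  let L : Sobolev n m (s + 1) × Sobolev n m s →L[ℝ] Free n m s :=
    (freeIso (n := n) (m := m) (s := s) 0).symm.toLinearIsometry.toContinuousLinearMap ∘L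
      ((WithLp.prodContinuousLinearEquiv 2 ℝ (Sobolev n m (s + 1)) (Sobolev n m s)).symm :
        _ →L[ℝ] Data n m s)
  have hL : ∀ φ : Free n m s, L ((freeData 0 φ).fst, (freeData 0 φ).snd) = φ := fun φ =>
    (freeIso 0).symm_apply_apply φ
  have d3 := L.hasFDerivAt.comp_hasDerivAt t (d1.prodMk d2)
  rw [hL] at d3
  refine d3.congr_of_eventuallyEq (Eventually.of_forall fun τ => ?_)
  exact (hL _).symm

/-- The field `φ ↦ -𝒱([φ]_t) ♯_t G` on `𝓔₀^(s+1)`. -/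
noncomputable def interaction (V : FormalMultilinearSeries ℝ (Data n m s) (Sobolev n m s)) (t : ℝ) :
    FormalMultilinearSeries ℝ (Free n m s) (Free n m s) := fun q =>
  (freeOfVelocity t).compContinuousMultilinearMap
    ((V q).compContinuousLinearMap fun _ =>
      (freeIso (n := n) (m := m) (s := s) t).toLinearIsometry.toContinuousLinearMap)

variable (V : FormalMultilinearSeries ℝ (Data n m s) (Sobolev n m s))

theorem interaction_apply (t : ℝ) (q : ℕ) (φ : Fin q → Free n m s) :
    interaction V t q φ = freeOfVelocity t (V q fun i => freeData t (φ i)) := rfl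

theorem norm_interaction_le (t : ℝ) (q : ℕ) : ‖interaction V t q‖ ≤ ‖V q‖ := by
  refine ContinuousMultilinearMap.opNorm_le_bound (norm_nonneg _) fun φ => ?_
  rw [interaction_apply, norm_freeOfVelocity]
  refine ((V q).le_opNorm _).trans (le_of_eq ?_)
  simp only [norm_freeData]

theorem continuous_interaction (q : ℕ) (φ : Fin q → Free n m s) :
    Continuous fun t => interaction V t q φ := by
  simp only [interaction_apply, freeOfVelocity_eq]
  rw [← continuousOn_univ]
  refine continuousOn_freeSolution (Continuous.continuousOn ?_)
  refine (WithLp.prod_continuous_toLp 2 _ _).comp (continuous_const.prodMk ?_)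
  exact (V q).cont.comp (continuous_pi fun i => continuous_freeData (φ i))

/-- The defining conditions of the `Classical.epsilon` in `opD` fix a symmetric form by its
diagonal, so it is unique, and minus the derivation satisfies them. The sign of 𝔻 cancels the one in
♯. -/
theorem opD_eq (t : ℝ) (f : Series n m s) : opD V t f = alongField (interaction V t) f := by
  funext k
  set P : (Free n m s [×k]→L[ℝ] ℝ) → Prop := fun g =>
    (∀ (σ : Equiv.Perm (Fin k)) (φ : Fin k → Free n m s), g (φ ∘ σ) = g φ) ∧
    ∀ φ : Free n m s, g (fun _ => φ) = ∑ qj ∈ Finset.HasAntidiagonal.antidiagonal k, ((qj.2 : ℝ) + 1) *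
      f (qj.2 + 1) (Fin.cons (sharp t (V qj.1 fun _ => freeData t φ)) fun _ => φ)
  have h0 : P (-alongField (interaction V t) f k) := by
    refine ⟨fun σ φ => ?_, fun φ => ?_⟩
    · rw [neg_apply, neg_apply,
        alongField_comp_perm]
    · rw [neg_apply, alongField_diagonal, ← Finset.sum_neg_distrib]
      refine Finset.sum_congr rfl fun qj _ => ?_
      rw [sharp_eq, smul_eq_mul, ← mul_neg]
      congr 1
      have h := (f (qj.2 + 1)).toMultilinearMap.cons_smul (fun _ => φ) (-1)
        (interaction V t qj.1 fun _ => φ)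
      rw [neg_one_smul, neg_one_smul] at h
      exact h.symm
  have h1 : P (Classical.epsilon P) := Classical.epsilon_spec ⟨_, h0⟩
  have h2 := eq_of_symmetric_of_diagonal_eq h1.1 h0.1 fun φ => (h1.2 φ).trans (h0.2 φ).symm
  change -Classical.epsilon P = _
  rw [h2, neg_neg]

theorem hasSum_interaction (hV : ENNReal.ofReal (cauchySize (s := s) u t) < V.radius) :
    HasSum (fun q => interaction V t q fun _ => tangentSolution (s := s) u t)
      (freeOfVelocity t (V.sum (cauchyData u t))) := by
  have h : HasSum (fun q => V q fun _ => cauchyData (s := s) u t) (V.sum (cauchyData u t)) := by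
    refine V.hasSum ?_
    rw [Metric.mem_eball, edist_zero_right, ← ofReal_norm]
    exact (ENNReal.ofReal_le_ofReal (norm_cauchyData_le u t)).trans_lt hV
  have := h.mapL (freeOfVelocity t)
  simpa only [interaction_apply, tangentSolution, freeData_freeSolution] using this

theorem continuousOn_sum (hK : IsOpen K) (hu : TimeRegular (s := s) K u)
    (hV : ∀ t ∈ K, ENNReal.ofReal (cauchySize (s := s) u t) < V.radius) :
    ContinuousOn (fun t => V.sum (cauchyData (s := s) u t)) K := by
  rcases eq_zero_or_pos V.radius with h0 | h0
  · intro t ht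
    exact absurd (hV t ht) (by simp [h0])
  · refine (V.hasFPowerSeriesOnBall h0).continuousOn.comp (hu.continuousOn_cauchyData hK)
      fun t ht => ?_
    rw [Metric.mem_eball, edist_zero_right, ← ofReal_norm]
    exact (ENNReal.ofReal_le_ofReal (norm_cauchyData_le u t)).trans_lt (hV t ht)

end Interaction

/-! ### Convergence of the exponentials and conservation -/

section Conservation

variable {n : ℕ} {m s : ℝ} [hm : Fact (0 < m)]
  {V : FormalMultilinearSeries ℝ (Data n m s) (Sobolev n m s)} {u : ℝ → Sobolev n m (s + 1)}
  {f : Series n m s} {r T t : ℝ} {Γ : ℝ → ℝ}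

theorem cauchySize_nonneg (u : ℝ → Sobolev n m (s + 1)) (t : ℝ) : 0 ≤ cauchySize (s := s) u t :=
  add_nonneg (norm_nonneg _) (norm_nonneg _)

theorem radiusAt_eq (hr : ENNReal.ofReal r < V.radius)
    (hΓ : IsTrajectory (fun y => -powSum (fun q => ‖V q‖) y) V.radius |t| r Γ) :
    radiusAt V r t = Γ |t| := by
  have h := flow_eq_of_isTrajectory (powSummable_norm V) hr (abs_nonneg t) hΓ
  change (flow (fun y => -powSum (fun q => ‖V q‖) y) V.radius |t| r).toReal = _
  rw [h, ENNReal.toReal_ofReal (hΓ.2 |t| ⟨abs_nonneg t, le_rfl⟩).1]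

/-- Run backwards, Γ is a trajectory of X from Γ(T) to r in time T, and Σ‖f_p‖z^p converges at its
end point z = r because f is in 𝔽_r. -/
theorem summable_iteratedBound (hr : 0 < r) (hf : f ∈ Fock n m s r) (hT : 0 ≤ T)
    (hΓ : IsTrajectory (fun y => -powSum (fun q => ‖V q‖) y) V.radius T r Γ) :
    Summable fun kp : ℕ × ℕ => iteratedBound f (fun q => ‖V q‖) T kp.1 kp.2 * Γ T ^ kp.2 := by
  have h := hΓ.reverse
  have hs := summable_iterate_fieldDeriv (powSummable_norm V) hT h.2 (b := fun p => ‖f p‖)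
    (fun p => norm_nonneg _) (by
      simp only [sub_self, hΓ.1]
      exact summable_of_fockNorm_lt_top hr.le hf.2)
  simp only [sub_zero] at hs
  exact hs

/-- The time ordered exponential converges in `𝔽_ρ`. -/
theorem exists_hasTimeOrderedExp {ρ : ℝ} (hρ : 0 < ρ) (hf : IsSymmetric f)
    (hs : Summable fun kp : ℕ × ℕ =>
      iteratedBound f (fun q => ‖V q‖) |t| kp.1 kp.2 * ρ ^ kp.2) :
    ∃ g ∈ Fock n m s ρ, HasTimeOrderedExp (opD V) t ρ f g ∧
      ∀ p, HasSum (fun k => iteratedIntegral (interaction V) f k t p) (g p) := by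
  have hw := norm_interaction_le V
  have hW := continuous_interaction V
  have hs' : Summable fun kp : ℕ × ℕ =>
      ‖iteratedIntegral (interaction V) f kp.1 t kp.2‖ * ρ ^ kp.2 := by
    refine hs.of_nonneg_of_le (fun kp => by positivity) fun kp => ?_
    gcongr
    exact norm_iteratedIntegral_le hw hW le_rfl _ _
  obtain ⟨g, hg, hsum⟩ := exists_hasSum_fock hρ
    (fun k => isSymmetric_iteratedIntegral hw hW hf k t) hs'
  refine ⟨g, hg, ⟨iteratedIntegral (interaction V) f, ⟨fun _ => rfl, fun k t p φ => ?_,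
    fun k t p φ => ?_⟩, ?_, hsum⟩, hsum⟩
  · simp only [opD_eq]
    exact (continuous_alongField_iteratedIntegral hw hW k p φ).intervalIntegrable _ _
  · simp only [opD_eq]
    exact iteratedIntegral_succ_apply hw hW k p φ t
  · exact tsum_fockNorm_lt_top_of_summable hs'

theorem hasSum_multilinear_apply {E : Type*} [NormedAddCommGroup E] [NormedSpace ℝ E] {p : ℕ}
    {G : ℕ → E [×p]→L[ℝ] ℝ} {g : E [×p]→L[ℝ] ℝ} (h : HasSum G g) (φ : Fin p → E) :
    HasSum (fun k => G k φ) (g φ) :=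
  h.mapL (ContinuousMultilinearMap.apply ℝ (fun _ : Fin p => E) ℝ φ)

theorem summable_iteratedIntegral_apply {E : Type*} [NormedAddCommGroup E] [NormedSpace ℝ E]
    {W : ℝ → FormalMultilinearSeries ℝ E E} {f : FormalMultilinearSeries ℝ E ℝ} {w : ℕ → ℝ}
    (hw : ∀ τ q, ‖W τ q‖ ≤ w q) (hW : ∀ q φ, Continuous fun τ => W τ q φ) {t ρ : ℝ} {ψ : E}
    (hψ : ‖ψ‖ ≤ ρ) (hs : Summable fun kp : ℕ × ℕ => iteratedBound f w |t| kp.1 kp.2 * ρ ^ kp.2) :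
    Summable fun kp : ℕ × ℕ => iteratedIntegral W f kp.1 t kp.2 fun _ => ψ := by
  refine Summable.of_norm_bounded hs fun kp => (norm_apply_const_le _ _).trans ?_
  have h1 := norm_iteratedIntegral_le (f := f) hw hW (le_refl |t|) kp.1 kp.2
  exact mul_le_mul h1 (pow_le_pow_left₀ (norm_nonneg _) hψ _) (by positivity)
    ((norm_nonneg _).trans h1)

theorem tsum_eq_tsum_of_hasSum_fst {F : ℕ × ℕ → ℝ} {a : ℕ → ℝ} (hF : Summable F)
    (ha : ∀ p, HasSum (fun k => F (k, p)) (a p)) : ∑' kp, F kp = ∑' p, a p := by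
  have h := hF.prod_symm.hasSum.prod_fiberwise ha
  rw [h.tsum_eq]
  exact ((Equiv.prodComm ℕ ℕ).tsum_eq F).symm

theorem orderedExpAt_eq_tsum {E : Type*} [NormedAddCommGroup E] [NormedSpace ℝ E]
    {W : ℝ → FormalMultilinearSeries ℝ E E} {f g : FormalMultilinearSeries ℝ E ℝ} {w : ℕ → ℝ}
    (hw : ∀ τ q, ‖W τ q‖ ≤ w q) (hW : ∀ q φ, Continuous fun τ => W τ q φ) {t ρ : ℝ} {ψ : ℝ → E}
    (hψ : ‖ψ t‖ ≤ ρ)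
    (hs : Summable fun kp : ℕ × ℕ => iteratedBound f w |t| kp.1 kp.2 * ρ ^ kp.2)
    (hg : ∀ p, HasSum (fun k => iteratedIntegral W f k t p) (g p)) :
    orderedExpAt W f ψ t = ∑' p, g p fun _ => ψ t := by
  have hs' := summable_iteratedIntegral_apply hw hW hψ hs
  exact tsum_eq_tsum_of_hasSum_fst hs' fun p => hasSum_multilinear_apply (hg p) fun _ => ψ t

/-- The norm of the tangent solution is at most ‖[u]_t‖ < ρ, so the translation by it converges;
interchanging the sums over k and p identifies its vacuum value with the double series. -/
theorem isAlpha_orderedExpAt {ρ : ℝ} (hρ : cauchySize (s := s) u t < ρ) (hf : IsSymmetric f)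
    (hs : Summable fun kp : ℕ × ℕ =>
      iteratedBound f (fun q => ‖V q‖) |t| kp.1 kp.2 * ρ ^ kp.2) :
    IsAlpha V u ρ t f (orderedExpAt (interaction V) f (tangentSolution (s := s) u) t) := by
  have hψ := norm_tangentSolution_le (s := s) u t
  obtain ⟨g, hg, hgT, hsum⟩ :=
    exists_hasTimeOrderedExp ((cauchySize_nonneg u t).trans_lt hρ) hf hs
  obtain ⟨h, hh, hE⟩ := exists_hasExp_delta hψ hρ hg
  exact ⟨g, hg, hgT, h, hh, hE, (orderedExpAt_eq_tsum (norm_interaction_le V)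
    (continuous_interaction V) (hψ.trans hρ.le) hs hsum).trans hE.vacuum_eq.symm⟩

theorem exists_trajectory_of_iSup_lt {J : Set ℝ} (hr : ENNReal.ofReal r < V.radius)
    (hsup : (⨆ t ∈ J, flow (majorant V) V.radius |t| (cauchySize (s := s) u t)) < ENNReal.ofReal r)
    (ht : t ∈ J) : ∃ T > |t|, ∃ Γ : ℝ → ℝ,
      IsTrajectory (fun y => -powSum (fun q => ‖V q‖) y) V.radius T r Γ ∧
        cauchySize (s := s) u t < Γ T := by
  obtain ⟨γ, hγ, hγr⟩ := exists_isTrajectory_of_flow_lt (abs_nonneg t)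
    ((le_iSup₂ (f := fun t _ => flow (majorant V) V.radius |t| (cauchySize (s := s) u t))
      t ht).trans_lt hsup)
  exact exists_backward_trajectory (powSummable_norm V) hr (abs_nonneg t) hγ hγr

omit hm in
theorem IsWeakSolution.mono {K K' : Set ℝ} {j : ℝ → Sobolev n m s} (h : IsWeakSolution K u j)
    (hK : K' ⊆ K) : IsWeakSolution K' u j :=
  fun χ ψ hχ hc hs hψ => h χ ψ hχ hc (hs.trans hK) hψ

theorem TimeRegular.mono {K K' : Set ℝ} (h : TimeRegular (s := s) K u) (hK : K' ⊆ K) :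
    TimeRegular (s := s) K' u :=
  ⟨h.1.mono hK, h.2.mono hK⟩

/-- Bounds that hold uniformly near a given time. -/
theorem exists_nhds_bounds {I J : Set ℝ} (hI : IsOpen I) (hu : TimeRegular (s := s) I u)
    (hJI : J ⊆ I) (hr : 0 < r) (hr' : ENNReal.ofReal r < V.radius)
    (hsup : (⨆ t ∈ J, flow (majorant V) V.radius |t| (cauchySize (s := s) u t)) < ENNReal.ofReal r)
    (hf : f ∈ Fock n m s r) (ht : t ∈ J) :
    ∃ T z ρ : ℝ, ∃ N : Set ℝ, IsOpen N ∧ t ∈ N ∧ N ⊆ I ∧ 0 ≤ z ∧ z < ρ ∧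
      ENNReal.ofReal ρ < V.radius ∧ (∀ τ ∈ N, |τ| ≤ T) ∧ (∀ τ ∈ N, cauchySize (s := s) u τ ≤ z) ∧
      Summable fun kp : ℕ × ℕ => iteratedBound f (fun q => ‖V q‖) T kp.1 kp.2 * ρ ^ kp.2 := by
  obtain ⟨T, hT, Γ, hΓ, hlt⟩ := exists_trajectory_of_iSup_lt hr' hsup ht
  have hT0 : 0 ≤ T := (abs_nonneg t).trans hT.le
  have h0 := cauchySize_nonneg (s := s) u t
  -- The midpoint between ‖[u]_t‖ and Γ(T) leaves room on both sides: the size of u stays below it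
  -- near t, and it is still below the radius ρ = Γ(T), valid for all times up to T > |t|.
  have hz : cauchySize (s := s) u t < (cauchySize (s := s) u t + Γ T) / 2 := by linarith
  refine ⟨T, (cauchySize (s := s) u t + Γ T) / 2, Γ T,
    (I ∩ cauchySize (s := s) u ⁻¹' Set.Iio ((cauchySize (s := s) u t + Γ T) / 2)) ∩
      {τ | |τ| < T}, ?_, ⟨⟨hJI ht, hz⟩, hT⟩, fun τ hτ => hτ.1.1, by linarith, by linarith,
    (hΓ.2 T ⟨hT0, le_rfl⟩).2.1, fun τ hτ => le_of_lt hτ.2, fun τ hτ => le_of_lt hτ.1.2,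
    summable_iteratedBound hr hf hT0 hΓ⟩
  exact ((hu.continuousOn_cauchySize hI).isOpen_inter_preimage hI isOpen_Iio).inter
    (isOpen_lt continuous_abs continuous_const)

theorem eq_of_continuousOn_of_hasDerivAt_zero {J : Set ℝ} (hJ : J.OrdConnected) {α : ℝ → ℝ}
    (hc : ContinuousOn α J) (hd : ∀ t ∈ interior J, HasDerivAt α 0 t) {t t' : ℝ} (ht : t ∈ J)
    (ht' : t' ∈ J) : α t = α t' := by
  have hJ' : Convex ℝ J := hJ.convex
  have hdiff : DifferentiableOn ℝ α (interior J) := fun t ht =>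
    (hd t ht).differentiableAt.differentiableWithinAt
  have h1 := monotoneOn_of_deriv_nonneg hJ' hc hdiff fun t ht => (hd t ht).deriv.ge
  have h2 := antitoneOn_of_deriv_nonpos hJ' hc hdiff fun t ht => (hd t ht).deriv.le
  rcases le_total t t' with h | h
  · exact le_antisymm (h1 ht ht' h) (h2 ht ht' h)
  · exact le_antisymm (h2 ht' ht h) (h1 ht' ht h)

end Conservation

end KleinGordon

/-! ### The main theorem. -/

open KleinGordon in
theorem mainTheorem2 (n : ℕ) (m s : ℝ) [Fact (0 < m)]
    (V : FormalMultilinearSeries ℝ (Data n m s) (Sobolev n m s)) (hV : IsSymmetric V)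
    (hV₀ : 0 < V.radius)
    (I : Set ℝ) (hI : IsOpen I) (hI' : I.OrdConnected)
    (u : ℝ → Sobolev n m (s + 1)) (hu : TimeRegular (s := s) I u)
    (J : Set ℝ) (hJI : J ⊆ I) (hJ : J.OrdConnected)
    (r : ℝ) (hr : 0 < r) (hr₀ : ENNReal.ofReal r < V.radius)
    (hsup : (⨆ t ∈ J, flow (majorant V) V.radius |t| (cauchySize (s := s) u t)) < ENNReal.ofReal r)
    (f : Series n m s) (hf : f ∈ Fock n m s r) :
    (∀ t ∈ J, cauchySize (s := s) u t < radiusAt V r t ∧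
      ∃! a : ℝ, IsAlpha V u (radiusAt V r t) t f a) ∧
    (IsWeakSolution (interior J) u (fun t => V.sum (cauchyData u t)) →
      ∃ c : ℝ, ∀ t ∈ J, IsAlpha V u (radiusAt V r t) t f c) := by
  have hα : ∀ t ∈ J, cauchySize (s := s) u t < radiusAt V r t ∧ IsAlpha V u (radiusAt V r t) t f
      (orderedExpAt (interaction V) f (tangentSolution (s := s) u) t) := by
    intro t ht
    obtain ⟨T, hT, Γ, hΓ, hlt⟩ := exists_trajectory_of_iSup_lt hr₀ hsup ht
    have hΓt := hΓ.mono hT.le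
    have hρ : cauchySize (s := s) u t < radiusAt V r t := by
      rw [radiusAt_eq hr₀ hΓt]
      exact hlt.trans_le (hΓ.antitoneOn (fun q => norm_nonneg _) ⟨abs_nonneg t, hT.le⟩
        ⟨(abs_nonneg t).trans hT.le, le_rfl⟩ hT.le)
    refine ⟨hρ, isAlpha_orderedExpAt hρ hf.1 ?_⟩
    rw [radiusAt_eq hr₀ hΓt]
    exact summable_iteratedBound hr hf (abs_nonneg t) hΓt
  refine ⟨fun t ht => ⟨(hα t ht).1, _, (hα t ht).2, fun a ha => ha.unique (hα t ht).2⟩, fun h => ?_⟩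
  rcases J.eq_empty_or_nonempty with rfl | ⟨t₁, ht₁⟩
  · exact ⟨0, fun t ht => absurd ht (Set.notMem_empty t)⟩
  refine ⟨_, fun t ht => eq_of_continuousOn_of_hasDerivAt_zero hJ
    (α := orderedExpAt (interaction V) f (tangentSolution (s := s) u)) ?_ ?_ ht₁ ht ▸ (hα t ht).2⟩
  -- Continuity is needed on all of J. An end point of J in J is interior to I, where u is regular,
  -- so a neighbourhood in I is available there too; the equation plays no role in this step.
  · intro t ht
    obtain ⟨T, z, ρ, N, hN, htN, hNI, -, hzρ, -, hT, hz, hs⟩ :=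
      exists_nhds_bounds hI hu hJI hr hr₀ hsup hf ht
    refine ContinuousAt.continuousWithinAt ?_
    refine (continuousOn_orderedExpAt (norm_interaction_le V) (continuous_interaction V)
      ((hu.continuousOn_tangentSolution hI).mono hNI) hT (fun τ hτ => ?_) hs).continuousAt
      (hN.mem_nhds htN)
    exact (norm_tangentSolution_le u τ).trans ((hz τ hτ).trans hzρ.le)
  · intro t ht
    obtain ⟨T, z, ρ, N, hN, htN, hNI, hz0, hzρ, hρ, hT, hz, hs⟩ :=
      exists_nhds_bounds hI hu hJI hr hr₀ hsup hf (interior_subset ht)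
    -- On a ball inside both the neighbourhood with uniform bounds and the interior of J, the
    -- equation for u and the termwise estimates hold together.
    obtain ⟨ε, hε, hball⟩ := Metric.isOpen_iff.mp (hN.inter isOpen_interior) t ⟨htN, ht⟩
    have hu' : TimeRegular (s := s) (Metric.ball t ε) u :=
      hu.mono fun τ hτ => hNI (hball hτ).1
    have hR : ∀ τ ∈ Metric.ball t ε, ENNReal.ofReal (cauchySize (s := s) u τ) < V.radius :=
      fun τ hτ => (ENNReal.ofReal_le_ofReal ((hz τ (hball hτ).1).trans hzρ.le)).trans_lt hρ
    have hj := continuousOn_sum V Metric.isOpen_ball hu' hR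
    have h' := h.mono (fun τ hτ => (hball hτ).2 : Metric.ball t ε ⊆ interior J)
    exact hasDerivAt_orderedExpAt (norm_interaction_le V) (continuous_interaction V) hf.1 hz0 hzρ
      ((powSummable_norm V).2 z hz0 ((ENNReal.ofReal_le_ofReal hzρ.le).trans_lt hρ)) hs
      Metric.isOpen_ball (convex_ball t ε).isPreconnected
      (fun τ hτ => h'.hasDerivAt_tangentSolution Metric.isOpen_ball hu' hj hτ)
      (fun τ hτ => hasSum_interaction V (hR τ hτ)) (fun τ hτ => hT τ (hball hτ).1)
      (fun τ hτ => (norm_tangentSolution_le u τ).trans (hz τ (hball hτ).1))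
      (Metric.mem_ball_self hε)
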